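/- Let $n\ge 2$ be an integer, $p>n$ a prime, $q=p^{e}$ with $e\ge 1$, and let $\mathrm{ord}_p$ be the valuation of $\mathbb{C}_p$ with $\mathrm{ord}_p(p)=1$. Let $\mathbb{Q}_q\subset\mathbb{C}_p$ be the unramified extension of $\mathbb{Q}_p$ of degree $e$, $\mathbb{Z}_q$ its ring of integers, $\zeta_p\in\mathbb{C}_p$ a primitive $p$-th root of unity, $\gamma\in\mathbb{Q}_p(\zeta_p)$ a zero of $\sum_{k\ge0}x^{p^k}/p^k$ with $\mathrm{ord}_p\gamma=\frac1{p-1}$, and $\tilde\gamma\in\mathbb{C}_p$ with $\tilde\gamma^n=\gamma$. Let $R=\mathbb{Z}_q[\tilde\gamma]$ be the ring of integers of $\mathbb{Q}_q(\zeta_p,\tilde\gamma)$, let $\sigma$ be the automorphism of $\mathbb{Q}_q(\zeta_p,\tilde\gamma)$ that fixes $\zeta_p$ and $\tilde\gamma$ and restricts to the Frobenius of $\mathbb{Q}_q/\mathbb{Q}_p$, and let $\bar t\in\mathbb{Z}_q$ be the Teichmüller representative of some $t\in\mathbb{F}_q^*$ (i.e. $\bar t^{\,q-1}=1$). For $(a,b)\in\mathbb{Z}^2$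 put $\omega(a,b)=\frac an+b+\frac{2n+1}{n}\max\{0,-a,-b\}$ and $(\widetilde{a,b})=\tilde\gamma^{\,n\omega(a,b)}x^ay^b$. Let $$\mathcal{C}_0=\Big\{\sum_{(a,b)\in\mathbb{Z}^2}\xi(a,b)(\widetilde{a,b})\ :\ \xi(a,b)\in R,\ \xi(a,b)\to0\text{ as }\omega(a,b)\to\infty\Big\}.$$ With $\gamma_i=\sum_{k=0}^{i}\gamma^{p^k}/p^k$ define on $\mathcal{C}_0$ the operators $$D_x=x\tfrac{\partial}{\partial x}+\sum_{i\ge0}\gamma_ip^i\Big(nx^{np^i}-\tfrac{\sigma^i(\bar t)}{x^{p^i}y^{p^i}}\Big),\qquad D_y=y\tfrac{\partial}{\partial y}+\sum_{i\ge0}\gamma_ip^i\Big(y^{p^i}-\tfrac{\sigma^i(\bar t)}{x^{p^i}y^{p^i}}\Big),$$ and let $H^2=\mathcal{C}_0/(D_x\mathcal{C}_0+D_y\mathcal{C}_0)$. Let $\Theta_\infty(x)=\exp\big(\sum_{k\ge0}(\gamma x)^{p^k}/p^k\big)$, $F_t(x,y)=\Theta_\infty(x^n)\,\Theta_\infty(y)\,\Theta_\infty(\bar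 t/(xy))$, and $\alpha_1=\sigma^{-1}\circ\psi_p\circ F_t$, where $F_t$ acts by multiplication, $\psi_p\big(\sum\eta(a,b)x^ay^b\big)=\sum\eta(pa,pb)x^ay^b$, and $\sigma^{-1}$ acts on coefficients. Let $\varepsilon_i=(i,0)$ for $0\le i\le n$ and $\varepsilon_i=(i-n,1)$ for $n+1\le i\le2n$. Let $0<\varpi<n$ be the integer with $p\varpi\equiv1\pmod n$, and put $$g(i)=\begin{cases}i,& i\in\{0,n,2n\},\\ \varpi i+n\lceil-\varpi i/n\rceil,&1\le i\le n-1,\\ n+\varpi i+n\lceil-\varpi i/n\rceil,&n+1\le i\le2n-1,\end{cases}\qquad \alpha_{i,j}=i-pj+n\Big\lceil\frac{pj-i}{n}\Big\rceil .$$ Then there are unique elements $\tilde A(\tilde\varepsilon_j,\tilde\varepsilon_i)\in R$ $(0\le i,j\le 2n)$ with $\alpha_1(\tilde\varepsilon_i)=\sum_{j=0}^{2n}\tilde A(\tilde\varepsilon_j,\tilde\varepsilon_i)\,\tilde\varepsilon_j$ in $H^2$ for all $0\le i\le 2n$, and they satisfy the following. (a) For all $0\le i,j\le2n$, $\mathrm{ord}_p\tilde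 A(\tilde\varepsilon_j,\tilde\varepsilon_i)\ge\frac jn$. (b) For all $0\le i\le2n$ and $0\le j<g(i)$, $\mathrm{ord}_p\tilde A(\tilde\varepsilon_j,\tilde\varepsilon_i)>\frac jn$; moreover $0\le g(i)\le 2n$ and $\mathrm{ord}_p\tilde A(\tilde\varepsilon_{g(i)},\tilde\varepsilon_i)=\frac{g(i)}n$. (c) If moreover $p>2n^2-n$, then for all $0\le i\le n$ and $0\le j\le n-1$ with $(i,j)\ne(n,0)$, $$\mathrm{ord}_p\tilde A(\tilde\varepsilon_j,\tilde\varepsilon_i)=\frac jn+\frac{(2n+1)\,\alpha_{i,j}}{n(p-1)}.$$ -/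

import Mathlib

open Filter Topology

noncomputable section

namespace Dwork

/-! ### Combinatorics of the Newton triangle with vertices `(-1,-1)`, `(n,0)`, `(0,1)` -/

/-- `n ω(a,b)`, where `ω(a,b) = a/n + b + ((2n+1)/n) max {0,-a,-b}` is the weight function. -/
def nwt (n : ℕ) (u : ℤ × ℤ) : ℤ :=
  u.1 + n * u.2 + (2 * n + 1) * max 0 (max (-u.1) (-u.2))

/-- Exponent vector of the monomial `ε_i`: `x^i` for `0 ≤ i ≤ n`, `x^(i-n) y` for
`n+1 ≤ i ≤ 2n`. -/
def eps (n i : ℕ) : ℤ × ℤ :=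
  if i ≤ n then ((i : ℤ), 0) else ((i : ℤ) - n, 1)

/-- `α_{i,j} = i - p j + n ⌈(p j - i)/n⌉`. -/
def alphaCoef (p n : ℕ) (i j : ℤ) : ℤ :=
  i - p * j + n * ⌈((p * j - i : ℤ) : ℚ) / (n : ℚ)⌉

/-- The integer `0 < ϖ < n` with `p ϖ ≡ 1 mod n` (for `n ≥ 2` prime to `p`). -/
def varpi (p n : ℕ) : ℕ := ((p : ZMod n)⁻¹).val

theorem varpi_spec {p n : ℕ} (hn : 2 ≤ n) (h : Nat.Coprime p n) :
    0 < varpi p n ∧ varpi p n < n ∧ p * varpi p n ≡ 1 [MOD n] := by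
  have : NeZero n := ⟨by omega⟩
  have : Fact (1 < n) := ⟨by omega⟩
  have h1 : (p : ZMod n) * ((varpi p n : ℕ) : ZMod n) = 1 := by
    rw [varpi, ZMod.natCast_val, ZMod.cast_id', id]
    exact ZMod.coe_mul_inv_eq_one p h
  refine ⟨Nat.pos_of_ne_zero fun h0 => ?_, ZMod.val_lt _, ?_⟩
  · rw [h0] at h1
    simp at h1
  · rw [← ZMod.natCast_eq_natCast_iff]
    push_cast
    exact h1

/-- The permutation `g` of `{0, …, 2n}`. -/
def g (p n i : ℕ) : ℤ :=
  if i = 0 ∨ i = n ∨ i = 2 * n then (i : ℤ)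
  else if i < n then
    varpi p n * i + n * ⌈(-(varpi p n * i : ℚ)) / (n : ℚ)⌉
  else
    n + varpi p n * i + n * ⌈(-(varpi p n * i : ℚ)) / (n : ℚ)⌉

/-! ### The Artin–Hasse series -/

/-- `∑_k x^(p^k) / p^k`, as a formal power series. -/
def logAH (p : ℕ) : PowerSeries ℚ :=
  open Classical in PowerSeries.mk fun m => if ∃ k : ℕ, m = p ^ k then 1 / (m : ℚ) else 0

/-- The Artin–Hasse series `exp (∑_k x^(p^k) / p^k)`. -/
def artinHasse (p : ℕ) : PowerSeries ℚ := (PowerSeries.exp ℚ).subst (logAH p)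

/-! ### The coefficient field -/

/-- The valuation `ord_p` attached to an absolute value with `|p| = 1/p`; `ord_p 0 = ∞`. -/
def ordp (p : ℕ) {K : Type*} [NormedField K] (x : K) : EReal :=
  open Classical in if x = 0 then ⊤ else ((-Real.logb p ‖x‖ : ℝ) : EReal)

/-- `γ` is a zero of `∑_k x^(p^k)/p^k` in `ℚ_p(ζ)` with `ord_p γ = 1/(p-1)`. -/
def IsDworkRoot (p : ℕ) [Fact p.Prime] (ζ γ : ℂ_[p]) : Prop :=
  γ ∈ IntermediateField.adjoin ℚ_[p] {ζ} ∧
  HasSum (fun k : ℕ => γ ^ p ^ k / (p : ℂ_[p]) ^ k) 0 ∧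
  ordp p γ = ((1 / ((p : ℝ) - 1) : ℝ) : EReal)

/-- The field `Ω₀(γ̃) = ℚ_q(ζ_p, γ̃)`, `q = p^a`. Here `ℚ_q`, the unramified extension of `ℚ_p`
of degree `a`, is generated by the solutions of `z^q = z`. -/
def Omega (p : ℕ) [Fact p.Prime] (a : ℕ) (ζ γt : ℂ_[p]) : IntermediateField ℚ_[p] ℂ_[p] :=
  IntermediateField.adjoin ℚ_[p] ({z | z ^ p ^ a = z} ∪ {ζ, γt})

/-- `ζ` as an element of `Ω₀(γ̃)`. -/
def zetaIn (p : ℕ) [Fact p.Prime] (a : ℕ) (ζ γt : ℂ_[p]) : Omega p a ζ γt :=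
  ⟨ζ, IntermediateField.subset_adjoin _ _ (by simp)⟩

/-- `γ̃` as an element of `Ω₀(γ̃)`. -/
def gammaIn (p : ℕ) [Fact p.Prime] (a : ℕ) (ζ γt : ℂ_[p]) : Omega p a ζ γt :=
  ⟨γt, IntermediateField.subset_adjoin _ _ (by simp)⟩

/-- The automorphism `σ` of `Ω₀(γ̃)` that restricts to the Frobenius automorphism of `ℚ_q` (the
`p`-th power map on Teichmüller representatives) and fixes `ζ_p` and `γ̃`. As these elements
generate `Ω₀(γ̃)`, there is only one such automorphism. -/
def IsFrobenius {p : ℕ} [Fact p.Prime] {a : ℕ} {ζ γt : ℂ_[p]}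
    (σ : Omega p a ζ γt ≃ₐ[ℚ_[p]] Omega p a ζ γt) : Prop :=
  (∀ z : Omega p a ζ γt, z ^ p ^ a = z → σ z = z ^ p) ∧
  σ (zetaIn p a ζ γt) = zetaIn p a ζ γt ∧ σ (gammaIn p a ζ γt) = gammaIn p a ζ γt

/-! ### Spaces of series and operators

In this section `γt` stands for `γ̃` (so that `γ = γt ^ n`) and `tb` for the Teichmüller
representative of `t`. A Laurent series `∑ ξ(a,b) x^a y^b` is given by its coefficient function
`ℤ × ℤ → K`. -/

section

variable {K : Type*} [NormedField K]

/-- Coefficients of the splitting function `Θ_∞(x) = E(γ x) = ∑ a_k x^k`. -/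
def thetaCoeff (p : ℕ) (γ : K) (k : ℕ) : K :=
  ((PowerSeries.coeff k (artinHasse p) : ℚ) : K) * γ ^ k

/-- The coefficient `B(a,b)` of `x^a y^b` in
`F_t(x,y) = Θ_∞(x^n) Θ_∞(y) Θ_∞(tb/(xy))`; the triple is `(k,l,m)`, for the term
`(tb/(xy))^k (x^n)^l y^m`. -/
def Bcoeff (p n : ℕ) (γt tb : K) (u : ℤ × ℤ) : K :=
  ∑' s : ℕ × ℕ × ℕ,
    if (n : ℤ) * s.2.1 - s.1 = u.1 ∧ (s.2.2 : ℤ) - s.1 = u.2 then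
      thetaCoeff p (γt ^ n) s.1 * tb ^ s.1 * thetaCoeff p (γt ^ n) s.2.1
        * thetaCoeff p (γt ^ n) s.2.2
    else 0

/-- The space `C₀` of series `∑ ξ(a,b) γ̃^(n ω(a,b)) x^a y^b` with integral `ξ(a,b)` that tend to
`0` as `ω(a,b) → ∞` (equivalently along the cofinite filter, since only finitely many lattice
points have bounded weight). -/
def C0 (n : ℕ) (γt : K) : Set (ℤ × ℤ → K) :=
  {η | ∃ ξ : ℤ × ℤ → K, (∀ u, ‖ξ u‖ ≤ 1) ∧ Tendsto ξ cofinite (𝓝 0) ∧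
    ∀ u, η u = ξ u * γt ^ nwt n u}

/-- The element `γ̃^(n ω(u)) x^(u.1) y^(u.2)` of `C₀`. -/
def mono (n : ℕ) (γt : K) (u : ℤ × ℤ) : ℤ × ℤ → K :=
  Pi.single u (γt ^ nwt n u)

/-- Multiplication by `F_t`. -/
def mulF (p n : ℕ) (γt tb : K) (η : ℤ × ℤ → K) (u : ℤ × ℤ) : K :=
  ∑' v : ℤ × ℤ, Bcoeff p n γt tb (u - v) * η v

/-- `ψ_p : ∑ η(a,b) x^a y^b ↦ ∑ η(pa,pb) x^a y^b`. -/
def psi (p : ℕ) (η : ℤ × ℤ → K) (u : ℤ × ℤ) : K := η (p * u.1, p * u.2)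

/-- `α₁ = σ⁻¹ ∘ ψ_p ∘ F_t`. -/
def alpha1 (p n : ℕ) (γt tb : K) (σ : K ≃+* K) (η : ℤ × ℤ → K) (u : ℤ × ℤ) : K :=
  σ.symm (psi p (mulF p n γt tb η) u)

/-- `γ_i = ∑_{k=0}^i γ^(p^k) / p^k`. -/
def gammaSeq (p : ℕ) (γ : K) (i : ℕ) : K :=
  ∑ k ∈ Finset.range (i + 1), γ ^ p ^ k / (p : K) ^ k

/-- `D_x = x ∂/∂x + ∑_i γ_i p^i (n x^(n p^i) - σ^i(tb) / (x^(p^i) y^(p^i)))`. -/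
def Dx (p n : ℕ) (γt tb : K) (σ : K ≃+* K) (η : ℤ × ℤ → K) (u : ℤ × ℤ) : K :=
  (u.1 : K) * η u + ∑' i : ℕ, gammaSeq p (γt ^ n) i * (p : K) ^ i *
    ((n : K) * η (u.1 - n * p ^ i, u.2) - σ^[i] tb * η (u.1 + p ^ i, u.2 + p ^ i))

/-- `D_y = y ∂/∂y + ∑_i γ_i p^i (y^(p^i) - σ^i(tb) / (x^(p^i) y^(p^i)))`. -/
def Dy (p n : ℕ) (γt tb : K) (σ : K ≃+* K) (η : ℤ × ℤ → K) (u : ℤ × ℤ) : K :=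
  (u.2 : K) * η u + ∑' i : ℕ, gammaSeq p (γt ^ n) i * (p : K) ^ i *
    (η (u.1, u.2 - p ^ i) - σ^[i] tb * η (u.1 + p ^ i, u.2 + p ^ i))

/-- `β` and `β'` have the same class in the top cohomology
`H² = C₀ / (D_x C₀ + D_y C₀)` of the complex `C₀ → C₀ ⊕ C₀ → C₀` built from `D_x`, `D_y`. -/
def EqInH2 (p n : ℕ) (γt tb : K) (σ : K ≃+* K) (β β' : ℤ × ℤ → K) : Prop :=
  ∃ ζx ∈ C0 n γt, ∃ ζy ∈ C0 n γt,
    β - β' = Dx p n γt tb σ ζx + Dy p n γt tb σ ζy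

/-- `A j i` is the coefficient `Ã(ε̃_j, ε̃_i)`: the matrix `A` has entries in the ring of integers
and `α₁(ε̃_i) = ∑_j A j i • ε̃_j` in `H²` for `0 ≤ i ≤ 2n`. -/
def IsFrobeniusMatrix (p n : ℕ) (γt tb : K) (σ : K ≃+* K)
    (A : Matrix (Fin (2 * n + 1)) (Fin (2 * n + 1)) K) : Prop :=
  (∀ j i, ‖A j i‖ ≤ 1) ∧
  ∀ i : Fin (2 * n + 1), EqInH2 p n γt tb σ
    (alpha1 p n γt tb σ (mono n γt (eps n i)))
    (∑ j : Fin (2 * n + 1), A j i • mono n γt (eps n j))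

end

end Dwork

end

noncomputable section

namespace Dwork

/-! ### Ultrametric norms and sums -/

/-! Write t for the Teichmüller constant `tb`, and wt = nω for the integral weight. The operators
D_x and D_y are perturbations of multiplication by γ(n x^n − t/(xy)) and γ(y − t/(xy)). Modulo these
leading parts n x^n = y = t/(xy), that is, x y² = t and x^(n+1) y = t/n. Hence monomials whose
exponents differ by the lattice spanned by (1,2) and (n+1,1) agree up to units. This lattice has
index 2n+1 and the exponents ε_j represent its cosets. The three monomials x^n, y, 1/(xy) all have
weight n, and every monomial can be rewritten as a unit multiple of some ε_j without raising the
weight (`exists_reducesTo`). Each rewriting puts a factor γ⁻¹ into a cofactor, whose weight is lower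
by n; a series whose coefficients decay like a power of |γ̃|^wt can afford this.

The rest of D_x and D_y, namely the derivation and the terms i ≥ 1, is small. Since ∑ γ^(p^k)/p^k =
0, the partial sum γ_i is minus a tail of that series, and so |γ_i p^i| ≤ |γ|^(p^(i+1) − p + 1)
(`norm_gammaSeq_le`). Reduction modulo the leading parts can therefore be iterated and converges
(`exists_reduction`). It respects all decay rates |γ̃|^(k wt) with 1 ≤ k ≤ p.

Uniqueness holds because the leading parts form a regular sequence, with control of norms
(`eq_zero_of_basisSum_eq_lead`, `exists_of_lead_eq_zero`). A relation among basis monomials can be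
rewritten with smaller and smaller preimages (`exists_smaller_preimage`), so it is trivial. Elements
of C₀ are treated by truncation (`eq_zero_of_basisSum_eq`).

For the valuations, integrality of the Artin–Hasse series bounds the k-th coefficient of Θ_∞ by
|γ|^k, with equality for k < p. The coefficient of α₁(ε̃_i) at w is a sum over the solutions of p w
= ε_i + k(−1,−1) + l(n,0) + m(0,1), with terms of size at most |γ̃|^(i + n(k+l+m)). Subadditivity of
the weight gives i + n(k+l+m) ≥ p wt(w) (`p_mul_wt_le`). After reduction the entry at ε_j is at most
|γ̃|^(pj), and division by γ̃^j leaves |γ̃|^((p−1)j), of order j/n: this is (a). For (b), among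
weights at most g(i) equality holds only at ε_{g(i)} (`eq_eps_of_p_mul_wt_eq`), where a single term
dominates. For (c), the dominant term at ε_j exceeds the minimal exponent by (2n+1)α_{i,j}, while
reduction changes it only from the excess p − 1 onwards. -/

theorem norm_add_le_of_le {K : Type*} [SeminormedAddCommGroup K] [IsUltrametricDist K] {x y : K}
    {C : ℝ} (hx : ‖x‖ ≤ C) (hy : ‖y‖ ≤ C) : ‖x + y‖ ≤ C :=
  (IsUltrametricDist.norm_add_le_max x y).trans (max_le hx hy)

theorem norm_sub_le_of_le {K : Type*} [SeminormedAddCommGroup K] [IsUltrametricDist K] {x y : K}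
    {C : ℝ} (hx : ‖x‖ ≤ C) (hy : ‖y‖ ≤ C) : ‖x - y‖ ≤ C := by
  rw [sub_eq_add_neg]
  exact norm_add_le_of_le hx (by rwa [norm_neg])

/-! ### Integrality of the Artin–Hasse series -/

open PowerSeries in
/-- **Dwork's lemma**: if `F(0) = 1` and `F(X)^p / F(X^p)` lies in `1 + p X ℤ_p⟦X⟧`, then `F` has
coefficients in `ℤ_p`. -/
theorem norm_coeff_le_one_of_pow_eq_expand_mul {p : ℕ} [hp : Fact p.Prime] {F U : PowerSeries ℚ_[p]}
    (hF : constantCoeff F = 1) (hU : constantCoeff U = 1)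
    (hUp : ∀ j, j ≠ 0 → ‖coeff j U‖ ≤ (p : ℝ)⁻¹)
    (h : F ^ p = expand p hp.out.ne_zero F * U) (k : ℕ) : ‖coeff k F‖ ≤ 1 := by
  induction k using Nat.strong_induction_on with
  | _ k ih =>
  rcases Nat.eq_zero_or_pos k with rfl | hk
  · simp [coeff_zero_eq_constantCoeff_apply, hF]
  have hp0 : (0 : ℝ) < p := by exact_mod_cast hp.out.pos
  -- the truncation of `F` below degree `k`, with coefficients in `ℤ_p`
  let c : ℕ → ℤ_[p] := fun i => if hi : i < k then ⟨coeff i F, ih i hi⟩ else 0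
  have hc : ∀ i, i < k → (c i : ℚ_[p]) = coeff i F := fun i hi => by simp [c, hi]
  let P : Polynomial ℤ_[p] := ∑ i ∈ Finset.range k, Polynomial.monomial i (c i)
  have hPc : ∀ i, P.coeff i = if i < k then c i else 0 := by
    intro i
    simp [P, Polynomial.coeff_monomial]
  let ι : ℤ_[p] →+* ℚ_[p] := PadicInt.Coe.ringHom
  have hι : ∀ x, ι x = (x : ℚ_[p]) := fun x => rfl
  let Q : PowerSeries ℚ_[p] := ((P.map ι : Polynomial ℚ_[p]) : PowerSeries ℚ_[p])
  have hQc : ∀ i, coeff i Q = if i < k then coeff i F else 0 := by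
    intro i
    simp only [Q, Polynomial.coeff_coe, Polynomial.coeff_map, hPc, hι]
    split_ifs with hi
    · exact hc i hi
    · simp
  -- the remainder
  obtain ⟨R, hR⟩ : ∃ R, F - Q = X ^ k * R := by
    rw [← dvd_iff_exists_eq_mul_right, X_pow_dvd_iff]
    intro m hm
    simp [hQc, hm]
  have hR0 : constantCoeff R = coeff k F := by
    have := congrArg (coeff k) hR
    simpa [hQc, coeff_X_pow_mul'] using this.symm
  have hFQ : F = Q + X ^ k * R := by rw [← hR]; ring
  -- In (Q + X^k R)^p the linear term contributes p times the k-th coefficient of F in degree k; the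
  -- quadratic remainder starts in degree 2k > k.
  obtain ⟨z, hz⟩ := Polynomial.powAddExpansion Q (X ^ k * R) p
  have hQ0 : constantCoeff Q = 1 := by
    rw [← coeff_zero_eq_constantCoeff_apply, hQc, if_pos hk, coeff_zero_eq_constantCoeff_apply, hF]
  have hlhs : coeff k (F ^ p) = coeff k (Q ^ p) + p * coeff k F := by
    conv_lhs => rw [hFQ, hz]
    rw [map_add, map_add]
    have h1 : coeff k ((p : PowerSeries ℚ_[p]) * Q ^ (p - 1) * (X ^ k * R)) = p * coeff k F := by
      rw [show (p : PowerSeries ℚ_[p]) * Q ^ (p - 1) * (X ^ k * R)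
        = X ^ k * ((p : PowerSeries ℚ_[p]) * Q ^ (p - 1) * R) by ring,
        coeff_X_pow_mul', if_pos le_rfl, Nat.sub_self, coeff_zero_eq_constantCoeff_apply]
      simp [hQ0, hR0]
    have h2 : coeff k (z * (X ^ k * R) ^ 2) = 0 := by
      rw [show z * (X ^ k * R) ^ 2 = X ^ (k + k) * (z * R ^ 2) by ring, coeff_X_pow_mul',
        if_neg (by omega)]
    rw [h1, h2, add_zero]
  -- congruence of `Q ^ p` with `Q(X^p)`
  have hfrob : ‖coeff k (Q ^ p) - coeff k (expand p hp.out.ne_zero F)‖ ≤ (p : ℝ)⁻¹ := by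
    have hmap : (P ^ p - Polynomial.expand _ p P).map (PadicInt.toZMod (p := p)) = 0 := by
      rw [Polynomial.map_sub, Polynomial.map_pow, Polynomial.map_expand, ZMod.expand_card, sub_self]
    have hk0 : PadicInt.toZMod ((P ^ p - Polynomial.expand _ p P).coeff k) = 0 := by
      rw [← Polynomial.coeff_map, hmap, Polynomial.coeff_zero]
    have hmem := (RingHom.mem_ker (f := PadicInt.toZMod (p := p))).2 hk0
    rw [PadicInt.ker_toZMod, PadicInt.maximalIdeal_eq_span_p, ← pow_one ((p : ℤ_[p])),
      ← PadicInt.norm_le_pow_iff_mem_span_pow] at hmem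
    have he : (((P ^ p - Polynomial.expand _ p P).coeff k : ℤ_[p]) : ℚ_[p])
        = coeff k (Q ^ p) - coeff k (expand p hp.out.ne_zero F) := by
      rw [Polynomial.coeff_sub, PadicInt.coe_sub]
      congr 1
      · rw [← hι, ← Polynomial.coeff_map, Polynomial.map_pow, ← Polynomial.coeff_coe,
          Polynomial.coe_pow]
      · rw [Polynomial.coeff_expand hp.out.pos, PowerSeries.coeff_expand]
        split_ifs with hd
        · have : k / p < k := Nat.div_lt_self hk hp.out.one_lt
          rw [hPc, if_pos this, hc _ this]
        · simp
    rw [← he, ← PadicInt.norm_def]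
    simpa only [Nat.cast_one, zpow_neg, zpow_one] using hmem
  have hrhs : ‖coeff k (expand p hp.out.ne_zero F * U) - coeff k (expand p hp.out.ne_zero F)‖
      ≤ (p : ℝ)⁻¹ := by
    rw [coeff_mul, ← Finset.add_sum_erase _ _ (a := (k, 0)) (by simp)]
    rw [coeff_zero_eq_constantCoeff_apply, hU, mul_one, add_sub_cancel_left]
    refine IsUltrametricDist.norm_sum_le_of_forall_le_of_nonneg (by positivity) ?_
    rintro ⟨i, j⟩ hij
    simp only [Finset.mem_erase, Finset.HasAntidiagonal.mem_antidiagonal, ne_eq,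
      Prod.mk.injEq, not_and] at hij
    have hj : j ≠ 0 := fun h0 => hij.1 (by omega) h0
    have h1 : ‖coeff i (expand p hp.out.ne_zero F)‖ ≤ 1 := by
      rw [PowerSeries.coeff_expand]
      split_ifs with hd
      · exact ih _ (lt_of_le_of_lt (Nat.div_le_self _ _) (by omega))
      · simp
    rw [norm_mul]
    calc _ ≤ 1 * (p : ℝ)⁻¹ := mul_le_mul h1 (hUp j hj) (norm_nonneg _) zero_le_one
      _ = _ := one_mul _
  have hfin : ‖(p : ℚ_[p]) * coeff k F‖ ≤ (p : ℝ)⁻¹ := by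
    have : (p : ℚ_[p]) * coeff k F
        = (coeff k (expand p hp.out.ne_zero F * U) - coeff k (expand p hp.out.ne_zero F))
          - (coeff k (Q ^ p) - coeff k (expand p hp.out.ne_zero F)) := by
      rw [← h, hlhs]; ring
    rw [this]
    exact norm_sub_le_of_le hrhs hfrob
  rw [norm_mul, Padic.norm_p] at hfin
  have := inv_pos.2 hp0
  nlinarith

/-- Legendre: (p − 1) v_p(j!) < j, hence v_p(j!) ≤ j − 1. It serves to show that exp(pX) is 1 plus
terms divisible by p. -/
theorem norm_pow_div_factorial_le {p : ℕ} [hp : Fact p.Prime] {j : ℕ} (hj : j ≠ 0) :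
    ‖(p : ℚ_[p]) ^ j / (j.factorial : ℚ_[p])‖ ≤ (p : ℝ)⁻¹ := by
  have hp1 : (1 : ℝ) < p := by exact_mod_cast hp.out.one_lt
  have h := sub_one_mul_padicValNat_factorial_lt_of_ne_zero p hj
  have hv : padicValNat p j.factorial + 1 ≤ j := by
    have h2 := hp.out.two_le
    have : padicValNat p j.factorial ≤ (p - 1) * padicValNat p j.factorial :=
      Nat.le_mul_of_pos_left _ (by omega)
    omega
  have hf : ‖(j.factorial : ℚ_[p])‖ = (p : ℝ) ^ (-(padicValNat p j.factorial : ℤ)) := by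
    rw [Padic.norm_eq_zpow_neg_valuation (by exact_mod_cast j.factorial_ne_zero),
      Padic.valuation_natCast]
  rw [norm_div, norm_pow, Padic.norm_p, hf, zpow_neg, zpow_natCast, div_inv_eq_mul, inv_pow]
  rw [inv_mul_le_iff₀ (by positivity), ← div_eq_mul_inv, le_div_iff₀ (by positivity), ← pow_succ]
  exact pow_le_pow_right₀ hp1.le hv

open PowerSeries in
-- The quotient F/H has derivative zero and constant term 1.
theorem eq_of_derivative_eq_mul {F H A : PowerSeries ℚ} (hF : derivative ℚ F = A * F)
    (hH : derivative ℚ H = A * H) (hF0 : constantCoeff F = 1) (hH0 : constantCoeff H = 1) :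
    F = H := by
  have hHi : H * H⁻¹ = 1 := PowerSeries.mul_inv_cancel _ (by simp [hH0])
  have h1 : F * H⁻¹ = 1 := by
    refine derivative.ext ?_ ?_
    · rw [Derivation.leibniz, derivative_inv', hF, hH, derivative_one, smul_eq_mul, smul_eq_mul]
      linear_combination (-F * A * H⁻¹) * hHi
    · simp [hF0, hH0]
  linear_combination H * h1 - F * hHi

/-! ### Functional equation of the Artin–Hasse exponential. -/

section

open PowerSeries

theorem coeff_logAH (p m : ℕ) [Decidable (∃ k : ℕ, m = p ^ k)] :
    coeff m (logAH p) = if ∃ k : ℕ, m = p ^ k then 1 / (m : ℚ) else 0 := by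
  rw [logAH, coeff_mk]
  congr

theorem constantCoeff_logAH (p : ℕ) : constantCoeff (logAH p) = 0 := by
  classical
  rw [← coeff_zero_eq_constantCoeff_apply, coeff_logAH]
  split_ifs <;> simp

theorem hasSubst_logAH (p : ℕ) : HasSubst (logAH p) :=
  HasSubst.of_constantCoeff_zero' (constantCoeff_logAH p)

theorem constantCoeff_artinHasse (p : ℕ) : constantCoeff (artinHasse p) = 1 := by
  have := PowerSeries.constantCoeff_subst_eq_zero (R := ℚ) (constantCoeff_logAH p)
    (exp ℚ - 1) (by simp)
  rw [subst_sub (hasSubst_logAH p)] at this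
  have h1 : subst (logAH p) (1 : PowerSeries ℚ) = 1 := by
    rw [← coe_substAlgHom (hasSubst_logAH p), map_one]
  rw [h1] at this
  have h2 : constantCoeff (artinHasse p) - constantCoeff (1 : PowerSeries ℚ) = 0 := by
    rw [← map_sub]; exact this
  simpa [sub_eq_zero] using h2

theorem derivative_artinHasse (p : ℕ) :
    derivative ℚ (artinHasse p) = derivative ℚ (logAH p) * artinHasse p := by
  rw [artinHasse, derivative_subst (hasSubst_logAH p), derivative_exp, mul_comm]

/-- Multiplication by p turns the term X^(p^(k+1))/p^(k+1) into the k-th term of the series in X^p;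
the term k = 0 leaves p X. -/
theorem nsmul_logAH {p : ℕ} (hp : p.Prime) :
    (p : PowerSeries ℚ) * logAH p = (p : PowerSeries ℚ) * X + expand p hp.ne_zero (logAH p) := by
  classical
  have hp0 : (p : ℚ) ≠ 0 := by exact_mod_cast hp.ne_zero
  ext m
  rw [map_add, PowerSeries.coeff_expand, ← map_natCast (C (R := ℚ)), coeff_C_mul, coeff_C_mul,
    coeff_X, coeff_logAH, coeff_logAH]
  by_cases h1 : m = 1
  · subst h1
    have : ¬ p ∣ 1 := by simpa using hp.ne_one
    rw [if_pos ⟨0, by simp⟩, if_neg this]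
    simp
  rw [if_neg h1, mul_zero, zero_add]
  by_cases hd : p ∣ m
  · obtain ⟨l, rfl⟩ := hd
    rw [if_pos (dvd_mul_right _ _), Nat.mul_div_cancel_left _ hp.pos]
    have : (∃ k, p * l = p ^ k) ↔ ∃ k, l = p ^ k := by
      constructor
      · rintro ⟨k, hk⟩
        cases k with
        | zero => exact absurd hk h1
        | succ k => exact ⟨k, Nat.eq_of_mul_eq_mul_left hp.pos (by rw [hk, pow_succ']) ⟩
      · rintro ⟨k, rfl⟩
        exact ⟨k + 1, by rw [pow_succ']⟩
    simp only [this]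
    split_ifs
    · push_cast
      field_simp
    · simp
  · rw [if_neg hd, if_neg, mul_zero]
    rintro ⟨k, rfl⟩
    cases k with
    | zero => exact h1 rfl
    | succ k => exact hd (dvd_pow_self _ k.succ_ne_zero)

/-- Exponential of `nsmul_logAH`. Both sides have constant term 1 and logarithmic derivative p L',
where L is `logAH p`. -/
theorem artinHasse_pow {p : ℕ} (hp : p.Prime) :
    artinHasse p ^ p = expand p hp.ne_zero (artinHasse p) * rescale (p : ℚ) (exp ℚ) := by
  have hX : HasSubst (X ^ p : PowerSeries ℚ) := HasSubst.X_pow hp.ne_zero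
  have hexpand : ∀ f : PowerSeries ℚ, derivative ℚ (expand p hp.ne_zero f)
      = expand p hp.ne_zero (derivative ℚ f) * derivative ℚ (X ^ p : PowerSeries ℚ) := by
    intro f
    rw [expand_apply, expand_apply, derivative_subst hX]
  have hresc : derivative ℚ (rescale (p : ℚ) (exp ℚ)) = p * rescale (p : ℚ) (exp ℚ) := by
    rw [← exp_pow_eq_rescale_exp, derivative_pow, derivative_exp]
    rw [mul_assoc, ← pow_succ, Nat.sub_add_cancel hp.one_le]
  have hL := congrArg (derivative ℚ) (nsmul_logAH hp)
  have hpc : derivative ℚ (p : PowerSeries ℚ) = 0 := by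
    rw [← map_natCast (C (R := ℚ)), derivative_C]
  rw [map_add, Derivation.leibniz, Derivation.leibniz, hexpand, hpc, derivative_X] at hL
  simp only [smul_eq_mul, mul_zero, add_zero, mul_one] at hL
  refine eq_of_derivative_eq_mul (A := p * derivative ℚ (logAH p)) ?_ ?_ ?_ ?_
  · rw [derivative_pow, derivative_artinHasse p]
    have : artinHasse p ^ p = artinHasse p ^ (p - 1) * artinHasse p := by
      rw [← pow_succ, Nat.sub_add_cancel hp.one_le]
    rw [this]
    ring
  · rw [Derivation.leibniz, hexpand, hresc, derivative_artinHasse p, map_mul, hL]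
    simp only [smul_eq_mul]
    ring
  · simp [constantCoeff_artinHasse p]
  · rw [map_mul, constantCoeff_expand, constantCoeff_artinHasse p,
      ← coeff_zero_eq_constantCoeff_apply, coeff_rescale]
    simp

/-- Dwork's lemma with U = exp(pX). -/
theorem norm_coeff_artinHasse_le {p : ℕ} [hp : Fact p.Prime] (k : ℕ) :
    ‖((coeff k (artinHasse p) : ℚ) : ℚ_[p])‖ ≤ 1 := by
  let i : ℚ →+* ℚ_[p] := Rat.castHom _
  have h := congrArg (PowerSeries.map i) (artinHasse_pow hp.out)
  rw [map_pow, map_mul, map_expand] at h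
  have := norm_coeff_le_one_of_pow_eq_expand_mul
    (F := PowerSeries.map i (artinHasse p)) (U := PowerSeries.map i (rescale (p : ℚ) (exp ℚ)))
    ?_ ?_ ?_ h k
  · simpa [i] using this
  · rw [← coeff_zero_eq_constantCoeff_apply, coeff_map, coeff_zero_eq_constantCoeff_apply,
      constantCoeff_artinHasse p, map_one]
  · rw [← coeff_zero_eq_constantCoeff_apply, coeff_map, coeff_rescale]
    simp
  · intro j hj
    rw [coeff_map, coeff_rescale, coeff_exp]
    simpa [i, div_eq_mul_inv] using norm_pow_div_factorial_le (p := p) hj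

/-- In E' = L' E the derivative L' is 1 up to terms of degree at least p − 1, so the recursion for
the coefficients is that of exp below degree p. -/
theorem coeff_artinHasse_of_lt {p k : ℕ} (hk : k < p) :
    coeff k (artinHasse p) = 1 / (k.factorial : ℚ) := by
  classical
  induction k with
  | zero => simp [coeff_zero_eq_constantCoeff_apply, constantCoeff_artinHasse p]
  | succ k ih =>
    have h := congrArg (coeff k) (derivative_artinHasse p)
    rw [coeff_derivative, coeff_mul, Finset.sum_eq_single (0, k)] at h
    · have h1 : coeff 1 (logAH p) = 1 := by
        rw [coeff_logAH, if_pos ⟨0, by simp⟩]; simp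
      rw [coeff_derivative, zero_add, h1, ih (by omega)] at h
      have hk0 : ((k : ℚ) + 1) ≠ 0 := by positivity
      rw [eq_div_of_mul_eq hk0 h, Nat.factorial_succ]
      push_cast
      field_simp
      simp
    · rintro ⟨i, j⟩ hij hne
      rw [Finset.HasAntidiagonal.mem_antidiagonal] at hij
      simp only at hij
      have hi : i ≠ 0 := fun h0 => hne (by subst h0; simp at hij; simp [hij])
      rw [coeff_derivative, coeff_logAH, if_neg, zero_mul, zero_mul]
      rintro ⟨l, hl⟩
      cases l with
      | zero => simp at hl; exact hi hl
      | succ l =>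
        have : p ≤ p ^ (l + 1) := Nat.le_self_pow l.succ_ne_zero p
        omega
    · intro h0
      simp at h0

end

/-! ### The weight function -/

theorem le_nwt (n : ℕ) (u : ℤ × ℤ) : u.1 + n * u.2 ≤ nwt n u ∧ n * u.2 - 2 * n * u.1 ≤ nwt n u ∧
    u.1 - (n + 1) * u.2 ≤ nwt n u := by
  unfold nwt
  have h0 : (0 : ℤ) ≤ max 0 (max (-u.1) (-u.2)) := le_max_left _ _
  have h1 : -u.1 ≤ max 0 (max (-u.1) (-u.2)) := (le_max_left _ _).trans (le_max_right _ _)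
  have h2 : -u.2 ≤ max 0 (max (-u.1) (-u.2)) := (le_max_right _ _).trans (le_max_right _ _)
  have hn : (0 : ℤ) ≤ 2 * n + 1 := by positivity
  have := mul_le_mul_of_nonneg_left h0 hn
  have := mul_le_mul_of_nonneg_left h1 hn
  have := mul_le_mul_of_nonneg_left h2 hn
  refine ⟨?_, ?_, ?_⟩ <;> linarith

/-- The weight is given by one linear form on each of the three cones of the fan. -/
theorem nwt_cases (n : ℕ) (u : ℤ × ℤ) :
    (nwt n u = u.1 + n * u.2 ∧ 0 ≤ u.1 ∧ 0 ≤ u.2) ∨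
    (nwt n u = n * u.2 - 2 * n * u.1 ∧ u.1 ≤ 0 ∧ u.1 ≤ u.2) ∨
    (nwt n u = u.1 - (n + 1) * u.2 ∧ u.2 ≤ 0 ∧ u.2 ≤ u.1) := by
  unfold nwt
  by_cases h1 : 0 ≤ u.1 ∧ 0 ≤ u.2
  · left
    rw [max_eq_left (a := (0 : ℤ)) (max_le (by linarith [h1.1]) (by linarith [h1.2]))]
    exact ⟨by ring, h1.1, h1.2⟩
  · right
    rcases le_total u.1 u.2 with h | h
    · left
      have h0 : u.1 ≤ 0 := by
        by_contra hc
        exact h1 ⟨by omega, by omega⟩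
      rw [max_eq_left (a := -u.1) (by linarith), max_eq_right (by linarith)]
      exact ⟨by ring, h0, h⟩
    · right
      have h0 : u.2 ≤ 0 := by
        by_contra hc
        exact h1 ⟨by omega, by omega⟩
      rw [max_eq_right (a := -u.1) (by linarith), max_eq_right (by linarith)]
      exact ⟨by ring, h0, h⟩

theorem nwt_nonneg (n : ℕ) (u : ℤ × ℤ) : 0 ≤ nwt n u := by
  have hn : (0 : ℤ) ≤ n := by positivity
  rcases nwt_cases n u with ⟨h, h1, h2⟩ | ⟨h, h1, h2⟩ | ⟨h, h1, h2⟩ <;> rw [h]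
  · positivity
  · nlinarith
  · nlinarith

/-- The weight `n ω(u)` as a natural number. -/
def wt (n : ℕ) (u : ℤ × ℤ) : ℕ := (nwt n u).toNat

theorem coe_wt (n : ℕ) (u : ℤ × ℤ) : (wt n u : ℤ) = nwt n u := Int.toNat_of_nonneg (nwt_nonneg n u)

/-- The weight is the maximum of the three linear forms that represent it on the cones. Comparisons
of weights thus become linear inequalities. -/
theorem wt_le_iff {n : ℕ} {u : ℤ × ℤ} {m : ℕ} : wt n u ≤ m ↔ u.1 + n * u.2 ≤ m ∧
    n * u.2 - 2 * n * u.1 ≤ m ∧ u.1 - (n + 1) * u.2 ≤ m := by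
  rw [← Int.ofNat_le, coe_wt]
  obtain ⟨h1, h2, h3⟩ := le_nwt n u
  constructor
  · intro h
    exact ⟨by linarith, by linarith, by linarith⟩
  · rintro ⟨g1, g2, g3⟩
    rcases nwt_cases n u with ⟨h, -, -⟩ | ⟨h, -, -⟩ | ⟨h, -, -⟩ <;> rw [h] <;> assumption

theorem le_wt (n : ℕ) (u : ℤ × ℤ) : u.1 + n * u.2 ≤ wt n u ∧ n * u.2 - 2 * n * u.1 ≤ wt n u ∧
    u.1 - (n + 1) * u.2 ≤ wt n u := wt_le_iff.1 le_rfl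

theorem wt_cases (n : ℕ) (u : ℤ × ℤ) :
    ((wt n u : ℤ) = u.1 + n * u.2 ∧ 0 ≤ u.1 ∧ 0 ≤ u.2) ∨
    ((wt n u : ℤ) = n * u.2 - 2 * n * u.1 ∧ u.1 ≤ 0 ∧ u.1 ≤ u.2) ∨
    ((wt n u : ℤ) = u.1 - (n + 1) * u.2 ∧ u.2 ≤ 0 ∧ u.2 ≤ u.1) := by
  rw [coe_wt]
  exact nwt_cases n u

theorem wt_of_nonneg {n : ℕ} {u : ℤ × ℤ} (h1 : 0 ≤ u.1) (h2 : 0 ≤ u.2) :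
    (wt n u : ℤ) = u.1 + n * u.2 := by
  rw [coe_wt, nwt, max_eq_left (max_le (by linarith) (by linarith))]
  ring

theorem wt_of_fst_nonpos {n : ℕ} {u : ℤ × ℤ} (h1 : u.1 ≤ 0) (h2 : u.1 ≤ u.2) :
    (wt n u : ℤ) = n * u.2 - 2 * n * u.1 := by
  rw [coe_wt, nwt, max_eq_left (a := -u.1) (by linarith), max_eq_right (by linarith)]
  ring

theorem wt_of_snd_nonpos {n : ℕ} {u : ℤ × ℤ} (h1 : u.2 ≤ 0) (h2 : u.2 ≤ u.1) :
    (wt n u : ℤ) = u.1 - (n + 1) * u.2 := by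
  rw [coe_wt, nwt, max_eq_right (a := -u.1) (by linarith), max_eq_right (by linarith)]
  ring

/-- Subadditivity of the weight for multiples of (n,0). This and the next two lemmas, for (0,1) and
(−1,−1), control all shifts occurring in D_x and D_y. -/
theorem wt_le_sub_fst_add (n m : ℕ) (u : ℤ × ℤ) : wt n u ≤ wt n (u.1 - n * m, u.2) + n * m := by
  obtain ⟨h1, h2, h3⟩ := le_wt n (u.1 - n * m, u.2)
  simp only at h1 h2 h3
  rw [wt_le_iff]
  push_cast
  have : (0 : ℤ) ≤ n * m := by positivity
  have : (0 : ℤ) ≤ n * (n * m) := by positivity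
  refine ⟨?_, ?_, ?_⟩ <;> linarith

theorem wt_le_sub_snd_add (n m : ℕ) (u : ℤ × ℤ) : wt n u ≤ wt n (u.1, u.2 - m) + n * m := by
  obtain ⟨h1, h2, h3⟩ := le_wt n (u.1, u.2 - m)
  simp only at h1 h2 h3
  rw [wt_le_iff]
  push_cast
  have : (0 : ℤ) ≤ n * m := by positivity
  refine ⟨?_, ?_, ?_⟩ <;> linarith

theorem wt_le_add_add (n m : ℕ) (u : ℤ × ℤ) : wt n u ≤ wt n (u.1 + m, u.2 + m) + n * m := by
  obtain ⟨h1, h2, h3⟩ := le_wt n (u.1 + m, u.2 + m)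
  simp only at h1 h2 h3
  rw [wt_le_iff]
  push_cast
  have : (0 : ℤ) ≤ n * m := by positivity
  refine ⟨?_, ?_, ?_⟩ <;> linarith

theorem abs_le_wt {n : ℕ} (hn : 1 ≤ n) (u : ℤ × ℤ) : |u.1| ≤ wt n u ∧ |u.2| ≤ wt n u := by
  have hn' : (1 : ℤ) ≤ n := by exact_mod_cast hn
  have hw : (0 : ℤ) ≤ wt n u := by positivity
  rw [abs_le, abs_le]
  rcases wt_cases n u with ⟨h, h1, h2⟩ | ⟨h, h1, h2⟩ | ⟨h, h1, h2⟩ <;> rw [h]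
  · exact ⟨⟨by nlinarith, by nlinarith⟩, by nlinarith, by nlinarith⟩
  · exact ⟨⟨by nlinarith, by nlinarith⟩, by nlinarith, by nlinarith⟩
  · exact ⟨⟨by nlinarith, by nlinarith⟩, by nlinarith, by nlinarith⟩

theorem finite_wt_le {n : ℕ} (hn : 1 ≤ n) (N : ℕ) : {u | wt n u ≤ N}.Finite := by
  refine ((Set.finite_Icc (-(N : ℤ)) N).prod (Set.finite_Icc (-(N : ℤ)) N)).subset ?_
  intro u hu
  obtain ⟨h1, h2⟩ := abs_le_wt hn u
  have hu' : (wt n u : ℤ) ≤ N := by exact_mod_cast hu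
  rw [abs_le] at h1 h2
  exact ⟨⟨by linarith, by linarith⟩, by linarith, by linarith⟩

theorem tendsto_wt {n : ℕ} (hn : 1 ≤ n) : Tendsto (wt n) cofinite atTop := by
  rw [tendsto_atTop]
  intro N
  rw [eventually_cofinite]
  exact (finite_wt_le hn N).subset fun u hu => (not_le.1 hu).le

theorem tendsto_pow_wt {n : ℕ} (hn : 1 ≤ n) {r : ℝ} (h0 : 0 ≤ r) (h1 : r < 1) :
    Tendsto (fun u => r ^ wt n u) cofinite (𝓝 0) :=
  (tendsto_pow_atTop_nhds_zero_of_lt_one h0 h1).comp (tendsto_wt hn)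

theorem wt_eps (n i : ℕ) : wt n (eps n i) = i := by
  unfold eps
  rw [← Int.natCast_inj]
  split_ifs with h
  · rw [wt_of_nonneg (by simp) (by simp)]
    simp
  · rw [wt_of_nonneg (by simp; omega) (by simp)]
    simp

theorem eps_fst_nonneg (n i : ℕ) : 0 ≤ (eps n i).1 := by
  unfold eps
  split_ifs with h
  · simp
  · simp; omega

theorem eps_snd_nonneg (n i : ℕ) : 0 ≤ (eps n i).2 := by
  unfold eps
  split_ifs with h <;> simp

theorem eps_fst_add (n i : ℕ) : (eps n i).1 + n * (eps n i).2 = i := by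
  unfold eps
  split_ifs with h <;> simp

theorem eps_injective {n i j : ℕ} (h : eps n i = eps n j) : i = j := by
  have h1 := eps_fst_add n i
  rw [h, eps_fst_add] at h1
  omega

/-- Weight does not decrease in direction `(1,2)` on the upper half plane. -/
theorem wt_le_wt_add_line {n : ℕ} {u : ℤ × ℤ} (hu : 0 ≤ u.2) (l : ℕ) :
    wt n u ≤ wt n (u.1 + l, u.2 + 2 * l) := by
  obtain ⟨h1, h2, h3⟩ := le_wt n (u.1 + l, u.2 + 2 * l)
  simp only at h1 h2 h3
  have hl : (0 : ℤ) ≤ l := by positivity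
  have hnl : (0 : ℤ) ≤ n * l := by positivity
  have hnu : (0 : ℤ) ≤ n * u.2 := by positivity
  rw [← Int.ofNat_le]
  rcases wt_cases n u with ⟨h, g1, g2⟩ | ⟨h, g1, g2⟩ | ⟨h, g1, g2⟩
  · linarith
  · linarith
  · have : u.2 = 0 := le_antisymm g1 hu
    rw [h, this]
    rw [this] at h1
    linarith

/-- Weight does not decrease in direction `-(1,2)` on the lower half plane. -/
theorem wt_le_wt_sub_line {n : ℕ} {u : ℤ × ℤ} (hu : u.2 ≤ 0) (l : ℕ) :
    wt n u ≤ wt n (u.1 - l, u.2 - 2 * l) := by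
  obtain ⟨h1, h2, h3⟩ := le_wt n (u.1 - l, u.2 - 2 * l)
  simp only at h1 h2 h3
  have hl : (0 : ℤ) ≤ l := by positivity
  have hnl : (0 : ℤ) ≤ n * l := by positivity
  rw [← Int.ofNat_le]
  rcases wt_cases n u with ⟨h, g1, g2⟩ | ⟨h, g1, g2⟩ | ⟨h, g1, g2⟩
  · have : u.2 = 0 := le_antisymm hu g2
    rw [h, this]
    rw [this] at h3
    linarith
  · linarith
  · linarith

/-! ### The leading parts of the operators -/

section

variable {K : Type*} [NormedField K]

/-- Multiplication by `g (n x^n - t/(xy))`. -/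
def leadX (n : ℕ) (g t : K) (η : ℤ × ℤ → K) (u : ℤ × ℤ) : K :=
  g * (n * η (u.1 - n, u.2) - t * η (u.1 + 1, u.2 + 1))

/-- Multiplication by `g (y - t/(xy))`. -/
def leadY (g t : K) (η : ℤ × ℤ → K) (u : ℤ × ℤ) : K :=
  g * (η (u.1, u.2 - 1) - t * η (u.1 + 1, u.2 + 1))

theorem leadX_add (n : ℕ) (g t : K) (η η' : ℤ × ℤ → K) :
    leadX n g t (η + η') = leadX n g t η + leadX n g t η' := by
  funext u
  simp only [leadX, Pi.add_apply]
  ring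

theorem leadY_add (g t : K) (η η' : ℤ × ℤ → K) :
    leadY g t (η + η') = leadY g t η + leadY g t η' := by
  funext u
  simp only [leadY, Pi.add_apply]
  ring

theorem leadX_sub (n : ℕ) (g t : K) (η η' : ℤ × ℤ → K) :
    leadX n g t (η - η') = leadX n g t η - leadX n g t η' := by
  funext u
  simp only [leadX, Pi.sub_apply]
  ring

theorem leadY_sub (g t : K) (η η' : ℤ × ℤ → K) :
    leadY g t (η - η') = leadY g t η - leadY g t η' := by
  funext u
  simp only [leadY, Pi.sub_apply]
  ring

theorem leadX_smul (n : ℕ) (g t c : K) (η : ℤ × ℤ → K) :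
    leadX n g t (c • η) = c • leadX n g t η := by
  funext u
  simp only [leadX, Pi.smul_apply, smul_eq_mul]
  ring

theorem leadY_smul (g t c : K) (η : ℤ × ℤ → K) :
    leadY g t (c • η) = c • leadY g t η := by
  funext u
  simp only [leadY, Pi.smul_apply, smul_eq_mul]
  ring

theorem leadX_zero (n : ℕ) (g t : K) : leadX n g t 0 = 0 := by
  funext u
  simp [leadX]

theorem leadY_zero (g t : K) : leadY g t 0 = 0 := by
  funext u
  simp [leadY]

theorem leadX_leadY_comm (n : ℕ) (g t : K) (η : ℤ × ℤ → K) :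
    leadX n g t (leadY g t η) = leadY g t (leadX n g t η) := by
  funext u
  simp only [leadX, leadY]
  rw [show u.1 + 1 - (n : ℤ) = u.1 - n + 1 by ring, show u.2 + 1 - 1 = u.2 - 1 + 1 by ring]
  ring

theorem leadX_single (n : ℕ) (g t : K) (v : ℤ × ℤ) :
    leadX n g t (Pi.single v 1) = (g * n) • Pi.single (v.1 + n, v.2) (1 : K)
      - (g * t) • Pi.single (v.1 - 1, v.2 - 1) (1 : K) := by
  funext u
  have h1 : ((u.1 - (n : ℤ), u.2) = v) = (u = (v.1 + n, v.2)) := by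
    simp only [Prod.ext_iff, sub_eq_iff_eq_add]
  have h2 : ((u.1 + 1, u.2 + 1) = v) = (u = (v.1 - 1, v.2 - 1)) := by
    simp only [Prod.ext_iff, eq_sub_iff_add_eq]
  simp only [leadX, Pi.single_apply, Pi.sub_apply, Pi.smul_apply, smul_eq_mul, h1, h2]
  ring

theorem leadY_single (g t : K) (v : ℤ × ℤ) :
    leadY g t (Pi.single v 1) = g • Pi.single (v.1, v.2 + 1) (1 : K)
      - (g * t) • Pi.single (v.1 - 1, v.2 - 1) (1 : K) := by
  funext u
  have h1 : ((u.1, u.2 - 1) = v) = (u = (v.1, v.2 + 1)) := by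
    simp only [Prod.ext_iff, sub_eq_iff_eq_add]
  have h2 : ((u.1 + 1, u.2 + 1) = v) = (u = (v.1 - 1, v.2 - 1)) := by
    simp only [Prod.ext_iff, eq_sub_iff_add_eq]
  simp only [leadY, Pi.single_apply, Pi.sub_apply, Pi.smul_apply, smul_eq_mul, h1, h2]
  ring

/-- The hypotheses on the constants that enter the leading parts of the operators. -/
structure LeadingData (n : ℕ) (γt t : K) : Prop where
  two_le : 2 ≤ n
  norm_pos : 0 < ‖γt‖
  norm_lt_one : ‖γt‖ < 1
  norm_natCast : ‖(n : K)‖ = 1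
  norm_t : ‖t‖ = 1

namespace LeadingData

variable {n : ℕ} {γt t : K}

theorem gt_ne_zero (h : LeadingData n γt t) : γt ≠ 0 := norm_pos_iff.1 h.norm_pos

theorem t_ne_zero (h : LeadingData n γt t) : t ≠ 0 :=
  norm_pos_iff.1 (by rw [h.norm_t]; exact one_pos)

theorem n_ne_zero (h : LeadingData n γt t) : (n : K) ≠ 0 :=
  norm_pos_iff.1 (by rw [h.norm_natCast]; exact one_pos)

theorem norm_mul_le_one (h : LeadingData n γt t) {c : K} (hc : ‖c‖ = 1) :
    ‖(γt ^ n * c)⁻¹‖ * ‖γt‖ ^ n ≤ 1 := by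
  have : ‖γt‖ ^ n ≠ 0 := (pow_pos h.norm_pos n).ne'
  rw [norm_inv, norm_mul, hc, norm_pow, mul_one, inv_mul_cancel₀ this]

end LeadingData

/-! ### Reduction of monomials modulo the leading parts -/

/-- The monomial with exponent `w` is, modulo the leading parts of the operators, a multiple of
the basis monomial `ε_j`, and the cofactors have weight at most `wt w - n`. -/
def ReducesTo (n : ℕ) (γt t : K) (w : ℤ × ℤ) (j : ℕ) (c : K) (hx hy : ℤ × ℤ → K) : Prop :=
  j ≤ 2 * n ∧ j ≤ wt n w ∧ ‖c‖ ≤ 1 ∧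
  Pi.single w 1 = c • Pi.single (eps n j) (1 : K) + leadX n (γt ^ n) t hx + leadY (γt ^ n) t hy ∧
  (∀ u, hx u ≠ 0 → wt n u + n ≤ wt n w) ∧ (∀ u, hy u ≠ 0 → wt n u + n ≤ wt n w) ∧
  (∀ u, ‖hx u‖ * ‖γt‖ ^ n ≤ 1) ∧ (∀ u, ‖hy u‖ * ‖γt‖ ^ n ≤ 1)

theorem reducesTo_eps {n j : ℕ} (γt t : K) (hj : j ≤ 2 * n) :
    ReducesTo n γt t (eps n j) j 1 0 0 :=
  ⟨hj, (wt_eps n j).ge, by simp, by simp [leadX_zero, leadY_zero], by simp, by simp, by simp,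
    by simp⟩

variable [IsUltrametricDist K] {n : ℕ} {γt t : K}

/-- One rewriting of w to w', followed by a known reduction of w'. The bound wt v + n ≤ wt w is the
drop in weight that later pays for γ⁻¹ in `a` and `b`. -/
theorem ReducesTo.of_step {w w' v : ℤ × ℤ} {c a b : K}
    (h : ∃ j c hx hy, ReducesTo n γt t w' j c hx hy) (hw : wt n w' ≤ wt n w)
    (hv : wt n v + n ≤ wt n w) (hc : ‖c‖ ≤ 1) (ha : ‖a‖ * ‖γt‖ ^ n ≤ 1) (hb : ‖b‖ * ‖γt‖ ^ n ≤ 1)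
    (heq : Pi.single w 1 = c • Pi.single w' (1 : K) + a • leadX n (γt ^ n) t (Pi.single v 1)
      + b • leadY (γt ^ n) t (Pi.single v 1)) :
    ∃ j c hx hy, ReducesTo n γt t w j c hx hy := by
  obtain ⟨j, c', hx, hy, hj, hjw, hc', heq', hx1, hy1, hx2, hy2⟩ := h
  have key1 : ∀ (d : K) (η : ℤ × ℤ → K), (∀ u, η u ≠ 0 → wt n u + n ≤ wt n w') →
      ∀ u, (c • η + d • (Pi.single v 1 : ℤ × ℤ → K)) u ≠ 0 → wt n u + n ≤ wt n w := by
    intro d η hη u hu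
    by_cases huv : u = v
    · rwa [huv]
    · refine (hη u fun h0 => hu ?_).trans hw
      simp [h0, huv]
  have key2 : ∀ (d : K) (η : ℤ × ℤ → K), ‖d‖ * ‖γt‖ ^ n ≤ 1 → (∀ u, ‖η u‖ * ‖γt‖ ^ n ≤ 1) →
      ∀ u, ‖(c • η + d • (Pi.single v 1 : ℤ × ℤ → K)) u‖ * ‖γt‖ ^ n ≤ 1 := by
    intro d η hd hη u
    rw [← norm_pow, ← norm_mul, Pi.add_apply, add_mul]
    refine norm_add_le_of_le ?_ ?_
    · rw [Pi.smul_apply, smul_eq_mul, mul_assoc, norm_mul, norm_mul, norm_pow]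
      exact mul_le_one₀ hc (by positivity) (hη u)
    · rw [Pi.smul_apply, smul_eq_mul, Pi.single_apply]
      split_ifs
      · rw [mul_one, norm_mul, norm_pow]
        exact hd
      · simp
  refine ⟨j, c * c', c • hx + a • Pi.single v 1, c • hy + b • Pi.single v 1, hj, hjw.trans hw, ?_,
    ?_, key1 _ _ hx1, key1 _ _ hy1, key2 _ _ ha hx2, key2 _ _ hb hy2⟩
  · rw [norm_mul]
    exact mul_le_one₀ hc (norm_nonneg _) hc'
  · rw [heq, heq', leadX_add, leadX_smul, leadX_smul, leadY_add, leadY_smul, leadY_smul]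
    module

/-- First of six moves, one for each ordered pair among x^n, y, z = 1/(xy), all times the monomial
with exponent v. The multipliers are units because |n| = |t| = 1; γ⁻¹ enters the cofactors only. -/
theorem ReducesTo.of_x_to_y (h : LeadingData n γt t) (v : ℤ × ℤ)
    (hr : ∃ j c hx hy, ReducesTo n γt t (v.1, v.2 + 1) j c hx hy)
    (hw : wt n (v.1, v.2 + 1) ≤ wt n (v.1 + n, v.2)) (hv : wt n v + n ≤ wt n (v.1 + n, v.2)) :
    ∃ j c hx hy, ReducesTo n γt t (v.1 + n, v.2) j c hx hy := by
  refine ReducesTo.of_step (c := (n : K)⁻¹) (a := (γt ^ n * n)⁻¹) (b := -(γt ^ n * n)⁻¹) hr hw hv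
    ?_ (h.norm_mul_le_one h.norm_natCast) ?_ ?_
  · rw [norm_inv, h.norm_natCast, inv_one]
  · rw [norm_neg]; exact h.norm_mul_le_one h.norm_natCast
  · rw [leadX_single, leadY_single]
    have := h.n_ne_zero
    have := pow_ne_zero n h.gt_ne_zero
    match_scalars <;> field_simp <;> ring

theorem ReducesTo.of_x_to_z (h : LeadingData n γt t) (v : ℤ × ℤ)
    (hr : ∃ j c hx hy, ReducesTo n γt t (v.1 - 1, v.2 - 1) j c hx hy)
    (hw : wt n (v.1 - 1, v.2 - 1) ≤ wt n (v.1 + n, v.2)) (hv : wt n v + n ≤ wt n (v.1 + n, v.2)) :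
    ∃ j c hx hy, ReducesTo n γt t (v.1 + n, v.2) j c hx hy := by
  refine ReducesTo.of_step (c := t / n) (a := (γt ^ n * n)⁻¹) (b := 0) hr hw hv
    ?_ (h.norm_mul_le_one h.norm_natCast) (by simp) ?_
  · rw [norm_div, h.norm_natCast, h.norm_t, div_one]
  · rw [leadX_single]
    have := h.n_ne_zero
    have := pow_ne_zero n h.gt_ne_zero
    match_scalars <;> field_simp
    ring

theorem ReducesTo.of_y_to_x (h : LeadingData n γt t) (v : ℤ × ℤ)
    (hr : ∃ j c hx hy, ReducesTo n γt t (v.1 + n, v.2) j c hx hy)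
    (hw : wt n (v.1 + n, v.2) ≤ wt n (v.1, v.2 + 1)) (hv : wt n v + n ≤ wt n (v.1, v.2 + 1)) :
    ∃ j c hx hy, ReducesTo n γt t (v.1, v.2 + 1) j c hx hy := by
  refine ReducesTo.of_step (c := n) (a := -(γt ^ n * 1)⁻¹) (b := (γt ^ n * 1)⁻¹) hr hw hv
    h.norm_natCast.le ?_ (h.norm_mul_le_one norm_one) ?_
  · rw [norm_neg]; exact h.norm_mul_le_one norm_one
  · rw [leadX_single, leadY_single]
    have := pow_ne_zero n h.gt_ne_zero
    match_scalars <;> field_simp <;> ring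

theorem ReducesTo.of_y_to_z (h : LeadingData n γt t) (v : ℤ × ℤ)
    (hr : ∃ j c hx hy, ReducesTo n γt t (v.1 - 1, v.2 - 1) j c hx hy)
    (hw : wt n (v.1 - 1, v.2 - 1) ≤ wt n (v.1, v.2 + 1)) (hv : wt n v + n ≤ wt n (v.1, v.2 + 1)) :
    ∃ j c hx hy, ReducesTo n γt t (v.1, v.2 + 1) j c hx hy := by
  refine ReducesTo.of_step (c := t) (a := 0) (b := (γt ^ n * 1)⁻¹) hr hw hv
    h.norm_t.le (by simp) (h.norm_mul_le_one norm_one) ?_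
  · rw [leadY_single]
    have := pow_ne_zero n h.gt_ne_zero
    match_scalars <;> field_simp
    ring

theorem ReducesTo.of_z_to_x (h : LeadingData n γt t) (v : ℤ × ℤ)
    (hr : ∃ j c hx hy, ReducesTo n γt t (v.1 + n, v.2) j c hx hy)
    (hw : wt n (v.1 + n, v.2) ≤ wt n (v.1 - 1, v.2 - 1))
    (hv : wt n v + n ≤ wt n (v.1 - 1, v.2 - 1)) :
    ∃ j c hx hy, ReducesTo n γt t (v.1 - 1, v.2 - 1) j c hx hy := by
  refine ReducesTo.of_step (c := n / t) (a := -(γt ^ n * t)⁻¹) (b := 0) hr hw hv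
    ?_ ?_ (by simp) ?_
  · rw [norm_div, h.norm_natCast, h.norm_t, div_one]
  · rw [norm_neg]; exact h.norm_mul_le_one h.norm_t
  · rw [leadX_single]
    have := h.t_ne_zero
    have := pow_ne_zero n h.gt_ne_zero
    match_scalars <;> field_simp
    ring

theorem ReducesTo.of_z_to_y (h : LeadingData n γt t) (v : ℤ × ℤ)
    (hr : ∃ j c hx hy, ReducesTo n γt t (v.1, v.2 + 1) j c hx hy)
    (hw : wt n (v.1, v.2 + 1) ≤ wt n (v.1 - 1, v.2 - 1))
    (hv : wt n v + n ≤ wt n (v.1 - 1, v.2 - 1)) :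
    ∃ j c hx hy, ReducesTo n γt t (v.1 - 1, v.2 - 1) j c hx hy := by
  refine ReducesTo.of_step (c := t⁻¹) (a := 0) (b := -(γt ^ n * t)⁻¹) hr hw hv
    ?_ (by simp) ?_ ?_
  · rw [norm_inv, h.norm_t, inv_one]
  · rw [norm_neg]; exact h.norm_mul_le_one h.norm_t
  · rw [leadY_single]
    have := h.t_ne_zero
    have := pow_ne_zero n h.gt_ne_zero
    match_scalars <;> field_simp
    ring

/-- On the first quadrant, where the weight is a + n b, replacing x^n or y by t/(xy) lowers the
weight by 2n + 1 whenever the new exponent stays in the quadrant. Monomials on the axes are first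
moved off them, or to a basis monomial, by trading x^n and y at equal weight. -/
theorem exists_reducesTo_of_nonneg (h : LeadingData n γt t) (N : ℕ)
    (ih : ∀ w, wt n w < N → ∃ j c hx hy, ReducesTo n γt t w j c hx hy) (w : ℤ × ℤ)
    (hN : wt n w = N) (hw1 : 0 ≤ w.1) (hw2 : 0 ≤ w.2) :
    ∃ j c hx hy, ReducesTo n γt t w j c hx hy := by
  have hn := h.two_le
  have base0 : ∀ a : ℤ, 0 ≤ a → a ≤ n → ∃ j c hx hy, ReducesTo n γt t (a, 0) j c hx hy := by
    intro a ha han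
    obtain ⟨j, rfl⟩ := Int.eq_ofNat_of_zero_le ha
    have : eps n j = ((j : ℤ), 0) := by rw [eps, if_pos (by exact_mod_cast han)]
    rw [← this]
    exact ⟨_, _, _, _, reducesTo_eps γt t (by omega)⟩
  have base1 : ∀ a : ℤ, 1 ≤ a → a ≤ n → ∃ j c hx hy, ReducesTo n γt t (a, 1) j c hx hy := by
    intro a ha han
    obtain ⟨j, rfl⟩ := Int.eq_ofNat_of_zero_le (by linarith : 0 ≤ a)
    have : eps n (n + j) = ((j : ℤ), 1) := by
      rw [eps, if_neg (by omega)]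
      push_cast
      simp
    rw [← this]
    exact ⟨_, _, _, _, reducesTo_eps γt t (by omega)⟩
  have interior : ∀ a b : ℤ, 1 ≤ a → 1 ≤ b → wt n (a, b) = N →
      ∃ j c hx hy, ReducesTo n γt t (a, b) j c hx hy := by
    intro a b ha hb hab
    have e0 := wt_of_nonneg (n := n) (u := (a, b)) (by simp; omega) (by simp; omega)
    simp only at e0
    rcases hb.eq_or_lt with rfl | hb
    · by_cases han : a ≤ n
      · exact base1 a ha han
      · have e1 := wt_of_nonneg (n := n) (u := (a - n, 1)) (by simp; omega) (by simp)
        have e2 := wt_of_nonneg (n := n) (u := (a - n - 1, 0)) (by simp; omega) (by simp)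
        simp only at e1 e2
        have hlt : wt n (a - n - 1, 0) < wt n (a, 1) := by
          rw [← Int.ofNat_lt]; linarith
        have := ReducesTo.of_x_to_z h (a - n, 1)
        simp only [sub_add_cancel, sub_self] at this
        exact this (ih _ (by omega)) hlt.le (by rw [← Int.ofNat_le]; push_cast; linarith)
    · have e1 := wt_of_nonneg (n := n) (u := (a, b - 1)) (by simp; omega) (by simp; omega)
      have e2 := wt_of_nonneg (n := n) (u := (a - 1, b - 1 - 1)) (by simp; omega) (by simp; omega)
      simp only at e1 e2
      have hlt : wt n (a - 1, b - 1 - 1) < wt n (a, b) := by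
        rw [← Int.ofNat_lt]; linarith
      have := ReducesTo.of_y_to_z h (a, b - 1)
      simp only [sub_add_cancel] at this
      exact this (ih _ (by omega)) hlt.le (by rw [← Int.ofNat_le]; push_cast; linarith)
  obtain ⟨a, b⟩ := w
  simp only at hw1 hw2
  have e0 := wt_of_nonneg (n := n) (u := (a, b)) hw1 hw2
  simp only at e0
  rcases hw1.eq_or_lt with rfl | ha
  · rcases hw2.eq_or_lt with rfl | hb
    · exact base0 0 le_rfl (by positivity)
    · have e1 := wt_of_nonneg (n := n) (u := (0, b - 1)) (by simp) (by simp; omega)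
      have e2 := wt_of_nonneg (n := n) (u := (0 + (n : ℤ), b - 1)) (by simp) (by simp; omega)
      simp only at e1 e2
      have hle : wt n (0 + (n : ℤ), b - 1) = wt n (0, b) := by
        rw [← Int.natCast_inj]; linarith
      have := ReducesTo.of_y_to_x h (0, b - 1)
      simp only [sub_add_cancel] at this
      refine this ?_ hle.le (by rw [← Int.ofNat_le]; push_cast; linarith)
      rcases (show (1 : ℤ) ≤ b from hb).eq_or_lt with rfl | hb1
      · simpa using base0 n (by positivity) le_rfl
      · exact interior _ _ (by omega) (by omega) (by omega)
  · rcases hw2.eq_or_lt with rfl | hb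
    · by_cases han : a ≤ n
      · exact base0 a ha.le han
      · have e1 := wt_of_nonneg (n := n) (u := (a - n, 0)) (by simp; omega) (by simp)
        have e2 := wt_of_nonneg (n := n) (u := (a - n, 0 + 1)) (by simp; omega) (by simp)
        simp only at e1 e2
        have hle : wt n (a - n, 0 + 1) = wt n (a, 0) := by
          rw [← Int.natCast_inj]; linarith
        have := ReducesTo.of_x_to_y h (a - n, 0)
        simp only [sub_add_cancel] at this
        exact this (interior _ _ (by omega) (by omega) (by omega)) hle.le
          (by rw [← Int.ofNat_le]; push_cast; linarith)
    · exact interior a b ha hb hN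

/-- Strong induction on the weight. In the other two cones, 1/(xy) is traded for x^n (below the
diagonal) or y (above it) at constant weight, until the first quadrant is reached. -/
theorem exists_reducesTo (h : LeadingData n γt t)
    (w : ℤ × ℤ) : ∃ j c hx hy, ReducesTo n γt t w j c hx hy := by
  induction hN : wt n w using Nat.strong_induction_on generalizing w with
  | _ N ih =>
  replace ih : ∀ w, wt n w < N → ∃ j c hx hy, ReducesTo n γt t w j c hx hy :=
    fun w hw => ih _ hw w rfl
  have hpos := exists_reducesTo_of_nonneg h N ih
  have right : ∀ (k : ℕ) (a : ℤ), -(k : ℤ) ≤ a → wt n (a, -(k : ℤ)) = N →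
      ∃ j c hx hy, ReducesTo n γt t (a, -(k : ℤ)) j c hx hy := by
    intro k
    induction k with
    | zero =>
      intro a ha haN
      exact hpos _ haN (by simpa using ha) (by simp)
    | succ k ihk =>
      intro a ha haN
      push_cast at ha haN ⊢
      have e0 := wt_of_snd_nonpos (n := n) (u := (a, -((k : ℤ) + 1)))
        (by simp only; omega) (by simp only; omega)
      have e1 := wt_of_snd_nonpos (n := n) (u := (a + 1, -(k : ℤ))) (by simp) (by simp; omega)
      have e2 := wt_of_snd_nonpos (n := n) (u := (a + 1 + n, -(k : ℤ))) (by simp) (by simp; omega)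
      simp only at e0 e1 e2
      have hle : wt n (a + 1 + n, -(k : ℤ)) = wt n (a, -((k : ℤ) + 1)) := by
        rw [← Int.natCast_inj]; linarith
      have := ReducesTo.of_z_to_x h (a + 1, -(k : ℤ))
      simp only [add_sub_cancel_right, ← neg_add'] at this
      exact this (ihk _ (by omega) (by omega)) hle.le (by rw [← Int.ofNat_le]; push_cast; linarith)
  have left : ∀ (k : ℕ) (b : ℤ), -(k : ℤ) ≤ b → wt n (-(k : ℤ), b) = N →
      ∃ j c hx hy, ReducesTo n γt t (-(k : ℤ), b) j c hx hy := by
    intro k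
    induction k with
    | zero =>
      intro b hb hbN
      exact hpos _ hbN (by simp) (by simpa using hb)
    | succ k ihk =>
      intro b hb hbN
      push_cast at hb hbN ⊢
      have e0 := wt_of_fst_nonpos (n := n) (u := (-((k : ℤ) + 1), b))
        (by simp only; omega) (by simp only; omega)
      have e1 := wt_of_fst_nonpos (n := n) (u := (-(k : ℤ), b + 1)) (by simp) (by simp; omega)
      have e2 := wt_of_fst_nonpos (n := n) (u := (-(k : ℤ), b + 1 + 1)) (by simp) (by simp; omega)
      simp only at e0 e1 e2
      have hle : wt n (-(k : ℤ), b + 1 + 1) = wt n (-((k : ℤ) + 1), b) := by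
        rw [← Int.natCast_inj]; linarith
      have := ReducesTo.of_z_to_y h (-(k : ℤ), b + 1)
      simp only [add_sub_cancel_right, ← neg_add'] at this
      exact this (ihk _ (by omega) (by omega)) hle.le (by rw [← Int.ofNat_le]; push_cast; linarith)
  rcases wt_cases n w with ⟨-, h1, h2⟩ | ⟨-, h1, h2⟩ | ⟨-, h1, h2⟩
  · exact hpos w hN h1 h2
  · have := left w.1.natAbs w.2
    rw [show -((w.1.natAbs : ℕ) : ℤ) = w.1 by omega] at this
    exact this h2 hN
  · have := right w.2.natAbs w.1
    rw [show -((w.2.natAbs : ℕ) : ℤ) = w.2 by omega] at this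
    exact this h2 hN

end

/-! ### Series with coefficients bounded in terms of the weight -/

section

variable {K : Type*} [NormedField K]

/-- `‖η u‖ ≤ C ‖γ̃‖ ^ (k n ω(u))` for all `u`. -/
def WtBound (n : ℕ) (γt : K) (k : ℕ) (C : ℝ) (η : ℤ × ℤ → K) : Prop :=
  ∀ u, ‖η u‖ ≤ C * ‖γt‖ ^ (k * wt n u)

variable {n k : ℕ} {γt t : K} {C : ℝ} {η η' β : ℤ × ℤ → K}

theorem WtBound.nonneg (hη : WtBound n γt k C η) (hγ : 0 < ‖γt‖) : 0 ≤ C := by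
  have h0 := (norm_nonneg _).trans (hη 0)
  exact nonneg_of_mul_nonneg_left h0 (by positivity)

theorem WtBound.mono (hη : WtBound n γt k C η) {D : ℝ} (h : C ≤ D) : WtBound n γt k D η :=
  fun u => (hη u).trans (by gcongr)

theorem WtBound.norm_le (hη : WtBound n γt k C η) (hγ : ‖γt‖ ≤ 1) (hC : 0 ≤ C) (u : ℤ × ℤ) :
    ‖η u‖ ≤ C :=
  (hη u).trans (mul_le_of_le_one_right hC (pow_le_one₀ (norm_nonneg _) hγ))

theorem WtBound.neg (hη : WtBound n γt k C η) : WtBound n γt k C (-η) := fun u => by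
  rw [Pi.neg_apply, norm_neg]; exact hη u

variable [IsUltrametricDist K]

theorem WtBound.add (hη : WtBound n γt k C η) (hη' : WtBound n γt k C η') :
    WtBound n γt k C (η + η') := fun u => norm_add_le_of_le (hη u) (hη' u)

theorem WtBound.sub (hη : WtBound n γt k C η) (hη' : WtBound n γt k C η') :
    WtBound n γt k C (η - η') := fun u => norm_sub_le_of_le (hη u) (hη' u)

/-- Normalised so that basis monomials reduce to themselves. This makes the coordinate `v j` of a
series comparable with its coefficient at ε_j. -/
theorem exists_reducesTo' (h : LeadingData n γt t) (w : ℤ × ℤ) :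
    ∃ j c hx hy, ReducesTo n γt t w j c hx hy ∧ ∀ i ≤ 2 * n, w = eps n i → j = i ∧ c = 1 := by
  by_cases hw : ∃ i ≤ 2 * n, w = eps n i
  · obtain ⟨i, hi, rfl⟩ := hw
    exact ⟨i, 1, 0, 0, reducesTo_eps γt t hi, fun i' _ hi' => ⟨eps_injective hi', rfl⟩⟩
  · obtain ⟨j, c, hx, hy, hr⟩ := exists_reducesTo h w
    exact ⟨j, c, hx, hy, hr, fun i hi hi' => absurd ⟨i, hi, hi'⟩ hw⟩

variable [CompleteSpace K]

theorem summable_of_norm_le_pow_wt {ι : Type*} (hn : 1 ≤ n) {r D : ℝ} (h0 : 0 ≤ r) (h1 : r < 1)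
    {e : ι → ℤ × ℤ} (he : Function.Injective e) {f : ι → K}
    (hf : ∀ i, ‖f i‖ ≤ D * r ^ wt n (e i)) : Summable f := by
  refine NonarchimedeanAddGroup.summable_of_tendsto_cofinite_zero ?_
  refine squeeze_zero_norm hf ?_
  have := ((tendsto_pow_wt hn h0 h1).comp he.tendsto_cofinite).const_mul D
  rwa [mul_zero] at this

/-- The combination `∑ v_j ε_j` of the basis monomials. -/
def basisSum (n : ℕ) (v : Fin (2 * n + 1) → K) : ℤ × ℤ → K :=
  ∑ j : Fin (2 * n + 1), v j • Pi.single (eps n j) (1 : K)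

/-- Every series is a combination of the basis monomials modulo the leading parts. -/
theorem exists_leading_reduction (h : LeadingData n γt t) (hβ : WtBound n γt 2 C β) :
    ∃ (v : Fin (2 * n + 1) → K) (hx hy : ℤ × ℤ → K),
      β = basisSum n v + leadX n (γt ^ n) t hx + leadY (γt ^ n) t hy ∧
      (∀ (k : ℕ) (D : ℝ), WtBound n γt (k + 1) D β →
        WtBound n γt (k + 1) (D * ‖γt‖ ^ (k * n)) hx ∧
        WtBound n γt (k + 1) (D * ‖γt‖ ^ (k * n)) hy) ∧
      (∀ (j : Fin (2 * n + 1)) (E : ℝ), 0 ≤ E →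
        (∀ w, (j : ℕ) ≤ wt n w → w ≠ eps n j → ‖β w‖ ≤ E) → ‖v j - β (eps n j)‖ ≤ E) := by
  choose j c hx hy hr hj using exists_reducesTo' (K := K) h
  have hn : 1 ≤ n := by have := h.two_le; omega
  have hπ := h.norm_pos
  have hC := hβ.nonneg hπ
  have hr1 : ‖γt‖ ^ 2 < 1 := pow_lt_one₀ hπ.le h.norm_lt_one two_ne_zero
  have hβ2 : ∀ w, ‖β w‖ ≤ C * (‖γt‖ ^ 2) ^ wt n w := fun w => by rw [← pow_mul]; exact hβ w
  have hsummable : ∀ (f : ℤ × ℤ → K) (D : ℝ), 0 ≤ D → (∀ w, ‖f w‖ ≤ D) →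
      Summable fun w => β w * f w := by
    intro f D hD hf
    refine summable_of_norm_le_pow_wt (D := C * D) hn (by positivity) hr1
      Function.injective_id fun w => ?_
    rw [norm_mul, mul_right_comm]
    exact mul_le_mul (hβ2 w) (hf w) (norm_nonneg _) (by positivity)
  have hbd : ∀ H : ℤ × ℤ → ℤ × ℤ → K, (∀ w u, ‖H w u‖ * ‖γt‖ ^ n ≤ 1) →
      ∀ w u, ‖H w u‖ ≤ (‖γt‖ ^ n)⁻¹ := fun H hH w u => by
    rw [← one_div, le_div_iff₀ (by positivity)]; exact hH w u
  have hx2 := hbd hx fun w u => (hr w).2.2.2.2.2.2.1 u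
  have hy2 := hbd hy fun w u => (hr w).2.2.2.2.2.2.2 u
  have hsx : ∀ u, HasSum (fun w => β w * hx w u) (∑' w, β w * hx w u) := fun u =>
    (hsummable (fun w => hx w u) _ (by positivity) fun w => hx2 w u).hasSum
  have hsy : ∀ u, HasSum (fun w => β w * hy w u) (∑' w, β w * hy w u) := fun u =>
    (hsummable (fun w => hy w u) _ (by positivity) fun w => hy2 w u).hasSum
  have hsc : ∀ i : Fin (2 * n + 1), HasSum (fun w => β w * if j w = i then c w else 0)
      (∑' w, β w * if j w = i then c w else 0) := fun i =>
    (hsummable _ 1 zero_le_one fun w => by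
      split_ifs
      · exact (hr w).2.2.1
      · simp).hasSum
  refine ⟨fun i => ∑' w, β w * if j w = i then c w else 0, fun u => ∑' w, β w * hx w u,
    fun u => ∑' w, β w * hy w u, ?_, ?_, ?_⟩
  · funext u
    have hL : HasSum (fun w => β w * (Pi.single w 1 : ℤ × ℤ → K) u) (β u) := by
      have := hasSum_single (f := fun w => β w * (Pi.single w 1 : ℤ × ℤ → K) u) u
        (fun w hw => by simp [Ne.symm hw])
      simpa using this
    refine hL.unique ?_
    have h1 := hasSum_sum (s := Finset.univ) fun (i : Fin (2 * n + 1)) _ =>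
      (hsc i).mul_right ((Pi.single (eps n i) 1 : ℤ × ℤ → K) u)
    have h2 := (((hsx (u.1 - n, u.2)).mul_left (n : K)).sub
      ((hsx (u.1 + 1, u.2 + 1)).mul_left t)).mul_left (γt ^ n)
    have h3 := (((hsy (u.1, u.2 - 1))).sub
      ((hsy (u.1 + 1, u.2 + 1)).mul_left t)).mul_left (γt ^ n)
    have h4 := (h1.add h2).add h3
    convert h4 using 1
    · rfl
    · funext w
      rw [(hr w).2.2.2.1]
      simp only [Pi.add_apply, leadX, leadY, Pi.smul_apply, smul_eq_mul]
      rw [Finset.sum_eq_single (⟨j w, by have := (hr w).1; omega⟩ : Fin (2 * n + 1))]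
      · simp only [if_true]
        ring
      · intro b _ hb
        rw [if_neg fun h0 => hb (Fin.ext h0.symm), mul_zero, zero_mul]
      · intro h0
        exact absurd (Finset.mem_univ _) h0
    · simp only [Pi.add_apply, leadX, leadY, basisSum, Finset.sum_apply, Pi.smul_apply, smul_eq_mul]
  · intro k D hD
    have hD0 := hD.nonneg hπ
    -- As wt w ≥ wt u + n, decay at rate k + 1 yields an extra |γ̃|^((k+1)n). One factor |γ̃|^n pays
    -- for γ⁻¹, and |γ̃|^(kn) remains.
    have key : ∀ H : ℤ × ℤ → ℤ × ℤ → K, (∀ w u, ‖H w u‖ ≤ (‖γt‖ ^ n)⁻¹) →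
        (∀ w u, H w u ≠ 0 → wt n u + n ≤ wt n w) →
        WtBound n γt (k + 1) (D * ‖γt‖ ^ (k * n)) fun u => ∑' w, β w * H w u := by
      intro H hH1 hH2 u
      refine IsUltrametricDist.norm_tsum_le_of_forall_le fun w => ?_
      by_cases h0 : H w u = 0
      · rw [h0, mul_zero, norm_zero]; positivity
      · have hw := hH2 w u h0
        rw [norm_mul]
        calc ‖β w‖ * ‖H w u‖ ≤ (D * ‖γt‖ ^ ((k + 1) * wt n w)) * (‖γt‖ ^ n)⁻¹ :=
              mul_le_mul (hD w) (hH1 w u) (norm_nonneg _) (by positivity)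
          _ ≤ (D * ‖γt‖ ^ ((k + 1) * (wt n u + n))) * (‖γt‖ ^ n)⁻¹ := by
              refine mul_le_mul_of_nonneg_right (mul_le_mul_of_nonneg_left ?_ hD0) (by positivity)
              exact pow_le_pow_of_le_one hπ.le h.norm_lt_one.le (Nat.mul_le_mul_left _ hw)
          _ = D * ‖γt‖ ^ (k * n) * ‖γt‖ ^ ((k + 1) * wt n u) := by
              rw [show (k + 1) * (wt n u + n) = k * n + (k + 1) * wt n u + n by ring, pow_add,
                pow_add]
              have : ‖γt‖ ^ n ≠ 0 := by positivity
              field_simp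
    exact ⟨key hx hx2 fun w u => (hr w).2.2.2.2.1 u, key hy hy2 fun w u => (hr w).2.2.2.2.2.1 u⟩
  · intro i E hE hw
    have hi : (i : ℕ) ≤ 2 * n := by have := i.2; omega
    simp only
    -- The monomial ε_i itself contributes exactly its coefficient; any other w that reduces to ε_i
    -- has weight at least i.
    rw [(hsc i).summable.tsum_eq_add_tsum_ite (eps n i), if_pos ((hj _ i hi rfl).1),
      (hj _ i hi rfl).2, mul_one, add_sub_cancel_left]
    refine IsUltrametricDist.norm_tsum_le_of_forall_le_of_nonneg hE fun w => ?_
    split_ifs with h1 h2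
    · simpa using hE
    · rw [norm_mul]
      refine (mul_le_of_le_one_right (norm_nonneg _) (hr w).2.2.1).trans (hw w ?_ h1)
      rw [← h2]
      exact (hr w).2.1
    · simpa using hE

end

/-! ### The leading parts form a regular sequence -/

section

variable {K : Type*} [NormedField K]

variable {n k : ℕ} {γt t : K} {C : ℝ} {a b η η' β : ℤ × ℤ → K}

theorem basisSum_apply_eps (v : Fin (2 * n + 1) → K) (j : Fin (2 * n + 1)) :
    basisSum n v (eps n j) = v j := by
  rw [basisSum, Finset.sum_apply, Finset.sum_eq_single j]
  · simp
  · intro i _ hij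
    have : eps n (j : ℕ) ≠ eps n i := fun h => hij (Fin.ext (eps_injective h).symm)
    simp [this]
  · simp

theorem basisSum_apply_of_ne (v : Fin (2 * n + 1) → K) {u : ℤ × ℤ}
    (hu : ∀ j : Fin (2 * n + 1), u ≠ eps n j) : basisSum n v u = 0 := by
  rw [basisSum, Finset.sum_apply]
  exact Finset.sum_eq_zero fun i _ => by simp [hu i]

theorem wt_add_le_wt_up {u : ℤ × ℤ} (hu : 0 ≤ u.2) : wt n u + n ≤ wt n (u.1, u.2 + 1) := by
  obtain ⟨h1, h2, -⟩ := le_wt n (u.1, u.2 + 1)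
  simp only at h1 h2
  rw [← Int.ofNat_le]
  push_cast
  rcases wt_cases n u with ⟨h, g1, g2⟩ | ⟨h, g1, g2⟩ | ⟨h, g1, g2⟩
  · linarith
  · linarith
  · have : u.2 = 0 := le_antisymm g1 hu
    rw [h, this]
    rw [this] at h1
    linarith

theorem wt_add_le_wt_down {u : ℤ × ℤ} (hu : u.2 ≤ 0) : wt n u + n ≤ wt n (u.1 - 1, u.2 - 1) := by
  obtain ⟨-, h2, h3⟩ := le_wt n (u.1 - 1, u.2 - 1)
  simp only at h2 h3
  rw [← Int.ofNat_le]
  push_cast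
  rcases wt_cases n u with ⟨h, g1, g2⟩ | ⟨h, g1, g2⟩ | ⟨h, g1, g2⟩
  · have : u.2 = 0 := le_antisymm hu g2
    rw [h, this]
    rw [this] at h3
    linarith
  · linarith
  · linarith

/-- The sublattice spanned by `(1,2)` and `(n+1,1)`, translated by `w`. -/
def latticePt (n : ℕ) (w q : ℤ × ℤ) : ℤ × ℤ := (w.1 + q.1 + q.2 * (n + 1), w.2 + 2 * q.1 + q.2)

theorem latticePt_injective (n : ℕ) (w : ℤ × ℤ) : Function.Injective (latticePt n w) := by
  intro q q' h
  have h1 : w.1 + q.1 + q.2 * (n + 1) = w.1 + q'.1 + q'.2 * (n + 1) := congrArg Prod.fst h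
  have h2 : w.2 + 2 * q.1 + q.2 = w.2 + 2 * q'.1 + q'.2 := congrArg Prod.snd h
  have h3 : (2 * (n : ℤ) + 1) * (q.2 - q'.2) = 0 := by linear_combination 2 * h1 - h2
  have h4 : q.2 - q'.2 = 0 := by
    rcases mul_eq_zero.1 h3 with h | h
    · omega
    · exact h
  exact Prod.ext (by omega) (by omega)

/-- The form u₁ + n u₂ has value j at ε_j and takes multiples of 2n + 1 on the lattice, so indices
in 0, …, 2n give different cosets. -/
theorem latticePt_eps {i j : ℕ} (hi : i ≤ 2 * n) (hj : j ≤ 2 * n) (hn : 1 ≤ n) {q : ℤ × ℤ}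
    (h : latticePt n (eps n j) q = eps n i) : q = 0 := by
  have h1 : (eps n j).1 + q.1 + q.2 * (n + 1) = (eps n i).1 := congrArg Prod.fst h
  have h2 : (eps n j).2 + 2 * q.1 + q.2 = (eps n i).2 := congrArg Prod.snd h
  have e1 := eps_fst_add n i
  have e2 := eps_fst_add n j
  have h3 : (2 * (n : ℤ) + 1) * (q.1 + q.2) = i - j := by
    linear_combination h1 + n * h2 + e1 - e2
  have h4 : q.1 + q.2 = 0 := by
    by_contra h0
    rcases lt_or_gt_of_ne h0 with h0 | h0
    · nlinarith
    · nlinarith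
  have hij : i = j := by rw [h4] at h3; omega
  subst hij
  have h5 : (n : ℤ) * q.2 = 0 := by linear_combination h1 - h4
  have h6 : q.2 = 0 := by
    rcases mul_eq_zero.1 h5 with h | h
    · omega
    · exact h
  exact Prod.ext (by simp; omega) (by simpa using h6)

/-- A series killed by y − t/(xy) has constant norm along lines in direction (1,2), while its
coefficients tend to 0. -/
theorem eq_zero_of_leadY_eq_zero (h : LeadingData n γt t) (hη : WtBound n γt 2 C η)
    (h0 : leadY (γt ^ n) t η = 0) : η = 0 := by
  have hn : 1 ≤ n := by have := h.two_le; omega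
  have hC := hη.nonneg h.norm_pos
  have hstep : ∀ u, ‖η u‖ = ‖η (u.1 + 1, u.2 + 2)‖ := by
    intro u
    have := congrFun h0 (u.1, u.2 + 1)
    simp only [leadY, Pi.zero_apply, mul_eq_zero, pow_eq_zero_iff', h.gt_ne_zero, false_and,
      false_or, sub_eq_zero, add_sub_cancel_right] at this
    rw [show η u = η (u.1, u.2) from rfl, this, norm_mul, h.norm_t, one_mul, add_assoc]
    norm_num
  have hiter : ∀ (m : ℕ) u, ‖η u‖ = ‖η (u.1 + m, u.2 + 2 * m)‖ := by
    intro m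
    induction m with
    | zero => intro u; simp
    | succ m ih =>
      intro u
      rw [ih, hstep]
      push_cast
      congr 3 <;> ring
  funext u
  have hlim : Tendsto (fun m : ℕ => C * ‖γt‖ ^ m) atTop (𝓝 0) := by
    have := (tendsto_pow_atTop_nhds_zero_of_lt_one h.norm_pos.le h.norm_lt_one).const_mul C
    rwa [mul_zero] at this
  have : ‖η u‖ ≤ 0 := by
    refine ge_of_tendsto hlim (Eventually.of_forall fun m => ?_)
    rw [hiter (m + u.1.natAbs) u]
    refine (hη _).trans (mul_le_mul_of_nonneg_left (pow_le_pow_of_le_one (norm_nonneg _)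
      h.norm_lt_one.le ?_) hC)
    have h1 := (abs_le_wt hn (u.1 + ↑(m + u.1.natAbs), u.2 + 2 * ↑(m + u.1.natAbs))).1
    simp only at h1
    have h2 := (le_abs_self _).trans h1
    omega
  simpa using this

variable [IsUltrametricDist K]

theorem leadX_wtBound (h : LeadingData n γt t) (hη : WtBound n γt 2 (C * ‖γt‖ ^ n) η) :
    WtBound n γt 2 C (leadX n (γt ^ n) t η) := by
  intro u
  have hC0 : 0 ≤ C := by
    have := hη.nonneg h.norm_pos
    exact nonneg_of_mul_nonneg_left this (pow_pos h.norm_pos n)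
  have key : ∀ u', wt n u ≤ wt n u' + n → ‖γt‖ ^ n * ‖η u'‖ ≤ C * ‖γt‖ ^ (2 * wt n u) := by
    intro u' hu'
    calc ‖γt‖ ^ n * ‖η u'‖ ≤ ‖γt‖ ^ n * (C * ‖γt‖ ^ n * ‖γt‖ ^ (2 * wt n u')) :=
          mul_le_mul_of_nonneg_left (hη u') (by positivity)
      _ = C * ‖γt‖ ^ (2 * (wt n u' + n)) := by ring
      _ ≤ C * ‖γt‖ ^ (2 * wt n u) := mul_le_mul_of_nonneg_left
          (pow_le_pow_of_le_one (norm_nonneg _) h.norm_lt_one.le (by omega)) hC0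
  rw [leadX, mul_sub]
  have h1 := wt_le_sub_fst_add n 1 u
  have h2 := wt_le_add_add n 1 u
  simp only [Nat.cast_one, mul_one] at h1 h2
  refine norm_sub_le_of_le ?_ ?_
  · rw [norm_mul, norm_mul, norm_pow, h.norm_natCast, one_mul]
    exact key _ h1
  · rw [norm_mul, norm_mul, norm_pow, h.norm_t, one_mul]
    exact key _ h2

variable [CompleteSpace K]

/-- On each coset of the lattice, sum the coefficients with weights t^q₁ κ^q₂. This imposes x y² = t
and x^(n+1) y = κ, so the sums vanish on both leading parts: two shifted copies of one convergent
sum cancel. By `latticePt_eps` the sum over the coset of ε_j picks out `v j`. -/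
theorem eq_zero_of_basisSum_eq_lead (h : LeadingData n γt t) (ha : WtBound n γt 2 C a)
    (hb : WtBound n γt 2 C b) {v : Fin (2 * n + 1) → K}
    (heq : basisSum n v = leadX n (γt ^ n) t a + leadY (γt ^ n) t b) : v = 0 := by
  have hn : 1 ≤ n := by have := h.two_le; omega
  have hπ := h.norm_pos
  have hr1 : ‖γt‖ ^ 2 < 1 := pow_lt_one₀ hπ.le h.norm_lt_one two_ne_zero
  have ht := h.t_ne_zero
  have hn0 := h.n_ne_zero
  set κ : K := t / n with hκ
  have hκ1 : ‖κ‖ = 1 := by rw [hκ, norm_div, h.norm_natCast, h.norm_t, div_one]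
  have hκ0 : κ ≠ 0 := norm_pos_iff.1 (by rw [hκ1]; exact one_pos)
  have hsum : ∀ (η : ℤ × ℤ → K) (w : ℤ × ℤ), WtBound n γt 2 C η →
      HasSum (fun q : ℤ × ℤ => t ^ q.1 * κ ^ q.2 * η (latticePt n w q))
        (∑' q : ℤ × ℤ, t ^ q.1 * κ ^ q.2 * η (latticePt n w q)) := by
    intro η w hη
    refine (summable_of_norm_le_pow_wt (D := C) hn (by positivity) hr1
      (latticePt_injective n w) fun q => ?_).hasSum
    rw [norm_mul, norm_mul, norm_zpow, norm_zpow, hκ1, h.norm_t, one_zpow, one_zpow, one_mul,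
      one_mul, ← pow_mul]
    exact hη _
  have hshift : ∀ (e : (ℤ × ℤ) ≃ (ℤ × ℤ)) (F : ℤ × ℤ → K) (s : K), HasSum F s →
      HasSum (fun q => F (e q)) s := fun e F s hF => (e.hasSum_iff (f := F)).2 hF
  funext j
  have hj : (j : ℕ) ≤ 2 * n := by have := j.2; omega
  have h1 : HasSum (fun q : ℤ × ℤ => t ^ q.1 * κ ^ q.2 * basisSum n v (latticePt n (eps n j) q))
      (v j) := by
    have := hasSum_single
      (f := fun q : ℤ × ℤ => t ^ q.1 * κ ^ q.2 * basisSum n v (latticePt n (eps n j) q)) 0 ?_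
    · simpa [latticePt, basisSum_apply_eps] using this
    · intro q hq
      rw [basisSum_apply_of_ne, mul_zero]
      intro i hi
      exact hq (latticePt_eps (by have := i.2; omega) hj hn hi)
  have h2 : HasSum (fun q : ℤ × ℤ => t ^ q.1 * κ ^ q.2 *
      leadX n (γt ^ n) t a (latticePt n (eps n j) q)) 0 := by
    have hF := hsum a ((eps n j).1 - n, (eps n j).2) ha
    have hG := hshift ((Equiv.refl ℤ).prodCongr (Equiv.addRight 1)) _ _ hF
    have := (hF.sub hG).mul_left (γt ^ n * n)
    rw [sub_self, mul_zero] at this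
    refine this.congr_fun ?_
    intro q
    simp only [leadX, latticePt, Equiv.prodCongr_apply, Prod.map_fst, Prod.map_snd,
      Equiv.coe_refl, id, Equiv.coe_addRight]
    rw [zpow_add_one₀ hκ0]
    rw [show (eps n j).1 - (n : ℤ) + q.1 + q.2 * (n + 1) = (eps n j).1 + q.1 + q.2 * (n + 1) - n
      by ring, show (eps n j).1 - (n : ℤ) + q.1 + (q.2 + 1) * (n + 1)
        = (eps n j).1 + q.1 + q.2 * (n + 1) + 1 by ring,
      show (eps n j).2 + 2 * q.1 + (q.2 + 1) = (eps n j).2 + 2 * q.1 + q.2 + 1 by ring]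
    have : κ * n = t := by rw [hκ]; field_simp
    linear_combination (γt ^ n * t ^ q.1 * κ ^ q.2 *
      a ((eps n j).1 + q.1 + q.2 * (n + 1) + 1, (eps n j).2 + 2 * q.1 + q.2 + 1)) * this
  have h3 : HasSum (fun q : ℤ × ℤ => t ^ q.1 * κ ^ q.2 *
      leadY (γt ^ n) t b (latticePt n (eps n j) q)) 0 := by
    have hF := hsum b ((eps n j).1, (eps n j).2 - 1) hb
    have hG := hshift ((Equiv.addRight 1).prodCongr (Equiv.refl ℤ)) _ _ hF
    have := (hF.sub hG).mul_left (γt ^ n)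
    rw [sub_self, mul_zero] at this
    refine this.congr_fun ?_
    intro q
    simp only [leadY, latticePt, Equiv.prodCongr_apply, Prod.map_fst, Prod.map_snd,
      Equiv.coe_refl, id, Equiv.coe_addRight]
    rw [zpow_add_one₀ ht]
    rw [show (eps n j).2 - 1 + 2 * q.1 + q.2 = (eps n j).2 + 2 * q.1 + q.2 - 1 by ring,
      show (eps n j).1 + (q.1 + 1) + q.2 * ((n : ℤ) + 1) = (eps n j).1 + q.1 + q.2 * (n + 1) + 1
        by ring,
      show (eps n j).2 - 1 + 2 * (q.1 + 1) + q.2 = (eps n j).2 + 2 * q.1 + q.2 + 1 by ring]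
    ring
  have h4 := h2.add h3
  rw [add_zero] at h4
  refine h1.unique (h4.congr_fun ?_)
  intro q
  rw [heq, Pi.add_apply]
  ring

/-- Summation in direction (1,2) imposes x y² = t and eliminates b by telescoping. What remains is n
A(w) = t A(w + (n+1,1)) for the line sums A of a. Their norms are then constant along this
direction, yet tend to 0. -/
theorem lineSum_eq_zero (h : LeadingData n γt t) (ha : WtBound n γt 2 C a)
    (hb : WtBound n γt 2 C b) (heq : leadX n (γt ^ n) t a + leadY (γt ^ n) t b = 0) (w : ℤ × ℤ) :
    HasSum (fun l : ℤ => t ^ l * a (w.1 + l, w.2 + 2 * l)) 0 := by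
  have hn : 1 ≤ n := by have := h.two_le; omega
  have hπ := h.norm_pos
  have hr1 : ‖γt‖ ^ 2 < 1 := pow_lt_one₀ hπ.le h.norm_lt_one two_ne_zero
  have ht := h.t_ne_zero
  have hC := ha.nonneg hπ
  have hsum : ∀ (η : ℤ × ℤ → K) (w : ℤ × ℤ), WtBound n γt 2 C η →
      HasSum (fun l : ℤ => t ^ l * η (w.1 + l, w.2 + 2 * l))
        (∑' l : ℤ, t ^ l * η (w.1 + l, w.2 + 2 * l)) := by
    intro η w hη
    refine (summable_of_norm_le_pow_wt (D := C) hn (by positivity) hr1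
      (e := fun l : ℤ => (w.1 + l, w.2 + 2 * l)) (fun l l' hl => ?_) fun q => ?_).hasSum
    · simpa using congrArg Prod.fst hl
    · rw [norm_mul, norm_zpow, h.norm_t, one_zpow, one_mul, ← pow_mul]
      exact hη _
  set A : ℤ × ℤ → K := fun w => ∑' l : ℤ, t ^ l * a (w.1 + l, w.2 + 2 * l) with hA
  have hstep : ∀ w, ‖A w‖ = ‖A (w.1 + (n + 1), w.2 + 1)‖ := by
    intro w
    have h1 := (((hsum a w ha).mul_left (n : K)).sub
      ((hsum a (w.1 + (n + 1), w.2 + 1) ha).mul_left t)).mul_left (γt ^ n)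
    have hF := hsum b (w.1 + n, w.2 - 1) hb
    have hG := ((Equiv.addRight (1 : ℤ)).hasSum_iff
      (f := fun l : ℤ => t ^ l * b (w.1 + n + l, w.2 - 1 + 2 * l))).2 hF
    have h2 := (hF.sub hG).mul_left (γt ^ n)
    have h3 := h1.add h2
    rw [sub_self, mul_zero, add_zero] at h3
    have h4 : HasSum (fun _ : ℤ => (0 : K)) 0 := hasSum_zero
    have h5 := h3.unique (h4.congr_fun ?_)
    · rw [mul_eq_zero, or_iff_right (pow_ne_zero n h.gt_ne_zero), sub_eq_zero] at h5
      have h6 := congrArg norm h5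
      rwa [norm_mul, norm_mul, h.norm_natCast, h.norm_t, one_mul, one_mul] at h6
    · intro l
      have h6 := congrFun heq (w.1 + n + l, w.2 + 2 * l)
      simp only [leadX, leadY, Pi.add_apply, Pi.zero_apply] at h6
      simp only [Function.comp_apply, Equiv.coe_addRight, zpow_add_one₀ ht]
      rw [show w.1 + (n : ℤ) + l - n = w.1 + l by ring] at h6
      rw [show w.1 + ((n : ℤ) + 1) + l = w.1 + n + l + 1 by ring,
        show w.2 + 1 + 2 * l = w.2 + 2 * l + 1 by ring,
        show w.2 - 1 + 2 * l = w.2 + 2 * l - 1 by ring,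
        show w.1 + (n : ℤ) + (l + 1) = w.1 + n + l + 1 by ring,
        show w.2 - 1 + 2 * (l + 1) = w.2 + 2 * l + 1 by ring]
      linear_combination t ^ l * h6
  have hiter : ∀ (m : ℕ) w, ‖A w‖ = ‖A (w.1 + m * (n + 1), w.2 + m)‖ := by
    intro m
    induction m with
    | zero => intro w; simp
    | succ m ih =>
      intro w
      rw [ih, hstep]
      push_cast
      congr 3 <;> ring
  have hlim : Tendsto (fun m : ℕ => C * ‖γt‖ ^ m) atTop (𝓝 0) := by
    have := (tendsto_pow_atTop_nhds_zero_of_lt_one h.norm_pos.le h.norm_lt_one).const_mul C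
    rwa [mul_zero] at this
  have hA0 : ‖A w‖ ≤ 0 := by
    refine ge_of_tendsto hlim (Eventually.of_forall fun m => ?_)
    -- The form 2u₁ − u₂ is constant on the line and, as the sum of two of the linear forms below
    -- the weight, at most twice the weight. M makes it at least m.
    set M : ℕ := m + (2 * w.1 - w.2).natAbs with hM
    rw [hiter M w]
    refine IsUltrametricDist.norm_tsum_le_of_forall_le fun l => ?_
    rw [norm_mul, norm_zpow, h.norm_t, one_zpow, one_mul]
    refine (ha _).trans (mul_le_mul_of_nonneg_left (pow_le_pow_of_le_one (norm_nonneg _)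
      h.norm_lt_one.le ?_) hC)
    obtain ⟨g1, -, g3⟩ := le_wt n (w.1 + ↑M * (n + 1) + l, w.2 + ↑M + 2 * l)
    simp only at g1 g3
    have hMn : (M : ℤ) ≤ M * n := by
      have : (1 : ℤ) ≤ n := by exact_mod_cast hn
      nlinarith
    have : (m : ℤ) ≤ M + (2 * w.1 - w.2) := by omega
    zify
    nlinarith
  have := hsum a w ha
  rwa [show (∑' l : ℤ, t ^ l * a (w.1 + l, w.2 + 2 * l)) = 0 from norm_le_zero_iff.1 hA0] at this

/-- Exactness of the Koszul complex of the leading parts, with a bound. -/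
theorem exists_of_lead_eq_zero (h : LeadingData n γt t) (ha : WtBound n γt 2 C a)
    (hb : WtBound n γt 2 C b) (heq : leadX n (γt ^ n) t a + leadY (γt ^ n) t b = 0) :
    ∃ c, WtBound n γt 2 (C * ‖γt‖ ^ n) c ∧ a = leadY (γt ^ n) t c ∧
      b = -leadX n (γt ^ n) t c := by
  have hn : 1 ≤ n := by have := h.two_le; omega
  have hπ := h.norm_pos
  have ht := h.t_ne_zero
  have hC := ha.nonneg hπ
  have hγ0 := pow_ne_zero n h.gt_ne_zero
  have hline := lineSum_eq_zero h ha hb heq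
  have hpos : ∀ w : ℤ × ℤ, Summable fun l : ℕ => t ^ l * a (w.1 + l, w.2 + 2 * l) := fun w => by
    have := (hline w).summable.comp_injective Nat.cast_injective
    simpa [Function.comp_def] using this
  -- The quotient of a by γ(y − t/(xy)), expanded in direction (1,2). Since full line sums vanish,
  -- the half-line sum is also minus the opposite one. The half-line leading away from the
  -- horizontal axis has weights at least wt u + n, which at decay rate 2 absorbs γ⁻¹ and leaves
  -- |γ̃|^n.
  set c : ℤ × ℤ → K := fun u =>
    (γt ^ n)⁻¹ * ∑' l : ℕ, t ^ l * a (u.1 + l, u.2 + 1 + 2 * l) with hc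
  have hbound : WtBound n γt 2 (C * ‖γt‖ ^ n) c := by
    intro u
    have key : ∀ f : ℕ → K, ∀ e : ℕ → ℤ × ℤ, (∀ l, ‖f l‖ = ‖a (e l)‖) →
        (∀ l, wt n u + n ≤ wt n (e l)) →
        ‖(γt ^ n)⁻¹ * ∑' l, f l‖ ≤ C * ‖γt‖ ^ n * ‖γt‖ ^ (2 * wt n u) := by
      intro f e hf he
      have h1 : ‖∑' l, f l‖ ≤ C * ‖γt‖ ^ (2 * (wt n u + n)) := by
        refine IsUltrametricDist.norm_tsum_le_of_forall_le fun l => ?_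
        rw [hf]
        exact (ha _).trans (mul_le_mul_of_nonneg_left (pow_le_pow_of_le_one (norm_nonneg _)
          h.norm_lt_one.le (Nat.mul_le_mul_left _ (he l))) hC)
      rw [norm_mul, norm_inv, norm_pow, inv_mul_le_iff₀ (by positivity)]
      refine h1.trans_eq ?_
      ring
    rcases le_or_gt 0 u.2 with hu | hu
    · refine key _ (fun l => (u.1 + l, u.2 + 1 + 2 * l)) (fun l => ?_) fun l => ?_
      · rw [norm_mul, norm_pow, h.norm_t, one_pow, one_mul]
      · exact (wt_add_le_wt_up hu).trans
          (wt_le_wt_add_line (u := (u.1, u.2 + 1)) (by simp; omega) l)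
    · have hz := hline (u.1, u.2 + 1)
      simp only at hz
      have hneg : Summable fun l : ℕ =>
          t ^ (-((l : ℤ) + 1)) * a (u.1 + -((l : ℤ) + 1), u.2 + 1 + 2 * -((l : ℤ) + 1)) := by
        refine hz.summable.comp_injective (i := fun l : ℕ => -((l : ℤ) + 1)) fun l l' hl => ?_
        simpa using hl
      have hp := hpos (u.1, u.2 + 1)
      have h0 := tsum_of_nat_of_neg_add_one
        (f := fun l : ℤ => t ^ l * a (u.1 + l, u.2 + 1 + 2 * l)) (by simpa using hp) hneg
      rw [hz.tsum_eq] at h0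
      have h1 : (∑' l : ℕ, t ^ l * a (u.1 + l, u.2 + 1 + 2 * l)) = -∑' l : ℕ,
          t ^ (-((l : ℤ) + 1)) * a (u.1 + -((l : ℤ) + 1), u.2 + 1 + 2 * -((l : ℤ) + 1)) := by
        simp only [zpow_natCast] at h0
        exact eq_neg_of_add_eq_zero_left h0.symm
      rw [hc]
      simp only
      rw [h1, mul_neg, norm_neg]
      refine key _ (fun l : ℕ => (u.1 + -((l : ℤ) + 1), u.2 + 1 + 2 * -((l : ℤ) + 1)))
        (fun l => ?_) fun l => ?_
      · rw [norm_mul, norm_zpow, h.norm_t, one_zpow, one_mul]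
      · have h2 := wt_le_wt_sub_line (n := n) (u := (u.1 - 1, u.2 - 1)) (by simp; omega) l
        simp only at h2
        rw [show u.1 + -((l : ℤ) + 1) = u.1 - 1 - l by ring,
          show u.2 + 1 + 2 * -((l : ℤ) + 1) = u.2 - 1 - 2 * l by ring]
        exact (wt_add_le_wt_down hu.le).trans h2
  have hac : a = leadY (γt ^ n) t c := by
    funext u
    have h0 := (hpos u).tsum_eq_zero_add
    simp only [leadY, hc]
    simp only [Nat.cast_zero, add_zero, mul_zero, pow_zero, one_mul] at h0
    have h1 : (∑' l : ℕ, t ^ (l + 1) * a (u.1 + ((l + 1 : ℕ) : ℤ), u.2 + 2 * ((l + 1 : ℕ) : ℤ)))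
        = t * ∑' l : ℕ, t ^ l * a (u.1 + 1 + l, u.2 + 1 + 1 + 2 * l) := by
      rw [← tsum_mul_left]
      congr 1
      funext l
      push_cast
      rw [show u.1 + ((l : ℤ) + 1) = u.1 + 1 + l by ring,
        show u.2 + 2 * ((l : ℤ) + 1) = u.2 + 1 + 1 + 2 * l by ring]
      ring
    rw [h1] at h0
    rw [sub_add_cancel, h0]
    field_simp
    ring
  refine ⟨c, hbound, hac, ?_⟩
  -- The second component follows from the first because leadY is injective.
  have h1 : leadY (γt ^ n) t (b + leadX n (γt ^ n) t c) = 0 := by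
    rw [leadY_add, ← leadX_leadY_comm, ← hac, add_comm, heq]
  have h2 := eq_zero_of_leadY_eq_zero h (hb.add (leadX_wtBound h hbound)) h1
  exact eq_neg_of_add_eq_zero_left h2

end

/-! ### The operators `D_x` and `D_y` -/

section

variable {K : Type*} [NormedField K]

/-- The hypotheses on the constants that enter the operators `D_x` and `D_y`. -/
structure OperatorData (p n : ℕ) (γt tb : K) (σ : K ≃+* K) : Prop extends
    LeadingData n γt tb where
  lt : n < p
  norm_iterate : ∀ i, ‖σ^[i] tb‖ = 1
  norm_gammaSeq : ∀ i, ‖gammaSeq p (γt ^ n) i * (p : K) ^ i‖ * ‖γt‖ ^ (n * (p - 1)) ≤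
    ‖γt‖ ^ (n * p ^ (i + 1))

/-- The `i`-th term of `D_x` or `D_y`. -/
def shiftTerm (p n : ℕ) (γt tb : K) (σ : K ≃+* K) (m : K) (d : ℤ × ℤ) (i : ℕ) (η : ℤ × ℤ → K)
    (u : ℤ × ℤ) : K :=
  gammaSeq p (γt ^ n) i * (p : K) ^ i *
    (m * η (u.1 - d.1 * p ^ i, u.2 - d.2 * p ^ i) - σ^[i] tb * η (u.1 + p ^ i, u.2 + p ^ i))

/-- The common form of `D_x` and `D_y`. -/
def diffOp (p n : ℕ) (γt tb : K) (σ : K ≃+* K) (c : ℤ × ℤ → ℤ) (m : K) (d : ℤ × ℤ)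
    (η : ℤ × ℤ → K) (u : ℤ × ℤ) : K :=
  (c u : K) * η u + ∑' i, shiftTerm p n γt tb σ m d i η u

/-- `D_x` or `D_y` without its leading part. -/
def tailOp (p n : ℕ) (γt tb : K) (σ : K ≃+* K) (c : ℤ × ℤ → ℤ) (m : K) (d : ℤ × ℤ)
    (η : ℤ × ℤ → K) (u : ℤ × ℤ) : K :=
  (c u : K) * η u + ∑' i, shiftTerm p n γt tb σ m d (i + 1) η u

/-- The monomial with exponent `d` has weight `n`, and `m` is a unit. -/
def IsUnitDirection (n : ℕ) (m : K) (d : ℤ × ℤ) : Prop :=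
  ‖m‖ = 1 ∧ ∀ (k : ℕ) (u : ℤ × ℤ), wt n u ≤ wt n (u.1 - d.1 * k, u.2 - d.2 * k) + n * k

variable {p n : ℕ} {γt tb : K} {σ : K ≃+* K}

theorem Dx_eq_diffOp : Dx p n γt tb σ = diffOp p n γt tb σ Prod.fst n (n, 0) := by
  funext η u
  simp [Dx, diffOp, shiftTerm]

theorem Dy_eq_diffOp : Dy p n γt tb σ = diffOp p n γt tb σ Prod.snd 1 (0, 1) := by
  funext η u
  simp [Dy, diffOp, shiftTerm]

theorem gammaSeq_zero (p : ℕ) (γ : K) : gammaSeq p γ 0 = γ := by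
  simp [gammaSeq]

theorem shiftTerm_zero_x (η : ℤ × ℤ → K) (u : ℤ × ℤ) :
    shiftTerm p n γt tb σ n (n, 0) 0 η u = leadX n (γt ^ n) tb η u := by
  simp [shiftTerm, leadX, gammaSeq_zero]

theorem shiftTerm_zero_y (η : ℤ × ℤ → K) (u : ℤ × ℤ) :
    shiftTerm p n γt tb σ 1 (0, 1) 0 η u = leadY (γt ^ n) tb η u := by
  simp [shiftTerm, leadY, gammaSeq_zero]

theorem shiftTerm_add (m : K) (d : ℤ × ℤ) (i : ℕ) (η η' : ℤ × ℤ → K) (u : ℤ × ℤ) :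
    shiftTerm p n γt tb σ m d i (η + η') u
      = shiftTerm p n γt tb σ m d i η u + shiftTerm p n γt tb σ m d i η' u := by
  simp only [shiftTerm, Pi.add_apply]
  ring

theorem shiftTerm_sub (m : K) (d : ℤ × ℤ) (i : ℕ) (η η' : ℤ × ℤ → K) (u : ℤ × ℤ) :
    shiftTerm p n γt tb σ m d i (η - η') u
      = shiftTerm p n γt tb σ m d i η u - shiftTerm p n γt tb σ m d i η' u := by
  simp only [shiftTerm, Pi.sub_apply]
  ring

theorem shiftTerm_comm (m m' : K) (d d' : ℤ × ℤ) (i j : ℕ) (η : ℤ × ℤ → K)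
    (u : ℤ × ℤ) :
    shiftTerm p n γt tb σ m d i (shiftTerm p n γt tb σ m' d' j η) u
      = shiftTerm p n γt tb σ m' d' j (shiftTerm p n γt tb σ m d i η) u := by
  simp only [shiftTerm]
  simp only [sub_sub, sub_add_eq_add_sub, add_sub_assoc, add_assoc]
  ring_nf

theorem isUnitDirection_x (h : LeadingData n γt tb) : IsUnitDirection (K := K) n n (n, 0) :=
  ⟨h.norm_natCast, fun k u => by simpa using wt_le_sub_fst_add n k u⟩

theorem isUnitDirection_y : IsUnitDirection (K := K) n 1 (0, 1) :=
  ⟨norm_one, fun k u => by simpa using wt_le_sub_snd_add n k u⟩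

namespace OperatorData

theorem three_le (h : OperatorData p n γt tb σ) : 3 ≤ p := by
  have := h.two_le
  have := h.lt
  omega

theorem norm_le_wt_of_mul (h : OperatorData p n γt tb σ)
    {k : ℕ} {C : ℝ} {η : ℤ × ℤ → K} (hC : 0 ≤ C)
    (hη : WtBound n γt (k + 1) (C * ‖γt‖ ^ (k * n)) η) : WtBound n γt (k + 1) C η :=
  hη.mono (mul_le_of_le_one_right hC (pow_le_one₀ (norm_nonneg _) h.norm_lt_one.le))

/-- A crude geometric bound, sufficient for the convergence of the series defining the operators. -/
theorem norm_gammaSeq_le_pow (h : OperatorData p n γt tb σ)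
    (i : ℕ) : ‖gammaSeq p (γt ^ n) i * (p : K) ^ i‖ ≤ ‖γt‖ ^ i := by
  have hπ := h.norm_pos
  have h3 := h.three_le
  have hpow : p * (i + 1) ≤ p ^ (i + 1) := by
    have h1 : i < p ^ i := Nat.lt_pow_self (by omega)
    calc p * (i + 1) ≤ p * p ^ i := Nat.mul_le_mul_left _ h1
      _ = p ^ (i + 1) := (pow_succ' _ _).symm
  have hexp : i + n * (p - 1) ≤ n * p ^ (i + 1) := by
    have h1 : n * (p - 1 + i) ≤ n * p ^ (i + 1) := by
      refine Nat.mul_le_mul_left _ (le_trans ?_ hpow)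
      have : i ≤ p * i := Nat.le_mul_of_pos_left _ (by omega)
      rw [mul_add, mul_one]
      omega
    have h2 : i ≤ n * i := Nat.le_mul_of_pos_left _ (by have := h.two_le; omega)
    rw [mul_add] at h1
    omega
  have h1 := (h.norm_gammaSeq i).trans
    (pow_le_pow_of_le_one hπ.le h.norm_lt_one.le hexp)
  rw [pow_add] at h1
  exact le_of_mul_le_mul_right h1 (by positivity)

end OperatorData

variable [IsUltrametricDist K] {m : K} {d : ℤ × ℤ} {c : ℤ × ℤ → ℤ} {C : ℝ} {η η' : ℤ × ℤ → K}

theorem norm_intCast_mul_le (z : ℤ) {x : K} (hx : ‖x‖ ≤ C) : ‖(z : K) * x‖ ≤ C := by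
  rw [norm_mul]
  exact (mul_le_of_le_one_left (norm_nonneg _) (IsUltrametricDist.norm_intCast_le_one K z)).trans hx

namespace OperatorData

theorem norm_shiftTerm_le (h : OperatorData p n γt tb σ)
    (hm : ‖m‖ ≤ 1) (hη : ∀ u, ‖η u‖ ≤ C) (i : ℕ) (u : ℤ × ℤ) :
    ‖shiftTerm p n γt tb σ m d i η u‖ ≤ ‖γt‖ ^ i * C := by
  rw [shiftTerm, norm_mul]
  refine mul_le_mul (h.norm_gammaSeq_le_pow i) ?_ (norm_nonneg _) (by positivity)
  refine norm_sub_le_of_le ?_ ?_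
  · rw [norm_mul]
    exact (mul_le_of_le_one_left (norm_nonneg _) hm).trans (hη _)
  · rw [norm_mul, h.norm_iterate, one_mul]
    exact hη _

theorem norm_shiftTerm_le' (h : OperatorData p n γt tb σ)
    (hm : ‖m‖ ≤ 1) (hη : ∀ u, ‖η u‖ ≤ C) (i : ℕ) (u : ℤ × ℤ) :
    ‖shiftTerm p n γt tb σ m d i η u‖ ≤ C := by
  have hC : 0 ≤ C := (norm_nonneg _).trans (hη 0)
  exact (h.norm_shiftTerm_le hm hη i u).trans
    (mul_le_of_le_one_left hC (pow_le_one₀ (norm_nonneg _) h.norm_lt_one.le))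

theorem norm_diffOp_le (h : OperatorData p n γt tb σ)
    (hm : ‖m‖ ≤ 1) (hη : ∀ u, ‖η u‖ ≤ C) (u : ℤ × ℤ) :
    ‖diffOp p n γt tb σ c m d η u‖ ≤ C := by
  refine norm_add_le_of_le (norm_intCast_mul_le _ (hη u)) ?_
  exact IsUltrametricDist.norm_tsum_le_of_forall_le fun i => h.norm_shiftTerm_le' hm hη i u

/-- A term of the operators acting on series of bounded weight. -/
theorem norm_shiftTerm_le_of_wtBound (h : OperatorData p n γt tb σ)
    (hd : IsUnitDirection n m d) {k f e i : ℕ} (hC : 0 ≤ C)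
    (hη : WtBound n γt k (C * ‖γt‖ ^ f) η) (u : ℤ × ℤ)
    (he : ∀ w, wt n u ≤ w + n * p ^ i → n * (p - 1) + e ≤ n * p ^ (i + 1) + k * w + f) :
    ‖shiftTerm p n γt tb σ m d i η u‖ ≤ C * ‖γt‖ ^ e := by
  have hπ := h.norm_pos
  have key : ∀ u', wt n u ≤ wt n u' + n * p ^ i →
      ‖gammaSeq p (γt ^ n) i * (p : K) ^ i‖ * ‖η u'‖ ≤ C * ‖γt‖ ^ e := by
    intro u' hu'
    have h1 : ‖gammaSeq p (γt ^ n) i * (p : K) ^ i‖ * ‖η u'‖ * ‖γt‖ ^ (n * (p - 1))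
        ≤ C * ‖γt‖ ^ e * ‖γt‖ ^ (n * (p - 1)) := by
      calc _ = (‖gammaSeq p (γt ^ n) i * (p : K) ^ i‖ * ‖γt‖ ^ (n * (p - 1))) * ‖η u'‖ := by ring
        _ ≤ ‖γt‖ ^ (n * p ^ (i + 1)) * (C * ‖γt‖ ^ f * ‖γt‖ ^ (k * wt n u')) :=
            mul_le_mul (h.norm_gammaSeq i) (hη u') (norm_nonneg _) (by positivity)
        _ = C * ‖γt‖ ^ (n * p ^ (i + 1) + k * wt n u' + f) := by ring
        _ ≤ C * ‖γt‖ ^ (n * (p - 1) + e) := mul_le_mul_of_nonneg_left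
            (pow_le_pow_of_le_one hπ.le h.norm_lt_one.le (he _ hu')) hC
        _ = _ := by ring
    exact le_of_mul_le_mul_right h1 (by positivity)
  rw [shiftTerm, mul_sub]
  refine norm_sub_le_of_le ?_ ?_
  · rw [norm_mul, norm_mul m, hd.1, one_mul]
    refine key _ ?_
    have := hd.2 (p ^ i) u
    push_cast at this
    exact this
  · rw [norm_mul, norm_mul (σ^[i] tb), h.norm_iterate, one_mul]
    refine key _ ?_
    have := wt_le_add_add n (p ^ i) u
    push_cast at this
    exact this

/-- The i-th shifts lower the weight by at most n p^i, a loss of (k+1) n p^i in the exponent.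
Against it stand n(p^(i+1) − p + 1) from γ_i p^i and the reserve k n. The balance is n(p − k −
1)(p^i − 1), whence the condition k + 1 ≤ p. -/
theorem norm_shiftTerm_le_wt (h : OperatorData p n γt tb σ)
    (hd : IsUnitDirection n m d) {k : ℕ} (hk : k + 1 ≤ p) (hC : 0 ≤ C)
    (hη : WtBound n γt (k + 1) (C * ‖γt‖ ^ (k * n)) η) (i : ℕ) (u : ℤ × ℤ) :
    ‖shiftTerm p n γt tb σ m d i η u‖ ≤ C * ‖γt‖ ^ ((k + 1) * wt n u) := by
  refine h.norm_shiftTerm_le_of_wtBound hd hC hη u fun w hw => ?_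
  have h1 : 1 ≤ p ^ i := Nat.one_le_pow _ _ (by omega)
  obtain ⟨r, rfl⟩ : ∃ r, p = k + 1 + r := ⟨p - (k + 1), by omega⟩
  generalize hP : (k + 1 + r) ^ i = P at *
  have h2 : (k + 1) * wt n u ≤ (k + 1) * (w + n * P) := Nat.mul_le_mul_left _ hw
  have h3 : n * r * 1 ≤ n * r * P := Nat.mul_le_mul_left _ h1
  rw [pow_succ, hP, show k + 1 + r - 1 = k + r by omega]
  nlinarith

theorem tailOp_wtBound (h : OperatorData p n γt tb σ)
    (hd : IsUnitDirection n m d) {k : ℕ} (hk : k + 1 ≤ p) (hC : 0 ≤ C)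
    (hη : WtBound n γt (k + 1) (C * ‖γt‖ ^ (k * n)) η) :
    WtBound n γt (k + 1) C (tailOp p n γt tb σ c m d η) := fun u =>
  norm_add_le_of_le (norm_intCast_mul_le _ (h.norm_le_wt_of_mul hC hη u))
    (IsUltrametricDist.norm_tsum_le_of_forall_le fun i =>
      h.norm_shiftTerm_le_wt hd hk hC hη (i + 1) u)

theorem diffOp_wtBound (h : OperatorData p n γt tb σ)
    (hd : IsUnitDirection n m d) {k : ℕ} (hk : k + 1 ≤ p) (hC : 0 ≤ C)
    (hη : WtBound n γt (k + 1) (C * ‖γt‖ ^ (k * n)) η) :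
    WtBound n γt (k + 1) C (diffOp p n γt tb σ c m d η) := fun u =>
  norm_add_le_of_le (norm_intCast_mul_le _ (h.norm_le_wt_of_mul hC hη u))
    (IsUltrametricDist.norm_tsum_le_of_forall_le fun i => h.norm_shiftTerm_le_wt hd hk hC hη i u)

/-- At rate 2 the terms i ≥ 1 lose nothing, since p^(i+1)(p − 2) ≥ p − 1 for p ≥ 3. The factor
|γ̃|^n survives, and this is the contraction behind every iteration below. -/
theorem tailOp_wtBound_two (h : OperatorData p n γt tb σ) (hd : IsUnitDirection n m d) (hC : 0 ≤ C)
    (hη : WtBound n γt 2 (C * ‖γt‖ ^ n) η) :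
    WtBound n γt 2 (C * ‖γt‖ ^ n) (tailOp p n γt tb σ c m d η) := by
  intro u
  refine norm_add_le_of_le (norm_intCast_mul_le _ (hη u)) ?_
  rw [mul_assoc, ← pow_add]
  refine IsUltrametricDist.norm_tsum_le_of_forall_le fun i =>
      h.norm_shiftTerm_le_of_wtBound hd hC hη u fun w hw => ?_
  have h3 := h.three_le
  have h1 : p ≤ p ^ (i + 1) := Nat.le_self_pow i.succ_ne_zero p
  obtain ⟨r, rfl⟩ : ∃ r, p = 3 + r := ⟨p - 3, by omega⟩
  generalize hP : (3 + r) ^ (i + 1) = P at *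
  have h4 : n * (r + 1) * (3 + r) ≤ n * (r + 1) * P := Nat.mul_le_mul_left _ h1
  rw [pow_succ, hP, show 3 + r - 1 = 2 + r by omega]
  nlinarith [Nat.zero_le (n * r), Nat.zero_le (n * r * r)]

/-- At rate p the general estimate gives no gain. On the weights of the basis monomials, however, n
p² exceeds 2np by at least np, and p − 1 further powers of γ̃ are won. This is the margin used in
(c). -/
theorem norm_tailOp_le_of_wt_le (h : OperatorData p n γt tb σ)
    (hd : IsUnitDirection n m d) (hC : 0 ≤ C)
    (hη : WtBound n γt p (C * ‖γt‖ ^ ((p - 1) * n)) η) {u : ℤ × ℤ} (hu : wt n u ≤ 2 * n) :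
    ‖tailOp p n γt tb σ c m d η u‖ ≤ C * ‖γt‖ ^ (p * wt n u + (p - 1)) := by
  have h2 := h.two_le
  have h3 := h.three_le
  refine norm_add_le_of_le (norm_intCast_mul_le _ ((hη u).trans ?_)) ?_
  · rw [mul_assoc, ← pow_add]
    refine mul_le_mul_of_nonneg_left (pow_le_pow_of_le_one (norm_nonneg _) h.norm_lt_one.le ?_) hC
    have : p - 1 ≤ (p - 1) * n := Nat.le_mul_of_pos_right _ (by omega)
    omega
  · refine IsUltrametricDist.norm_tsum_le_of_forall_le fun i =>
      h.norm_shiftTerm_le_of_wtBound hd hC hη u fun w _ => ?_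
    have h1 : p ≤ p ^ (i + 1) := Nat.le_self_pow i.succ_ne_zero p
    have h4 : p * wt n u ≤ p * (2 * n) := Nat.mul_le_mul_left _ hu
    have h5 : p * (n * 3) ≤ p * (n * p ^ (i + 1)) :=
      Nat.mul_le_mul_left _ (Nat.mul_le_mul_left _ (h3.trans h1))
    have h6 : p * 1 ≤ p * n := Nat.mul_le_mul_left _ (by omega)
    have h7 : n * p ^ (i + 1 + 1) = p * (n * p ^ (i + 1)) := by ring
    have h8 : n * (p - 1) = (p - 1) * n := mul_comm _ _
    rw [h7, h8]
    have h9 : p * (n * 3) = p * (2 * n) + p * n := by ring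
    omega

variable [CompleteSpace K]

theorem summable_shiftTerm (h : OperatorData p n γt tb σ)
    (hm : ‖m‖ ≤ 1) (hη : ∀ u, ‖η u‖ ≤ C) (u : ℤ × ℤ) :
    Summable fun i => shiftTerm p n γt tb σ m d i η u :=
  Summable.of_norm_bounded
    ((summable_geometric_of_lt_one (norm_nonneg _) h.norm_lt_one).mul_right C)
    fun i => h.norm_shiftTerm_le hm hη i u

theorem diffOp_add (h : OperatorData p n γt tb σ)
    (hm : ‖m‖ ≤ 1) (hη : ∀ u, ‖η u‖ ≤ C) (hη' : ∀ u, ‖η' u‖ ≤ C) :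
    diffOp p n γt tb σ c m d (η + η')
      = diffOp p n γt tb σ c m d η + diffOp p n γt tb σ c m d η' := by
  funext u
  simp only [diffOp, Pi.add_apply, shiftTerm_add]
  rw [(h.summable_shiftTerm hm hη u).tsum_add (h.summable_shiftTerm hm hη' u)]
  ring

theorem diffOp_sub (h : OperatorData p n γt tb σ)
    (hm : ‖m‖ ≤ 1) (hη : ∀ u, ‖η u‖ ≤ C) (hη' : ∀ u, ‖η' u‖ ≤ C) :
    diffOp p n γt tb σ c m d (η - η')
      = diffOp p n γt tb σ c m d η - diffOp p n γt tb σ c m d η' := by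
  funext u
  simp only [diffOp, Pi.sub_apply, shiftTerm_sub]
  rw [(h.summable_shiftTerm hm hη u).tsum_sub (h.summable_shiftTerm hm hη' u)]
  ring

theorem Dx_eq_lead_add_tail (h : OperatorData p n γt tb σ) (hη : ∀ u, ‖η u‖ ≤ C) :
    Dx p n γt tb σ η = leadX n (γt ^ n) tb η + tailOp p n γt tb σ Prod.fst n (n, 0) η := by
  funext u
  rw [Dx_eq_diffOp, diffOp, (h.summable_shiftTerm h.norm_natCast.le hη u).tsum_eq_zero_add,
    shiftTerm_zero_x, Pi.add_apply, tailOp]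
  ring

theorem Dy_eq_lead_add_tail (h : OperatorData p n γt tb σ) (hη : ∀ u, ‖η u‖ ≤ C) :
    Dy p n γt tb σ η = leadY (γt ^ n) tb η + tailOp p n γt tb σ Prod.snd 1 (0, 1) η := by
  funext u
  rw [Dy_eq_diffOp, diffOp, (h.summable_shiftTerm norm_one.le hη u).tsum_eq_zero_add,
    shiftTerm_zero_y, Pi.add_apply, tailOp]
  ring

/-- Arranged so that for D_x and D_y each of the three summands is symmetric by itself. -/
theorem diffOp_diffOp (h : OperatorData p n γt tb σ)
    {m' : K} {d' : ℤ × ℤ} {c' : ℤ × ℤ → ℤ} (hm : ‖m‖ ≤ 1) (hm' : ‖m'‖ ≤ 1)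
    (hη : ∀ u, ‖η u‖ ≤ C) (u : ℤ × ℤ) :
    diffOp p n γt tb σ c m d (diffOp p n γt tb σ c' m' d' η) u = (c u : K) * c' u * η u
      + ∑' i, ((c u : K) * shiftTerm p n γt tb σ m' d' i η u
        + shiftTerm p n γt tb σ m d i (fun w => (c' w : K) * η w) u)
      + ∑' i, ∑' j, shiftTerm p n γt tb σ m d i (shiftTerm p n γt tb σ m' d' j η) u := by
  have hC : 0 ≤ C := (norm_nonneg _).trans (hη 0)
  have h1 : ∀ i, shiftTerm p n γt tb σ m d i (diffOp p n γt tb σ c' m' d' η) u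
      = shiftTerm p n γt tb σ m d i (fun w => (c' w : K) * η w) u
        + ∑' j, shiftTerm p n γt tb σ m d i (shiftTerm p n γt tb σ m' d' j η) u := by
    intro i
    have hs := h.summable_shiftTerm (d := d') hm' hη
    simp only [shiftTerm.eq_def (d := d) (m := m), diffOp]
    rw [tsum_mul_left, ((hs _).mul_left _).tsum_sub ((hs _).mul_left _), tsum_mul_left,
      tsum_mul_left]
    ring
  have hcη : ∀ w, ‖(c' w : K) * η w‖ ≤ C := fun w => norm_intCast_mul_le _ (hη w)
  have hs1 := h.summable_shiftTerm (d := d) hm hcη u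
  have hs2 := h.summable_shiftTerm (d := d') hm' hη u
  have hs3 : Summable fun i =>
      ∑' j, shiftTerm p n γt tb σ m d i (shiftTerm p n γt tb σ m' d' j η) u := by
    refine Summable.of_norm_bounded
      ((summable_geometric_of_lt_one (norm_nonneg _) h.norm_lt_one).mul_right C) fun i => ?_
    exact IsUltrametricDist.norm_tsum_le_of_forall_le fun j =>
      h.norm_shiftTerm_le hm (fun w => h.norm_shiftTerm_le' hm' hη j w) i u
  rw [diffOp]
  simp only [h1]
  rw [hs1.tsum_add hs3, (hs2.mul_left _).tsum_add hs1, tsum_mul_left, diffOp]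
  ring

/-- The derivation x∂/∂x of the series in D_y and y∂/∂y of the series in D_x both equal ∑ γ_i p^(2i)
σ^i(t) (xy)^(−p^i). -/
theorem Dx_Dy_comm (h : OperatorData p n γt tb σ) (hη : ∀ u, ‖η u‖ ≤ C) :
    Dx p n γt tb σ (Dy p n γt tb σ η) = Dy p n γt tb σ (Dx p n γt tb σ η) := by
  have hC : 0 ≤ C := (norm_nonneg _).trans (hη 0)
  funext u
  rw [Dx_eq_diffOp, Dy_eq_diffOp, h.diffOp_diffOp h.norm_natCast.le norm_one.le hη,
    h.diffOp_diffOp norm_one.le h.norm_natCast.le hη]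
  congr 1
  · congr 1
    · ring
    · congr 1
      funext i
      simp only [shiftTerm]
      push_cast
      ring
  · rw [Summable.tsum_comm]
    · simp only [shiftTerm_comm _ (n : K)]
    · have hg := summable_geometric_of_lt_one (norm_nonneg γt) h.norm_lt_one
      refine Summable.of_norm_bounded
        ((hg.mul_of_nonneg hg (fun _ => by positivity) fun _ => by positivity).mul_right C) ?_
      rintro ⟨i, j⟩
      simp only [Function.uncurry]
      rw [mul_assoc, shiftTerm_comm]
      exact h.norm_shiftTerm_le norm_one.le
        (fun w => h.norm_shiftTerm_le h.norm_natCast.le hη j w) i u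

end OperatorData

end

/-! ### Reduction to the basis in cohomology -/

section

variable {K : Type*} [NormedField K] {p n : ℕ} {γt tb : K} {σ : K ≃+* K} {C : ℝ}
  {β : ℤ × ℤ → K}

theorem basisSum_add (v v' : Fin (2 * n + 1) → K) :
    basisSum n (v + v') = basisSum n v + basisSum n v' := by
  simp only [basisSum, Pi.add_apply, add_smul, Finset.sum_add_distrib]

theorem basisSum_sub (v v' : Fin (2 * n + 1) → K) :
    basisSum n (v - v') = basisSum n v - basisSum n v' := by
  simp only [basisSum, Pi.sub_apply, sub_smul, Finset.sum_sub_distrib]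

theorem norm_basisSum_le {v : Fin (2 * n + 1) → K} (hC : 0 ≤ C) (hv : ∀ j, ‖v j‖ ≤ C)
    (u : ℤ × ℤ) : ‖basisSum n v u‖ ≤ C := by
  by_cases hu : ∃ j : Fin (2 * n + 1), u = eps n j
  · obtain ⟨j, rfl⟩ := hu
    rw [basisSum_apply_eps]
    exact hv j
  · rw [basisSum_apply_of_ne v fun j hj => hu ⟨j, hj⟩, norm_zero]
    exact hC

theorem WtBound.norm_le_of_le_wt {k j : ℕ} (hβ : WtBound n γt k C β) (hC : 0 ≤ C)
    (hγ : ‖γt‖ ≤ 1) {w : ℤ × ℤ} (hw : j ≤ wt n w) : ‖β w‖ ≤ C * ‖γt‖ ^ (k * j) :=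
  (hβ w).trans (mul_le_mul_of_nonneg_left
    (pow_le_pow_of_le_one (norm_nonneg _) hγ (Nat.mul_le_mul_left _ hw)) hC)

variable [IsUltrametricDist K] [CompleteSpace K]

namespace OperatorData

/-- Reduce modulo the leading parts, then replace these by the full operators; the new remainder is
minus the two tails. It contracts by |γ̃|^n at rate 2, keeps every rate up to p, and gains p − 1
powers of γ̃ on the weights that matter. -/
theorem exists_step (h : OperatorData p n γt tb σ)
    (β : {β : ℤ × ℤ → K // ∃ C, WtBound n γt 2 C β}) :
    ∃ (v : Fin (2 * n + 1) → K) (hx hy : ℤ × ℤ → K)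
      (β' : {β : ℤ × ℤ → K // ∃ C, WtBound n γt 2 C β}),
      β.1 = basisSum n v + Dx p n γt tb σ hx + Dy p n γt tb σ hy + β'.1 ∧
      (∀ C, WtBound n γt 2 C β.1 → WtBound n γt 2 (C * ‖γt‖ ^ n) hx ∧
        WtBound n γt 2 (C * ‖γt‖ ^ n) hy ∧ WtBound n γt 2 (C * ‖γt‖ ^ n) β'.1) ∧
      (∀ k D, k + 1 ≤ p → WtBound n γt (k + 1) D β.1 → WtBound n γt (k + 1) D β'.1) ∧
      (∀ D, WtBound n γt p D β.1 → ∀ u, wt n u ≤ 2 * n →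
        ‖β'.1 u‖ ≤ D * ‖γt‖ ^ (p * wt n u + (p - 1))) ∧
      (∀ (j : Fin (2 * n + 1)) (E : ℝ), 0 ≤ E →
        (∀ w, (j : ℕ) ≤ wt n w → w ≠ eps n j → ‖β.1 w‖ ≤ E) → ‖v j - β.1 (eps n j)‖ ≤ E) := by
  obtain ⟨β, C, hβ⟩ := β
  have hπ := h.norm_pos
  have hC := hβ.nonneg hπ
  obtain ⟨v, hx, hy, heq, hb, hv⟩ := exists_leading_reduction h.toLeadingData hβ
  have hdx := isUnitDirection_x h.toLeadingData
  have hdy := isUnitDirection_y (K := K) (n := n)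
  have hb2 : ∀ D, WtBound n γt 2 D β → WtBound n γt 2 (D * ‖γt‖ ^ n) hx ∧
      WtBound n γt 2 (D * ‖γt‖ ^ n) hy := fun D hD => by simpa using hb 1 D hD
  set β' : ℤ × ℤ → K := -(tailOp p n γt tb σ Prod.fst n (n, 0) hx
    + tailOp p n γt tb σ Prod.snd 1 (0, 1) hy) with hβ'
  have h2 : ∀ D, WtBound n γt 2 D β → WtBound n γt 2 (D * ‖γt‖ ^ n) β' := fun D hD =>
    ((h.tailOp_wtBound_two hdx (hD.nonneg hπ) (hb2 D hD).1).add
      (h.tailOp_wtBound_two hdy (hD.nonneg hπ) (hb2 D hD).2)).neg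
  refine ⟨v, hx, hy, ⟨β', _, h2 C hβ⟩, ?_, fun D hD => ⟨(hb2 D hD).1, (hb2 D hD).2, h2 D hD⟩,
    ?_, ?_, hv⟩
  · have hC' : 0 ≤ C * ‖γt‖ ^ n := by positivity
    rw [h.Dx_eq_lead_add_tail ((hb2 C hβ).1.norm_le h.norm_lt_one.le hC'),
      h.Dy_eq_lead_add_tail ((hb2 C hβ).2.norm_le h.norm_lt_one.le hC')]
    simp only [hβ']
    conv_lhs => rw [heq]
    abel
  · intro k D hk hD
    exact ((h.tailOp_wtBound hdx hk (hD.nonneg hπ) (hb k D hD).1).add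
      (h.tailOp_wtBound hdy hk (hD.nonneg hπ) (hb k D hD).2)).neg
  · intro D hD u hu
    have hp : p - 1 + 1 = p := Nat.sub_add_cancel (by have := h.three_le; omega)
    have hD' : WtBound n γt (p - 1 + 1) D β := by rwa [hp]
    have hbp := hb (p - 1) D hD'
    rw [hp] at hbp
    have h1 := h.norm_tailOp_le_of_wt_le (c := Prod.fst) hdx (hD.nonneg hπ) hbp.1 hu
    have h2 := h.norm_tailOp_le_of_wt_le (c := Prod.snd) hdy (hD.nonneg hπ) hbp.2 hu
    simp only [hβ', Pi.neg_apply, norm_neg]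
    exact norm_add_le_of_le h1 h2

/-- Reduction of a series to a combination of basis monomials modulo the images of `D_x`, `D_y`. -/
theorem exists_reduction (h : OperatorData p n γt tb σ) (hβ : WtBound n γt 2 C β) :
    ∃ (v : Fin (2 * n + 1) → K) (zx zy : ℤ × ℤ → K),
      β = basisSum n v + Dx p n γt tb σ zx + Dy p n γt tb σ zy ∧
      WtBound n γt 2 C zx ∧ WtBound n γt 2 C zy ∧
      (∀ k D, k + 1 ≤ p → WtBound n γt (k + 1) D β →
        ∀ j, ‖v j‖ ≤ D * ‖γt‖ ^ ((k + 1) * (j : ℕ))) ∧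
      (∀ D, WtBound n γt p D β → ∀ (j : Fin (2 * n + 1)) (E : ℝ),
        D * ‖γt‖ ^ (p * (j : ℕ) + (p - 1)) ≤ E →
        (∀ w, wt n w = j → w ≠ eps n j → ‖β w‖ ≤ E) → ‖v j - β (eps n j)‖ ≤ E) := by
  have hπ := h.norm_pos
  have hπ1 := h.norm_lt_one
  have h3 := h.three_le
  have hC := hβ.nonneg hπ
  choose V HX HY R hR1 hR2 hR3 hR4 hR5 using h.exists_step
  -- The remainder after m steps. Its geometric decay allows the contributions of all steps to be
  -- summed.
  let B : ℕ → {β : ℤ × ℤ → K // ∃ C, WtBound n γt 2 C β} := fun m => R^[m] ⟨β, C, hβ⟩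
  have hB0 : (B 0).1 = β := rfl
  have hBs : ∀ m, B (m + 1) = R (B m) := fun m => Function.iterate_succ_apply' _ _ _
  have hr : ‖γt‖ ^ n < 1 := pow_lt_one₀ hπ.le hπ1 (by have := h.two_le; omega)
  have hr0 : 0 ≤ ‖γt‖ ^ n := by positivity
  have hb2 : ∀ m, WtBound n γt 2 (C * (‖γt‖ ^ n) ^ m) (B m).1 := by
    intro m
    induction m with
    | zero =>
      rw [pow_zero, mul_one, hB0]
      exact hβ
    | succ m ih =>
      rw [hBs, pow_succ, ← mul_assoc]
      exact (hR2 _ _ ih).2.2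
  have hbk : ∀ k D, k + 1 ≤ p → WtBound n γt (k + 1) D β →
      ∀ m, WtBound n γt (k + 1) D (B m).1 := by
    intro k D hk hD m
    induction m with
    | zero => exact hD
    | succ m ih => rw [hBs]; exact hR3 _ k D hk ih
  have hvk : ∀ (m k : ℕ) (D : ℝ), WtBound n γt (k + 1) D (B m).1 → ∀ j : Fin (2 * n + 1),
      ‖V (B m) j‖ ≤ D * ‖γt‖ ^ ((k + 1) * (j : ℕ)) := by
    intro m k D hD j
    have hD0 := hD.nonneg hπ
    have h1 := hR5 (B m) j (D * ‖γt‖ ^ ((k + 1) * (j : ℕ))) (by positivity)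
      fun w hw _ => hD.norm_le_of_le_wt hD0 hπ1.le hw
    have h2 := hD.norm_le_of_le_wt hD0 hπ1.le (wt_eps n j).ge
    have := norm_add_le_of_le h1 h2
    rwa [sub_add_cancel] at this
  -- geometric bounds for the terms of the three series
  have hpow : ∀ m, C * (‖γt‖ ^ n) ^ m * ‖γt‖ ^ n ≤ C * (‖γt‖ ^ n) ^ m := fun m =>
    mul_le_of_le_one_right (by positivity) hr.le
  have hgx : ∀ m, WtBound n γt 2 (C * (‖γt‖ ^ n) ^ m) (HX (B m)) := fun m =>
    (hR2 _ _ (hb2 m)).1.mono (hpow m)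
  have hgy : ∀ m, WtBound n γt 2 (C * (‖γt‖ ^ n) ^ m) (HY (B m)) := fun m =>
    (hR2 _ _ (hb2 m)).2.1.mono (hpow m)
  have hgv : ∀ m j, ‖V (B m) j‖ ≤ C * (‖γt‖ ^ n) ^ m := fun m j =>
    (hvk m 1 _ (hb2 m) j).trans
      (mul_le_of_le_one_right (by positivity) (pow_le_one₀ hπ.le hπ1.le))
  have hpowle : ∀ m, C * (‖γt‖ ^ n) ^ m ≤ C := fun m =>
    mul_le_of_le_one_right hC (pow_le_one₀ hr0 hr.le)
  have hmono : ∀ M m, C * (‖γt‖ ^ n) ^ (m + M) ≤ C * (‖γt‖ ^ n) ^ M := fun M m =>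
    mul_le_mul_of_nonneg_left (pow_le_pow_of_le_one hr0 hr.le (by omega)) hC
  have hnx : ∀ m u, ‖HX (B m) u‖ ≤ C * (‖γt‖ ^ n) ^ m := fun m =>
    (hgx m).norm_le hπ1.le (by positivity)
  have hny : ∀ m u, ‖HY (B m) u‖ ≤ C * (‖γt‖ ^ n) ^ m := fun m =>
    (hgy m).norm_le hπ1.le (by positivity)
  have hsum : ∀ f : ℕ → K, (∀ m, ‖f m‖ ≤ C * (‖γt‖ ^ n) ^ m) → Summable f := fun f hf =>
    Summable.of_norm_bounded ((summable_geometric_of_lt_one hr0 hr).mul_left C) hf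
  have htail : ∀ f : ℕ → K, (∀ m, ‖f m‖ ≤ C * (‖γt‖ ^ n) ^ m) → ∀ M,
      ‖∑' m, f m - ∑ m ∈ Finset.range M, f m‖ ≤ C * (‖γt‖ ^ n) ^ M := by
    intro f hf M
    rw [← (hsum f hf).sum_add_tsum_nat_add M, add_sub_cancel_left]
    exact IsUltrametricDist.norm_tsum_le_of_forall_le fun m => (hf _).trans (hmono M m)
  set v : Fin (2 * n + 1) → K := fun j => ∑' m, V (B m) j with hv
  set zx : ℤ × ℤ → K := fun u => ∑' m, HX (B m) u with hzx
  set zy : ℤ × ℤ → K := fun u => ∑' m, HY (B m) u with hzy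
  have hzx2 : WtBound n γt 2 C zx := fun u =>
    IsUltrametricDist.norm_tsum_le_of_forall_le fun m => (hgx m).mono (hpowle m) u
  have hzy2 : WtBound n γt 2 C zy := fun u =>
    IsUltrametricDist.norm_tsum_le_of_forall_le fun m => (hgy m).mono (hpowle m) u
  refine ⟨v, zx, zy, ?_, hzx2, hzy2, ?_, ?_⟩
  · -- partial sums
    let SV : ℕ → Fin (2 * n + 1) → K := fun M => ∑ m ∈ Finset.range M, V (B m)
    let SX : ℕ → ℤ × ℤ → K := fun M => ∑ m ∈ Finset.range M, HX (B m)
    let SY : ℕ → ℤ × ℤ → K := fun M => ∑ m ∈ Finset.range M, HY (B m)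
    have hSX : ∀ M u, ‖SX M u‖ ≤ C := fun M u => by
      simp only [SX, Finset.sum_apply]
      exact IsUltrametricDist.norm_sum_le_of_forall_le_of_nonneg hC
        fun m _ => (hnx m u).trans (hpowle m)
    have hSY : ∀ M u, ‖SY M u‖ ≤ C := fun M u => by
      simp only [SY, Finset.sum_apply]
      exact IsUltrametricDist.norm_sum_le_of_forall_le_of_nonneg hC
        fun m _ => (hny m u).trans (hpowle m)
    have hpart : ∀ M, β = basisSum n (SV M) + Dx p n γt tb σ (SX M) + Dy p n γt tb σ (SY M)
        + (B M).1 := by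
      intro M
      induction M with
      | zero =>
        have e1 : Dx p n γt tb σ 0 = 0 := by funext u; simp [Dx]
        have e2 : Dy p n γt tb σ 0 = 0 := by funext u; simp [Dy]
        simp only [SV, SX, SY, Finset.range_zero, Finset.sum_empty, e1, e2, hB0]
        simp [basisSum]
      | succ M ih =>
        have e0 : SV (M + 1) = SV M + V (B M) := Finset.sum_range_succ _ _
        have e1 : SX (M + 1) = SX M + HX (B M) := Finset.sum_range_succ _ _
        have e2 : SY (M + 1) = SY M + HY (B M) := Finset.sum_range_succ _ _
        rw [e0, e1, e2, basisSum_add, Dx_eq_diffOp, Dy_eq_diffOp,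
          h.diffOp_add h.norm_natCast.le (hSX M) fun u => (hnx M u).trans (hpowle M),
          h.diffOp_add norm_one.le (hSY M) fun u => (hny M u).trans (hpowle M),
          ← Dx_eq_diffOp, ← Dy_eq_diffOp, hBs]
        conv_lhs => rw [ih, hR1 (B M)]
        abel
    -- Both sides are compared with the M-step identity `hpart`. The remainder and the three
    -- truncation errors are each at most C |γ̃|^(nM).
    funext u
    rw [← sub_eq_zero, ← norm_le_zero_iff]
    have hlim : Tendsto (fun m : ℕ => C * (‖γt‖ ^ n) ^ m) atTop (𝓝 0) := by
      have := (tendsto_pow_atTop_nhds_zero_of_lt_one hr0 hr).const_mul C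
      rwa [mul_zero] at this
    refine ge_of_tendsto hlim (Eventually.of_forall fun M => ?_)
    have hM : 0 ≤ C * (‖γt‖ ^ n) ^ M := by positivity
    have hx0 := hzx2.norm_le hπ1.le hC
    have hy0 := hzy2.norm_le hπ1.le hC
    have e : β u - (basisSum n v + Dx p n γt tb σ zx + Dy p n γt tb σ zy) u
        = (B M).1 u - basisSum n (v - SV M) u - Dx p n γt tb σ (zx - SX M) u
          - Dy p n γt tb σ (zy - SY M) u := by
      rw [basisSum_sub, Dx_eq_diffOp, Dy_eq_diffOp, h.diffOp_sub h.norm_natCast.le hx0 (hSX M),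
        h.diffOp_sub norm_one.le hy0 (hSY M), ← Dx_eq_diffOp, ← Dy_eq_diffOp]
      conv_lhs => rw [hpart M]
      simp only [Pi.add_apply, Pi.sub_apply]
      ring
    rw [e]
    refine norm_sub_le_of_le (norm_sub_le_of_le (norm_sub_le_of_le ?_ ?_) ?_) ?_
    · exact (hb2 M).norm_le hπ1.le hM u
    · refine norm_basisSum_le hM (fun j => ?_) u
      simp only [hv, SV, Pi.sub_apply, Finset.sum_apply]
      exact htail _ (fun m => hgv m j) M
    · rw [Dx_eq_diffOp]
      refine h.norm_diffOp_le h.norm_natCast.le (fun w => ?_) u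
      simp only [hzx, SX, Pi.sub_apply, Finset.sum_apply]
      exact htail _ (fun m => hnx m w) M
    · rw [Dy_eq_diffOp]
      refine h.norm_diffOp_le norm_one.le (fun w => ?_) u
      simp only [hzy, SY, Pi.sub_apply, Finset.sum_apply]
      exact htail _ (fun m => hny m w) M
  · intro k D hk hD j
    exact IsUltrametricDist.norm_tsum_le_of_forall_le fun m => hvk m k D (hbk k D hk hD m) j
  · intro D hD j E hE hw
    have hD0 := hD.nonneg hπ
    have hE0 : 0 ≤ E := le_trans (by positivity) hE
    have hp : p - 1 + 1 = p := Nat.sub_add_cancel (by omega)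
    have hbp : ∀ m, WtBound n γt p D (B m).1 := fun m => by
      have := hbk (p - 1) D (by omega) (by rwa [hp]) m
      rwa [hp] at this
    -- One unit of weight is worth |γ̃|^p, more than the margin p − 1.
    have hbig : ∀ m w, (j : ℕ) + 1 ≤ wt n w → ‖(B m).1 w‖ ≤ E := by
      intro m w hw
      refine ((hbp m).norm_le_of_le_wt hD0 hπ1.le hw).trans (le_trans ?_ hE)
      refine mul_le_mul_of_nonneg_left (pow_le_pow_of_le_one hπ.le hπ1.le ?_) hD0
      rw [mul_add, mul_one]
      omega
    have hs := hsum (fun m => V (B m) j) fun m => hgv m j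
    rw [hv]
    simp only
    rw [hs.tsum_eq_zero_add, add_sub_right_comm]
    refine norm_add_le_of_le ?_ ?_
    · refine hR5 (B 0) j E hE0 fun w hjw hne => ?_
      rcases hjw.eq_or_lt with hjw | hjw
      · exact hw w hjw.symm hne
      · exact hbig 0 w hjw
    · refine IsUltrametricDist.norm_tsum_le_of_forall_le fun m => ?_
      -- Later remainders are negligible: weights up to 2n by the gain in the tails, larger ones
      -- because they exceed j.
      have hall : ∀ w, (j : ℕ) ≤ wt n w → ‖(B (m + 1)).1 w‖ ≤ E := by
        intro w hjw
        by_cases hw2 : wt n w ≤ 2 * n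
        · rw [hBs]
          refine (hR4 (B m) D (hbp m) w hw2).trans (le_trans ?_ hE)
          refine mul_le_mul_of_nonneg_left (pow_le_pow_of_le_one hπ.le hπ1.le ?_) hD0
          have := Nat.mul_le_mul_left p hjw
          omega
        · exact hbig _ w (by have := j.2; omega)
      have h1 := hR5 (B (m + 1)) j E hE0 fun w hw _ => hall w hw
      have := norm_add_le_of_le h1 (hall (eps n j) (wt_eps n j).ge)
      rwa [sub_add_cancel] at this

end OperatorData

end

/-! ### Independence of the basis in cohomology -/

section

variable {K : Type*} [NormedField K] {p n : ℕ} {γt tb : K} {σ : K ≃+* K} {C : ℝ}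
  {a b ζ : ℤ × ℤ → K}

theorem exists_wtBound_of_finite (n : ℕ) (hγ : 0 < ‖γt‖) (k : ℕ) {η : ℤ × ℤ → K}
    (hη : {u | η u ≠ 0}.Finite) : ∃ C, WtBound n γt k C η := by
  refine ⟨∑ u ∈ hη.toFinset, ‖η u‖ / ‖γt‖ ^ (k * wt n u), fun u => ?_⟩
  by_cases hu : η u = 0
  · rw [hu, norm_zero]
    positivity
  · rw [← div_le_iff₀ (by positivity)]
    exact Finset.single_le_sum (f := fun u => ‖η u‖ / ‖γt‖ ^ (k * wt n u))
      (fun w _ => by positivity) (by simpa using hu)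

theorem exists_wtBound_basisSum (hγ : 0 < ‖γt‖) (k : ℕ) (v : Fin (2 * n + 1) → K) :
    ∃ C, WtBound n γt k C (basisSum n v) := by
  refine exists_wtBound_of_finite n hγ k
    ((Set.finite_range fun j : Fin (2 * n + 1) => eps n j).subset fun u hu => ?_)
  by_contra h
  exact hu (basisSum_apply_of_ne v fun j hj => h ⟨j, hj.symm⟩)

theorem zpow_nwt (γt : K) (u : ℤ × ℤ) : γt ^ nwt n u = γt ^ wt n u := by
  rw [← coe_wt, zpow_natCast]

theorem wtBound_of_mem_C0 (hζ : ζ ∈ C0 n γt) : WtBound n γt 1 1 ζ := by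
  obtain ⟨ξ, h1, -, h3⟩ := hζ
  intro u
  rw [h3, zpow_nwt, norm_mul, norm_pow, one_mul (wt n u)]
  exact mul_le_mul_of_nonneg_right (h1 u) (by positivity)

theorem mem_C0_of_wtBound (hn : 1 ≤ n) (h0 : 0 < ‖γt‖) (h1 : ‖γt‖ < 1)
    (hζ : WtBound n γt 2 1 ζ) : ζ ∈ C0 n γt := by
  have hγ : γt ≠ 0 := norm_pos_iff.1 h0
  have hle : ∀ u, ‖ζ u / γt ^ wt n u‖ ≤ ‖γt‖ ^ wt n u := by
    intro u
    rw [norm_div, norm_pow, div_le_iff₀ (by positivity), ← pow_add, ← two_mul]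
    simpa using hζ u
  refine ⟨fun u => ζ u / γt ^ wt n u, fun u => (hle u).trans (pow_le_one₀ h0.le h1.le),
    squeeze_zero_norm hle (tendsto_pow_wt hn h0.le h1), fun u => ?_⟩
  rw [zpow_nwt, div_mul_cancel₀ _ (pow_ne_zero _ hγ)]

/-- Only finitely many normalised coefficients have norm at least ε. The part kept has finite
support, hence every rate of decay; in particular the rate 2 needed for contraction. -/
theorem exists_truncation (hγ : 0 < ‖γt‖) (hζ : ζ ∈ C0 n γt) {ε : ℝ} (hε : 0 < ε) :
    ∃ a, (∃ C, WtBound n γt 2 C a) ∧ WtBound n γt 1 ε (ζ - a) := by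
  classical
  obtain ⟨ξ, h1, h2, h3⟩ := hζ
  have hfin : {u | ¬ ‖ξ u‖ < ε}.Finite := by
    have := h2.eventually (Metric.ball_mem_nhds (0 : K) hε)
    rw [eventually_cofinite] at this
    simpa using this
  refine ⟨fun u => if ‖ξ u‖ < ε then 0 else ζ u, ?_, fun u => ?_⟩
  · refine exists_wtBound_of_finite n hγ 2 (hfin.subset fun u hu => ?_)
    intro hlt
    exact hu (if_pos hlt)
  · rw [Pi.sub_apply, one_mul]
    split_ifs with h
    · rw [sub_zero, h3, zpow_nwt, norm_mul, norm_pow]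
      exact mul_le_mul_of_nonneg_right h.le (by positivity)
    · rw [sub_self, norm_zero]
      positivity

theorem sum_smul_mono (v : Fin (2 * n + 1) → K) :
    ∑ j : Fin (2 * n + 1), v j • mono n γt (eps n j)
      = basisSum n fun j => v j * γt ^ (j : ℕ) := by
  refine Finset.sum_congr rfl fun j _ => ?_
  funext u
  by_cases hu : u = eps n j
  · subst hu
    simp [mono, zpow_nwt, wt_eps]
  · simp [mono, hu]

variable [IsUltrametricDist K]

theorem sub_mem_C0 {ζ ζ' : ℤ × ℤ → K} (hζ : ζ ∈ C0 n γt) (hζ' : ζ' ∈ C0 n γt) :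
    ζ - ζ' ∈ C0 n γt := by
  obtain ⟨ξ, h1, h2, h3⟩ := hζ
  obtain ⟨ξ', h1', h2', h3'⟩ := hζ'
  refine ⟨ξ - ξ', fun u => norm_sub_le_of_le (h1 u) (h1' u), ?_, fun u => ?_⟩
  · have := h2.sub h2'
    rwa [sub_zero] at this
  · rw [Pi.sub_apply, Pi.sub_apply, h3, h3', sub_mul]

variable [CompleteSpace K]

namespace OperatorData

/-- The tails of a and b reduce, modulo the leading parts, to a basis combination with smaller
cofactors `hx`, `hy`. By independence modulo the leading parts, (a − hx, b − hy) is a cycle of their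
Koszul complex, so it comes from some c. Only small terms are left after correcting (a, b) by the
boundary of c for the full operators. -/
theorem exists_smaller_preimage (h : OperatorData p n γt tb σ)
    (ha : WtBound n γt 2 C a) (hb : WtBound n γt 2 C b)
    {v : Fin (2 * n + 1) → K} (heq : basisSum n v = Dx p n γt tb σ a + Dy p n γt tb σ b) :
    ∃ a' b', WtBound n γt 2 (C * ‖γt‖ ^ n) a' ∧ WtBound n γt 2 (C * ‖γt‖ ^ n) b' ∧
      basisSum n v = Dx p n γt tb σ a' + Dy p n γt tb σ b' := by
  have hπ := h.norm_pos
  have hπ1 := h.norm_lt_one.le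
  have hC := ha.nonneg hπ
  have hdx := isUnitDirection_x h.toLeadingData
  have hdy := isUnitDirection_y (K := K) (n := n)
  have hdiv : C / ‖γt‖ ^ n * ‖γt‖ ^ n = C := div_mul_cancel₀ _ (by positivity)
  have htail : ∀ (η : ℤ × ℤ → K) (c : ℤ × ℤ → ℤ) (m : K) (d : ℤ × ℤ), IsUnitDirection n m d →
      WtBound n γt 2 C η → WtBound n γt 2 C (tailOp p n γt tb σ c m d η) := by
    intro η c m d hd hη
    have := h.tailOp_wtBound_two (c := c) (C := C / ‖γt‖ ^ n) hd (by positivity)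
      (by rwa [hdiv])
    rwa [hdiv] at this
  set ν : ℤ × ℤ → K := -(tailOp p n γt tb σ Prod.fst n (n, 0) a
    + tailOp p n γt tb σ Prod.snd 1 (0, 1) b) with hν
  have hν2 : WtBound n γt 2 C ν := ((htail a _ _ _ hdx ha).add (htail b _ _ _ hdy hb)).neg
  obtain ⟨v', hx, hy, heq', hbd, -⟩ := exists_leading_reduction h.toLeadingData hν2
  have hbd1 := hbd 1 C hν2
  rw [one_mul] at hbd1
  have hle : C * ‖γt‖ ^ n ≤ C := mul_le_of_le_one_right hC (pow_le_one₀ hπ.le hπ1)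
  have hnorm : ∀ {η : ℤ × ℤ → K}, WtBound n γt 2 C η → ∀ u, ‖η u‖ ≤ C :=
    fun hη => hη.norm_le hπ1 hC
  have hlead : leadX n (γt ^ n) tb a + leadY (γt ^ n) tb b = basisSum n v + ν := by
    rw [heq, h.Dx_eq_lead_add_tail (hnorm ha), h.Dy_eq_lead_add_tail (hnorm hb), hν]
    abel
  have ha2 : WtBound n γt 2 C (a - hx) := ha.sub (hbd1.1.mono hle)
  have hb2 : WtBound n γt 2 C (b - hy) := hb.sub (hbd1.2.mono hle)
  have hsub : basisSum n (v + v')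
      = leadX n (γt ^ n) tb (a - hx) + leadY (γt ^ n) tb (b - hy) := by
    rw [leadX_sub, leadY_sub, basisSum_add]
    have e1 : basisSum n v = leadX n (γt ^ n) tb a + leadY (γt ^ n) tb b - ν := by
      rw [hlead]; abel
    have e2 : basisSum n v' = ν - leadX n (γt ^ n) tb hx - leadY (γt ^ n) tb hy := by
      conv_rhs => rw [heq']
      abel
    rw [e1, e2]
    abel
  have hv0 := eq_zero_of_basisSum_eq_lead h.toLeadingData ha2 hb2 hsub
  have hker : leadX n (γt ^ n) tb (a - hx) + leadY (γt ^ n) tb (b - hy) = 0 := by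
    rw [← hsub, hv0]
    simp [basisSum]
  obtain ⟨c, hc, hca, hcb⟩ := exists_of_lead_eq_zero h.toLeadingData ha2 hb2 hker
  have hc1 := hnorm (hc.mono hle)
  have hcx : ∀ u, ‖Dx p n γt tb σ c u‖ ≤ C := fun u => by
    rw [Dx_eq_diffOp]; exact h.norm_diffOp_le h.norm_natCast.le hc1 u
  have hcy : ∀ u, ‖Dy p n γt tb σ c u‖ ≤ C := fun u => by
    rw [Dy_eq_diffOp]; exact h.norm_diffOp_le norm_one.le hc1 u
  -- Subtracting (D_y c, −D_x c) leaves the sum unchanged because D_x and D_y commute, and cancels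
  -- the cycle up to the tails of c.
  refine ⟨a - Dy p n γt tb σ c, b + Dx p n γt tb σ c, ?_, ?_, ?_⟩
  · have : a - Dy p n γt tb σ c = hx - tailOp p n γt tb σ Prod.snd 1 (0, 1) c := by
      rw [h.Dy_eq_lead_add_tail hc1, ← hca]
      abel
    rw [this]
    exact hbd1.1.sub (h.tailOp_wtBound_two hdy hC hc)
  · have : b + Dx p n γt tb σ c = hy + tailOp p n γt tb σ Prod.fst n (n, 0) c := by
      rw [h.Dx_eq_lead_add_tail hc1, ← neg_neg (leadX n (γt ^ n) tb c), ← hcb]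
      abel
    rw [this]
    exact hbd1.2.add (h.tailOp_wtBound_two hdx hC hc)
  · have e1 : Dx p n γt tb σ (a - Dy p n γt tb σ c)
        = Dx p n γt tb σ a - Dx p n γt tb σ (Dy p n γt tb σ c) := by
      rw [Dx_eq_diffOp]
      exact h.diffOp_sub h.norm_natCast.le (hnorm ha) hcy
    have e2 : Dy p n γt tb σ (b + Dx p n γt tb σ c)
        = Dy p n γt tb σ b + Dy p n γt tb σ (Dx p n γt tb σ c) := by
      rw [Dy_eq_diffOp]
      exact h.diffOp_add norm_one.le (hnorm hb) hcx
    rw [e1, e2, h.Dx_Dy_comm hc1, heq]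
    abel

theorem eq_zero_of_basisSum_eq_of_wtBound (h : OperatorData p n γt tb σ)
    (ha : WtBound n γt 2 C a) (hb : WtBound n γt 2 C b)
    {v : Fin (2 * n + 1) → K} (heq : basisSum n v = Dx p n γt tb σ a + Dy p n γt tb σ b) :
    v = 0 := by
  have hπ := h.norm_pos
  have hC := ha.nonneg hπ
  have hr : ‖γt‖ ^ n < 1 := pow_lt_one₀ hπ.le h.norm_lt_one (by have := h.two_le; omega)
  have hiter : ∀ m : ℕ, ∃ a' b', WtBound n γt 2 (C * (‖γt‖ ^ n) ^ m) a' ∧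
      WtBound n γt 2 (C * (‖γt‖ ^ n) ^ m) b' ∧
      basisSum n v = Dx p n γt tb σ a' + Dy p n γt tb σ b' := by
    intro m
    induction m with
    | zero => exact ⟨a, b, by simpa using ha, by simpa using hb, heq⟩
    | succ m ih =>
      obtain ⟨a', b', ha', hb', heq'⟩ := ih
      rw [pow_succ, ← mul_assoc]
      exact h.exists_smaller_preimage ha' hb' heq'
  funext j
  have hlim : Tendsto (fun m : ℕ => C * (‖γt‖ ^ n) ^ m) atTop (𝓝 0) := by
    have := (tendsto_pow_atTop_nhds_zero_of_lt_one (by positivity) hr).const_mul C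
    rwa [mul_zero] at this
  rw [Pi.zero_apply, ← norm_le_zero_iff]
  refine ge_of_tendsto hlim (Eventually.of_forall fun m => ?_)
  obtain ⟨a', b', ha', hb', heq'⟩ := hiter m
  have hCm : 0 ≤ C * (‖γt‖ ^ n) ^ m := by positivity
  rw [← basisSum_apply_eps v j, heq', Dx_eq_diffOp, Dy_eq_diffOp]
  exact norm_add_le_of_le
    (h.norm_diffOp_le h.norm_natCast.le (ha'.norm_le h.norm_lt_one.le hCm) _)
    (h.norm_diffOp_le norm_one.le (hb'.norm_le h.norm_lt_one.le hCm) _)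

/-- The basis monomials are linearly independent modulo `D_x C₀ + D_y C₀`. -/
theorem eq_zero_of_basisSum_eq (h : OperatorData p n γt tb σ)
    {ζx ζy : ℤ × ℤ → K} (hx : ζx ∈ C0 n γt) (hy : ζy ∈ C0 n γt)
    {v : Fin (2 * n + 1) → K} (heq : basisSum n v = Dx p n γt tb σ ζx + Dy p n γt tb σ ζy) :
    v = 0 := by
  have hπ := h.norm_pos
  have hπ1 := h.norm_lt_one.le
  have h3 := h.three_le
  have hdx := isUnitDirection_x h.toLeadingData
  have hdy := isUnitDirection_y (K := K) (n := n)
  funext j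
  rw [Pi.zero_apply, ← norm_le_zero_iff]
  refine le_of_forall_pos_le_add fun ε hε => ?_
  rw [zero_add]
  -- Members of C₀ decay only at rate 1. After truncation the error δ has rate 1 with constant ε and
  -- also rate 2 with an uncontrolled constant. The latter allows δ to be reduced to some v' and
  -- yields v = v'; the former gives ‖v' j‖ ≤ ε.
  obtain ⟨a, ⟨Ca, ha⟩, hae⟩ := exists_truncation hπ hx hε
  obtain ⟨b, ⟨Cb, hb⟩, hbe⟩ := exists_truncation hπ hy hε
  obtain ⟨Cv, hv⟩ := exists_wtBound_basisSum (γt := γt) hπ 2 v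
  have hCa := ha.nonneg hπ
  have hCb := hb.nonneg hπ
  have hCv := hv.nonneg hπ
  set δ : ℤ × ℤ → K := Dx p n γt tb σ (ζx - a) + Dy p n γt tb σ (ζy - b) with hδ
  have hδ1 : WtBound n γt 1 ε δ := by
    rw [hδ, Dx_eq_diffOp, Dy_eq_diffOp]
    exact (h.diffOp_wtBound (k := 0) hdx (by omega) hε.le (by simpa using hae)).add
      (h.diffOp_wtBound (k := 0) hdy (by omega) hε.le (by simpa using hbe))
  have hdiff : δ = basisSum n v - Dx p n γt tb σ a - Dy p n γt tb σ b := by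
    have e1 := h.diffOp_sub (c := Prod.fst) (d := (n, 0)) (C := max 1 Ca) h.norm_natCast.le
      (fun u => ((wtBound_of_mem_C0 hx).norm_le hπ1 zero_le_one u).trans (le_max_left _ _))
      (fun u => (ha.norm_le hπ1 hCa u).trans (le_max_right _ _))
    have e2 := h.diffOp_sub (c := Prod.snd) (d := (0, 1)) (C := max 1 Cb) norm_one.le
      (fun u => ((wtBound_of_mem_C0 hy).norm_le hπ1 zero_le_one u).trans (le_max_left _ _))
      (fun u => (hb.norm_le hπ1 hCb u).trans (le_max_right _ _))
    rw [heq, hδ, Dx_eq_diffOp, Dy_eq_diffOp, e1, e2]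
    abel
  have hbound : ∀ (η : ℤ × ℤ → K) (c : ℤ × ℤ → ℤ) (m : K) (d : ℤ × ℤ) (C : ℝ),
      IsUnitDirection n m d → 0 ≤ C → WtBound n γt 2 C η →
      WtBound n γt 2 (C / ‖γt‖ ^ n) (diffOp p n γt tb σ c m d η) := by
    intro η c m d C hd hC hη
    refine h.diffOp_wtBound (k := 1) hd (by omega) (by positivity) ?_
    rwa [one_mul, div_mul_cancel₀ _ (by positivity)]
  obtain ⟨C, hδ2⟩ : ∃ C, WtBound n γt 2 C δ := by
    refine ⟨max (max Cv (Ca / ‖γt‖ ^ n)) (Cb / ‖γt‖ ^ n), ?_⟩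
    rw [hdiff, Dx_eq_diffOp, Dy_eq_diffOp]
    refine ((hv.mono ?_).sub ((hbound a _ _ _ Ca hdx hCa ha).mono ?_)).sub
      ((hbound b _ _ _ Cb hdy hCb hb).mono ?_)
    · exact (le_max_left _ _).trans (le_max_left _ _)
    · exact (le_max_right _ _).trans (le_max_left _ _)
    · exact le_max_right _ _
  obtain ⟨v', zx, zy, heq', hzx, hzy, hv', -⟩ := h.exists_reduction hδ2
  have hCδ := hδ2.nonneg hπ
  set M : ℝ := max (max Ca Cb) C with hM
  have hCaM : Ca ≤ M := (le_max_left _ _).trans (le_max_left _ _)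
  have hCbM : Cb ≤ M := (le_max_right _ _).trans (le_max_left _ _)
  have hCM : C ≤ M := le_max_right _ _
  have hM0 : 0 ≤ M := hCa.trans hCaM
  have hfin : basisSum n (v - v') = Dx p n γt tb σ (a + zx) + Dy p n γt tb σ (b + zy) := by
    have e1 := h.diffOp_add (c := Prod.fst) (d := (n, 0)) h.norm_natCast.le
      ((ha.mono hCaM).norm_le hπ1 hM0) ((hzx.mono hCM).norm_le hπ1 hM0)
    have e2 := h.diffOp_add (c := Prod.snd) (d := (0, 1)) norm_one.le
      ((hb.mono hCbM).norm_le hπ1 hM0) ((hzy.mono hCM).norm_le hπ1 hM0)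
    rw [basisSum_sub]
    have e3 : basisSum n v' = δ - Dx p n γt tb σ zx - Dy p n γt tb σ zy := by
      conv_rhs => rw [heq']
      abel
    rw [e3, hdiff, Dx_eq_diffOp, Dy_eq_diffOp, e1, e2]
    abel
  have hvv := h.eq_zero_of_basisSum_eq_of_wtBound ((ha.mono hCaM).add (hzx.mono hCM))
    ((hb.mono hCbM).add (hzy.mono hCM)) hfin
  rw [sub_eq_zero] at hvv
  rw [hvv]
  refine (hv' 0 ε (by omega) (by simpa using hδ1) j).trans ?_
  exact mul_le_of_le_one_right hε.le (pow_le_one₀ hπ.le hπ1)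

theorem isFrobeniusMatrix_unique (h : OperatorData p n γt tb σ)
    {A A' : Matrix (Fin (2 * n + 1)) (Fin (2 * n + 1)) K}
    (hA : IsFrobeniusMatrix p n γt tb σ A) (hA' : IsFrobeniusMatrix p n γt tb σ A') :
    A' = A := by
  have hπ1 := h.norm_lt_one.le
  ext j i
  obtain ⟨zx, hzx, zy, hzy, e⟩ := hA.2 i
  obtain ⟨zx', hzx', zy', hzy', e'⟩ := hA'.2 i
  rw [sum_smul_mono] at e e'
  have hnorm : ∀ {ζ : ℤ × ℤ → K}, ζ ∈ C0 n γt → ∀ u, ‖ζ u‖ ≤ 1 := fun hζ =>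
    (wtBound_of_mem_C0 hζ).norm_le hπ1 zero_le_one
  have heq : basisSum n ((fun j => A' j i * γt ^ (j : ℕ)) - fun j => A j i * γt ^ (j : ℕ))
      = Dx p n γt tb σ (zx - zx') + Dy p n γt tb σ (zy - zy') := by
    have e1 := h.diffOp_sub (c := Prod.fst) (d := (n, 0)) h.norm_natCast.le (hnorm hzx) (hnorm hzx')
    have e2 := h.diffOp_sub (c := Prod.snd) (d := (0, 1)) norm_one.le (hnorm hzy) (hnorm hzy')
    rw [Dx_eq_diffOp, Dy_eq_diffOp, e1, e2, ← Dx_eq_diffOp, ← Dy_eq_diffOp, basisSum_sub]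
    rw [← sub_eq_zero] at e e' ⊢
    have := congrArg₂ (· - ·) e e'
    simp only [sub_zero] at this
    rw [← this]
    abel
  have h0 := congrFun (h.eq_zero_of_basisSum_eq (sub_mem_C0 hzx hzx') (sub_mem_C0 hzy hzy') heq) j
  simp only [Pi.sub_apply, Pi.zero_apply, ← sub_mul] at h0
  rcases mul_eq_zero.1 h0 with h1 | h1
  · exact sub_eq_zero.1 h1
  · exact absurd h1 (pow_ne_zero _ h.gt_ne_zero)

end OperatorData

end

/-! ### Combinatorics of the Frobenius matrix -/

/-- Subadditivity of the weight for p w = ε_i + k(−1,−1) + l(n,0) + m(0,1), where the last three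
vectors have weight n. -/
theorem p_mul_wt_le {p n i : ℕ} {w : ℤ × ℤ} {k l m : ℕ}
    (h1 : (n : ℤ) * l - k = p * w.1 - (eps n i).1) (h2 : (m : ℤ) - k = p * w.2 - (eps n i).2) :
    p * wt n w ≤ i + n * (k + l + m) := by
  have e0 := eps_fst_add n i
  have e1 := eps_fst_nonneg n i
  have e2 := eps_snd_nonneg n i
  have h3 : (0 : ℤ) ≤ n * (eps n i).1 := by positivity
  have h4 : (0 : ℤ) ≤ n * (eps n i).2 := by positivity
  have h5 : (0 : ℤ) ≤ n * k := by positivity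
  have h6 : (0 : ℤ) ≤ n * l := by positivity
  have h7 : (0 : ℤ) ≤ n * m := by positivity
  have h8 : (0 : ℤ) ≤ n * (n * l) := by positivity
  zify
  rcases wt_cases n w with ⟨h, -, -⟩ | ⟨h, -, -⟩ | ⟨h, -, -⟩ <;> rw [h]
  · have : (p : ℤ) * (w.1 + n * w.2) = i + n * l + n * m - (n + 1) * k := by
      linear_combination e0 - h1 - n * h2
    linarith
  · have : (p : ℤ) * (n * w.2 - 2 * n * w.1) = i - (2 * n + 1) * (eps n i).1 + n * m + n * k
        - 2 * n * (n * l) := by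
      linear_combination e0 - n * h2 + 2 * n * h1
    linarith
  · have : (p : ℤ) * (w.1 - (n + 1) * w.2) = i - (2 * n + 1) * (eps n i).2 + n * l + n * k
        - (n + 1) * m := by
      linear_combination e0 - h1 + (n + 1) * h2
    linarith

theorem eps_fst_eq_zero {n i : ℕ} (hi : (eps n i).1 = 0) : i = 0 := by
  unfold eps at hi
  split_ifs at hi with h <;> simp at hi <;> omega

theorem eps_fst_le {n i : ℕ} (hi : i ≤ 2 * n) : (eps n i).1 ≤ n := by
  unfold eps
  split_ifs with h
  · simpa using h
  · simp; omega

theorem eps_snd_le_one (n i : ℕ) : (eps n i).2 ≤ 1 := by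
  unfold eps
  split_ifs <;> simp

/-- Turns the ceilings in `g` and `alphaCoef` into remainders modulo n. -/
theorem mul_ceil_neg_div (n : ℕ) (a : ℤ) :
    (n : ℤ) * ⌈(-(a : ℚ)) / (n : ℚ)⌉ = a % n - a := by
  rw [neg_div, Int.ceil_neg, Rat.floor_intCast_div_natCast]
  have := Int.emod_add_mul_ediv a n
  linarith

/-- The value `g(i)`, described by the exponents of `ε_i` and `ε_{g(i)}`. -/
theorem exists_g_eq {p n i : ℕ} (hn : 2 ≤ n) (hpn : Nat.Coprime p n) (hi : i ≤ 2 * n) :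
    ∃ G : ℕ, G ≤ 2 * n ∧ (G : ℤ) = g p n i ∧ (eps n G).2 = (eps n i).2 ∧
      (n : ℤ) ∣ p * (eps n G).1 - (eps n i).1 ∧ ((eps n i).1 = 0 → (eps n G).1 = 0) ∧
      (0 < (eps n i).1 → 0 < (eps n G).1) := by
  obtain ⟨-, -, hϖ⟩ := varpi_spec hn hpn
  set ϖ := varpi p n with hϖdef
  have hn0 : (0 : ℤ) < n := by exact_mod_cast (by omega : 0 < n)
  have hmod : (n : ℤ) ∣ p * ϖ - 1 := by
    have := (Nat.modEq_iff_dvd.1 hϖ.symm)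
    push_cast at this
    exact this
  -- the generic case
  have key : ∀ r : ℤ, ¬ (n : ℤ) ∣ r →
      0 < (ϖ * r) % (n : ℤ) ∧ (ϖ * r) % (n : ℤ) < n ∧ (n : ℤ) ∣ p * ((ϖ * r) % n) - r := by
    intro r hr
    have hd : (n : ℤ) ∣ p * ((ϖ * r) % n) - r := by
      have h1 : (n : ℤ) ∣ ϖ * r - (ϖ * r) % n := Int.dvd_self_sub_emod
      have : (p : ℤ) * ((ϖ * r) % n) - r = (p * ϖ - 1) * r - p * (ϖ * r - (ϖ * r) % n) := by ring
      rw [this]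
      exact dvd_sub (hmod.mul_right _) (h1.mul_left _)
    refine ⟨lt_of_le_of_ne (Int.emod_nonneg _ hn0.ne') fun h0 => hr ?_,
      Int.emod_lt_of_pos _ hn0, hd⟩
    rw [← h0, mul_zero, zero_sub] at hd
    exact (dvd_neg).1 hd
  by_cases hspec : i = 0 ∨ i = n ∨ i = 2 * n
  · refine ⟨i, hi, ?_, rfl, ?_, id, id⟩
    · rw [g, if_pos hspec]
    · rcases hspec with rfl | rfl | rfl
      · simp [eps]
      · simp only [eps, le_refl, if_true]
        exact dvd_sub (dvd_mul_left _ _) dvd_rfl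
      · rw [eps, if_neg (by omega)]
        push_cast
        rw [show (2 * (n : ℤ) - n) = n by ring]
        exact dvd_sub (dvd_mul_left _ _) dvd_rfl
  · by_cases hlt : i < n
    · have hr : ¬ (n : ℤ) ∣ i := by
        intro hd
        have := Nat.le_of_dvd (by omega) (Int.natCast_dvd_natCast.1 hd)
        omega
      obtain ⟨h1, h2, h3⟩ := key i hr
      obtain ⟨G, hG⟩ := Int.eq_ofNat_of_zero_le h1.le
      have hGn : G < n := by rw [hG] at h2; exact_mod_cast h2
      have eG : eps n G = ((G : ℤ), 0) := by rw [eps, if_pos hGn.le]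
      have ei : eps n i = ((i : ℤ), 0) := by rw [eps, if_pos hlt.le]
      refine ⟨G, by omega, ?_, ?_, ?_, ?_, ?_⟩
      · rw [g, if_neg hspec, if_pos hlt, ← hϖdef]
        have := mul_ceil_neg_div n (ϖ * i)
        push_cast at this
        rw [this, ← hG]
        ring
      · rw [eG, ei]
      · rw [eG, ei, ← Int.ofNat_eq_natCast, ← hG]
        exact h3
      · rw [ei]
        intro h0
        simp only at h0
        omega
      · rw [eG]
        intro _
        rw [hG] at h1
        exact h1
    · have hr : ¬ (n : ℤ) ∣ i := by
        rintro ⟨c, hc⟩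
        have h1 : (1 : ℤ) < c := by nlinarith [(by omega : (n : ℤ) < i)]
        have h2 : c < 2 := by nlinarith [(by omega : (i : ℤ) < 2 * n)]
        omega
      obtain ⟨h1, h2, h3⟩ := key i hr
      obtain ⟨G, hG⟩ := Int.eq_ofNat_of_zero_le h1.le
      have hGn : G < n := by rw [hG] at h2; exact_mod_cast h2
      have hG0 : 0 < G := by rw [hG] at h1; exact_mod_cast h1
      have eG : eps n (n + G) = ((G : ℤ), 1) := by
        rw [eps, if_neg (by omega)]
        push_cast
        simp
      have ei : eps n i = ((i : ℤ) - n, 1) := by rw [eps, if_neg (by omega)]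
      refine ⟨n + G, by omega, ?_, ?_, ?_, ?_, ?_⟩
      · rw [g, if_neg hspec, if_neg hlt, ← hϖdef]
        have := mul_ceil_neg_div n (ϖ * i)
        push_cast at this
        rw [this]
        push_cast
        rw [show (G : ℤ) = (ϖ * i) % n from hG.symm]
        ring
      · rw [eG, ei]
      · rw [eG, ei, show ((G : ℤ), (1 : ℤ)).1 = (ϖ * i) % n from hG.symm]
        rw [show (p : ℤ) * ((ϖ * i) % n) - ((i : ℤ) - n, (1 : ℤ)).1
          = (p * ((ϖ * i) % n) - i) + n by simp only; ring]
        exact dvd_add h3 dvd_rfl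
      · rw [ei]
        intro h0
        simp only at h0
        omega
      · rw [eG]
        intro _
        simp only
        exact_mod_cast hG0

theorem le_of_dvd_sub {n x y : ℤ} (h : n ∣ x - y) (hx : 0 < x) (hy : y ≤ n) : y ≤ x := by
  obtain ⟨c, hc⟩ := h
  by_contra hlt
  have hn : 0 < n := by omega
  have h1 : c < 0 := by nlinarith
  nlinarith

/-- Only the monomial `ε_{g(i)}` has minimal order among those of weight at most `g(i)`. -/
theorem eq_eps_of_p_mul_wt_eq {p n i G : ℕ} (hn : 2 ≤ n) (hpn : n < p) (hcop : Nat.Coprime p n)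
    (hG : G ≤ 2 * n) (hG2 : (eps n G).2 = (eps n i).2)
    (hGd : (n : ℤ) ∣ p * (eps n G).1 - (eps n i).1) (hG0 : (eps n i).1 = 0 → (eps n G).1 = 0)
    {w : ℤ × ℤ} {k l m : ℕ} (h1 : (n : ℤ) * l - k = p * w.1 - (eps n i).1)
    (h2 : (m : ℤ) - k = p * w.2 - (eps n i).2) (heq : p * wt n w = i + n * (k + l + m))
    (hw : wt n w ≤ G) : w = eps n G := by
  have e0 := eps_fst_add n i
  have e1 := eps_fst_nonneg n i
  have e2 := eps_snd_nonneg n i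
  have E0 := eps_fst_add n G
  have E1 := eps_fst_le hG
  have hp0 : (0 : ℤ) < p := by exact_mod_cast (by omega : 0 < p)
  have hn0 : (0 : ℤ) < n := by exact_mod_cast (by omega : 0 < n)
  have hcop' : IsCoprime (n : ℤ) p := Nat.isCoprime_iff_coprime.2 hcop.symm
  have hw' : (wt n w : ℤ) ≤ G := by exact_mod_cast hw
  have heq' : (p : ℤ) * wt n w = i + n * (k + l + m) := by exact_mod_cast heq
  -- the case `i = 0`
  rcases e1.eq_or_lt with h0 | h0
  · have hi0 := eps_fst_eq_zero h0.symm
    have hGz := eps_fst_eq_zero (hG0 h0.symm)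
    subst hGz
    have hwz : wt n w = 0 := by omega
    obtain ⟨a1, a2⟩ := abs_le_wt (n := n) (by omega) w
    rw [hwz] at a1 a2
    simp only [Nat.cast_zero, abs_nonpos_iff] at a1 a2
    exact Prod.ext (by rw [a1]; simp [eps]) (by rw [a2]; simp [eps])
  -- a positive `q` with `p q = e + n l` is at least the first exponent of `ε_g`
  have hq : ∀ q : ℤ, p * q = (eps n i).1 + n * l → 0 < q ∧ (eps n G).1 ≤ q := by
    intro q hq
    have hl : (0 : ℤ) ≤ n * l := by positivity
    have hq0 : 0 < q := by
      by_contra hc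
      have : (p : ℤ) * q ≤ 0 := mul_nonpos_of_nonneg_of_nonpos hp0.le (by omega)
      linarith
    refine ⟨hq0, le_of_dvd_sub (n := n) ?_ hq0 E1⟩
    refine hcop'.dvd_of_dvd_mul_left ?_
    have : (p : ℤ) * (q - (eps n G).1)
        = n * l - (p * (eps n G).1 - (eps n i).1) := by rw [mul_sub, hq]; ring
    rw [this]
    exact dvd_sub (dvd_mul_right _ _) hGd
  have hk0 : (0 : ℤ) ≤ k := by positivity
  have hl0 : (0 : ℤ) ≤ l := by positivity
  have hm0 : (0 : ℤ) ≤ m := by positivity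
  -- Equality in the subadditivity forces every summand into the cone of w. In the first cone k = 0.
  -- The second is excluded because ε_i has positive first exponent. In the third m = 0 and ε_i lies
  -- on the x-axis.
  rcases wt_cases n w with ⟨h, -, -⟩ | ⟨h, -, -⟩ | ⟨h, -, -⟩ <;> rw [h] at heq' hw'
  · have hk : (2 * (n : ℤ) + 1) * k = 0 := by
      linear_combination -heq' - h1 - n * h2 + e0
    have hk : (k : ℤ) = 0 := by
      rcases mul_eq_zero.1 hk with h | h
      · omega
      · exact h
    rw [hk] at h1 h2
    obtain ⟨-, hq2⟩ := hq w.1 (by linarith)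
    have hw2 : (eps n i).2 ≤ w.2 := by
      by_contra hc
      have h3 := eps_snd_le_one n i
      have h4 : (p : ℤ) * w.2 = (eps n i).2 + m := by linarith
      rcases (show (eps n i).2 = 0 ∨ (eps n i).2 = 1 by omega) with h5 | h5
      · have : (p : ℤ) * w.2 < 0 := mul_neg_of_pos_of_neg hp0 (by omega)
        omega
      · have : (p : ℤ) * w.2 ≤ 0 := mul_nonpos_of_nonneg_of_nonpos hp0.le (by omega)
        omega
    have h5 : w.2 = (eps n G).2 := by
      rw [hG2]
      refine le_antisymm ?_ hw2
      by_contra hc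
      have : (n : ℤ) * ((eps n i).2 + 1) ≤ n * w.2 := mul_le_mul_of_nonneg_left (by omega) hn0.le
      rw [← E0, hG2] at hw'
      linarith
    have h6 : w.1 = (eps n G).1 := by
      rw [← E0, ← h5] at hw'
      omega
    exact Prod.ext h6 h5
  · exfalso
    have : (2 * (n : ℤ) + 1) * (eps n i).1 + (2 * n + 1) * (n * l) = 0 := by
      linear_combination -heq' + 2 * n * h1 - n * h2 + e0
    have h5 : (0 : ℤ) < (2 * n + 1) * (eps n i).1 := by positivity
    have h6 : (0 : ℤ) ≤ (2 * n + 1) * (n * l) := by positivity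
    linarith
  · have h3 : (2 * (n : ℤ) + 1) * ((eps n i).2 + m) = 0 := by
      linear_combination -heq' - h1 + (n + 1) * h2 + e0
    have h4 : (eps n i).2 + m = 0 := by
      rcases mul_eq_zero.1 h3 with h | h
      · omega
      · exact h
    have h5 : (eps n i).2 = 0 := by omega
    have h6 : (m : ℤ) = 0 := by omega
    rw [h5, h6] at h2
    obtain ⟨-, hq2⟩ := hq (w.1 - w.2) (by linarith)
    have hw2 : w.2 ≤ 0 := by
      by_contra hc
      have : 0 < (p : ℤ) * w.2 := mul_pos hp0 (by omega)
      linarith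
    rw [← E0, hG2, h5, mul_zero, add_zero] at hw'
    have h7 : w.2 = 0 := by
      refine le_antisymm hw2 ?_
      by_contra hc
      have : (n : ℤ) * w.2 ≤ n * (-1) := mul_le_mul_of_nonneg_left (by omega) hn0.le
      linarith
    rw [h7] at hq2 hw'
    exact Prod.ext (by omega) (by rw [h7, hG2, h5])

/-- Off the nonnegative x-axis all weights are at least n. Hence for j < n no other monomial of
weight j disturbs the entry at ε_j. -/
theorem eq_eps_of_wt_lt {n j : ℕ} {w : ℤ × ℤ} (hw : wt n w = j) (hj : j < n) : w = eps n j := by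
  have hn0 : (0 : ℤ) < n := by omega
  have hj' : (j : ℤ) < n := by omega
  rw [eps, if_pos hj.le]
  rcases wt_cases n w with ⟨h, g1, g2⟩ | ⟨h, g1, g2⟩ | ⟨h, g1, g2⟩ <;> rw [hw] at h
  · have h0 : w.2 = 0 := by
      refine le_antisymm ?_ g2
      by_contra hc
      nlinarith
    rw [h0] at h
    exact Prod.ext (by simp only; linarith) h0
  · have h0 : w.2 - 2 * w.1 = 0 := by
      refine le_antisymm ?_ (by linarith)
      by_contra hc
      nlinarith
    have h1 : w.1 = 0 := by omega
    have h2 : w.2 = 0 := by omega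
    rw [h1, h2] at h
    exact Prod.ext (by simp only; linarith) h2
  · have h0 : w.2 = 0 := by
      refine le_antisymm g1 ?_
      by_contra hc
      nlinarith
    rw [h0] at h
    exact Prod.ext (by simp only; linarith) h0

/-- In this form α is visibly the least k ≥ 0 with n ∣ p j − i + k. -/
theorem alphaCoef_eq (p n : ℕ) (i j : ℤ) :
    alphaCoef p n i j = (i - p * j) % n := by
  have := mul_ceil_neg_div n (i - p * j)
  have e : -((i - p * j : ℤ) : ℚ) = ((p * j - i : ℤ) : ℚ) := by push_cast; ring
  rw [e] at this
  rw [alphaCoef, this]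
  ring

/-! ### The Frobenius matrix -/

section

variable {K : Type*} [NormedField K]

theorem norm_eq_of_norm_sub_lt [IsUltrametricDist K] {x y : K} (h : ‖x - y‖ < ‖y‖) : ‖x‖ = ‖y‖ := by
  have h1 := IsUltrametricDist.norm_add_eq_max_of_norm_ne_norm h.ne
  rwa [sub_add_cancel, max_eq_right h.le] at h1

/-- The norm estimates on which the computation of the Frobenius matrix rests. -/
structure FrobeniusData (p n : ℕ) (γt tb : K) (σ : K ≃+* K) : Prop
    extends OperatorData p n γt tb σ where
  coprime : Nat.Coprime p n
  norm_theta : ∀ k, ‖thetaCoeff p (γt ^ n) k‖ ≤ ‖γt‖ ^ (n * k)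
  norm_theta_eq : ∀ k < p, ‖thetaCoeff p (γt ^ n) k‖ = ‖γt‖ ^ (n * k)
  norm_symm : ∀ x, ‖σ.symm x‖ = ‖x‖

namespace FrobeniusData

variable {p n : ℕ} {γt tb : K} {σ : K ≃+* K}

theorem norm_term_le (h : FrobeniusData p n γt tb σ) (k l m : ℕ) :
    ‖thetaCoeff p (γt ^ n) k * tb ^ k * thetaCoeff p (γt ^ n) l * thetaCoeff p (γt ^ n) m‖
      ≤ ‖γt‖ ^ (n * k) * (‖γt‖ ^ (n * l) * ‖γt‖ ^ (n * m)) := by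
  rw [norm_mul, norm_mul, norm_mul, norm_pow, h.norm_t, one_pow, mul_one, mul_assoc]
  have h1 := h.norm_theta k
  have h2 := h.norm_theta l
  have h3 := h.norm_theta m
  gcongr

theorem norm_Bcoeff_le [IsUltrametricDist K] (h : FrobeniusData p n γt tb σ) {u : ℤ × ℤ} {e : ℕ}
    (he : ∀ k l m : ℕ, (n : ℤ) * l - k = u.1 → (m : ℤ) - k = u.2 → e ≤ n * (k + l + m)) :
    ‖Bcoeff p n γt tb u‖ ≤ ‖γt‖ ^ e := by
  refine IsUltrametricDist.norm_tsum_le_of_forall_le_of_nonneg (by positivity) ?_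
  rintro ⟨k, l, m⟩
  split_ifs with hs
  · refine (h.norm_term_le k l m).trans ?_
    rw [← pow_add, ← pow_add]
    refine pow_le_pow_of_le_one (norm_nonneg _) h.norm_lt_one.le ?_
    have := he k l m hs.1 hs.2
    linarith
  · rw [norm_zero]
    positivity

theorem summable_Bcoeff [CompleteSpace K] (h : FrobeniusData p n γt tb σ) (u : ℤ × ℤ) :
    Summable fun s : ℕ × ℕ × ℕ =>
      if (n : ℤ) * s.2.1 - s.1 = u.1 ∧ (s.2.2 : ℤ) - s.1 = u.2 then
        thetaCoeff p (γt ^ n) s.1 * tb ^ s.1 * thetaCoeff p (γt ^ n) s.2.1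
          * thetaCoeff p (γt ^ n) s.2.2
      else 0 := by
  have h1 : Summable fun k : ℕ => ‖γt‖ ^ (n * k) := by
    simp only [pow_mul]
    refine summable_geometric_of_lt_one (by positivity)
      (pow_lt_one₀ (norm_nonneg _) h.norm_lt_one ?_)
    have := h.two_le
    omega
  have h0 : ∀ k : ℕ, 0 ≤ ‖γt‖ ^ (n * k) := fun k => by positivity
  have h2 : Summable fun s : ℕ × ℕ => ‖γt‖ ^ (n * s.1) * ‖γt‖ ^ (n * s.2) :=
    Summable.mul_of_nonneg (f := fun k : ℕ => ‖γt‖ ^ (n * k)) (g := fun k : ℕ => ‖γt‖ ^ (n * k))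
      h1 h1 h0 h0
  have h3 : Summable fun s : ℕ × ℕ × ℕ =>
      ‖γt‖ ^ (n * s.1) * (‖γt‖ ^ (n * s.2.1) * ‖γt‖ ^ (n * s.2.2)) :=
    Summable.mul_of_nonneg (f := fun k : ℕ => ‖γt‖ ^ (n * k))
      (g := fun s : ℕ × ℕ => ‖γt‖ ^ (n * s.1) * ‖γt‖ ^ (n * s.2)) h1 h2 h0
      fun s => mul_nonneg (h0 s.1) (h0 s.2)
  refine Summable.of_norm_bounded h3 ?_
  rintro ⟨k, l, m⟩
  split_ifs with hs
  · exact h.norm_term_le k l m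
  · rw [norm_zero]
    positivity

/-- For a fixed exponent, k determines l and m, and k + l + m grows with k. The solution with least
k strictly dominates, and its size is exact because its three indices are below p. -/
theorem norm_Bcoeff_eq [IsUltrametricDist K] [CompleteSpace K] (h : FrobeniusData p n γt tb σ)
    {u : ℤ × ℤ} {k l m : ℕ}
    (h1 : (n : ℤ) * l - k = u.1) (h2 : (m : ℤ) - k = u.2) (hk : k < p) (hl : l < p) (hm : m < p)
    (hmin : ∀ k' l' m' : ℕ, (n : ℤ) * l' - k' = u.1 → (m' : ℤ) - k' = u.2 → k ≤ k') :
    ‖Bcoeff p n γt tb u‖ = ‖γt‖ ^ (n * (k + l + m)) := by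
  have hn0 : (0 : ℤ) < n := by exact_mod_cast (by have := h.two_le; omega : 0 < n)
  have hlead : ‖thetaCoeff p (γt ^ n) k * tb ^ k * thetaCoeff p (γt ^ n) l
      * thetaCoeff p (γt ^ n) m‖ = ‖γt‖ ^ (n * (k + l + m)) := by
    rw [norm_mul, norm_mul, norm_mul, norm_pow, h.norm_t, one_pow, mul_one, h.norm_theta_eq k hk,
      h.norm_theta_eq l hl, h.norm_theta_eq m hm, ← pow_add, ← pow_add]
    ring_nf
  rw [← hlead]
  refine norm_eq_of_norm_sub_lt ?_
  rw [hlead, Bcoeff, (h.summable_Bcoeff u).tsum_eq_add_tsum_ite (k, l, m)]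
  simp only [h1, h2, and_self, if_true, add_sub_cancel_left]
  refine lt_of_le_of_lt (b := ‖γt‖ ^ (n * (k + l + m) + 1)) ?_
    (pow_lt_pow_right_of_lt_one₀ h.norm_pos h.norm_lt_one (Nat.lt_succ_self _))
  refine IsUltrametricDist.norm_tsum_le_of_forall_le_of_nonneg (by positivity) ?_
  rintro ⟨k', l', m'⟩
  split_ifs with hs ht
  · rw [norm_zero]
    positivity
  · simp only at ht
    refine (h.norm_term_le k' l' m').trans ?_
    rw [← pow_add, ← pow_add]
    refine pow_le_pow_of_le_one (norm_nonneg _) h.norm_lt_one.le ?_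
    have hkk := hmin k' l' m' ht.1 ht.2
    have hlt : k < k' := by
      refine lt_of_le_of_ne hkk fun hkk => hs ?_
      subst hkk
      have e1 : (n : ℤ) * l' = n * l := by linarith [ht.1]
      have e2 : (l' : ℤ) = l := mul_left_cancel₀ hn0.ne' e1
      have e3 : (m' : ℤ) = m := by linarith [ht.2]
      norm_cast at e2 e3
      rw [e2, e3]
    have e1 : (n : ℤ) * l' = n * l + (k' - k) := by linarith [ht.1]
    have e2 : (n : ℤ) * m' = n * m + n * (k' - k) := by
      rw [show (m' : ℤ) = m + (k' - k) by linarith [ht.2]]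
      ring
    have e3 : (0 : ℤ) < k' - k := by omega
    have e4 : (0 : ℤ) < n * (k' - k) := mul_pos hn0 e3
    zify
    linarith
  · rw [norm_zero]
    positivity

theorem alpha1_mono (p n : ℕ) (γt tb : K) (σ : K ≃+* K) (i : ℕ) (w : ℤ × ℤ) :
    alpha1 p n γt tb σ (mono n γt (eps n i)) w
      = σ.symm (Bcoeff p n γt tb (p * w.1 - (eps n i).1, p * w.2 - (eps n i).2) * γt ^ i) := by
  rw [alpha1, psi, mulF, tsum_eq_single (eps n i)]
  · rw [mono, Pi.single_eq_same, zpow_nwt, wt_eps]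
    rfl
  · intro v hv
    rw [mono, Pi.single_eq_of_ne hv, mul_zero]

theorem norm_alpha1_mono (h : FrobeniusData p n γt tb σ) (i : ℕ) (w : ℤ × ℤ) :
    ‖alpha1 p n γt tb σ (mono n γt (eps n i)) w‖
      = ‖Bcoeff p n γt tb (p * w.1 - (eps n i).1, p * w.2 - (eps n i).2)‖ * ‖γt‖ ^ i := by
  rw [alpha1_mono, h.norm_symm, norm_mul, norm_pow]

theorem norm_alpha1_mono_le [IsUltrametricDist K] (h : FrobeniusData p n γt tb σ) {i e : ℕ}
    {w : ℤ × ℤ}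
    (he : ∀ k l m : ℕ, (n : ℤ) * l - k = p * w.1 - (eps n i).1 →
      (m : ℤ) - k = p * w.2 - (eps n i).2 → e ≤ i + n * (k + l + m)) :
    ‖alpha1 p n γt tb σ (mono n γt (eps n i)) w‖ ≤ ‖γt‖ ^ e := by
  rw [h.norm_alpha1_mono]
  have h1 : ‖Bcoeff p n γt tb (p * w.1 - (eps n i).1, p * w.2 - (eps n i).2)‖ ≤ ‖γt‖ ^ (e - i) := by
    refine h.norm_Bcoeff_le fun k l m h1 h2 => ?_
    have := he k l m h1 h2
    omega
  refine (mul_le_mul_of_nonneg_right h1 (by positivity)).trans ?_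
  rw [← pow_add]
  exact pow_le_pow_of_le_one (norm_nonneg _) h.norm_lt_one.le (by omega)

theorem wtBound_alpha1_mono [IsUltrametricDist K] (h : FrobeniusData p n γt tb σ) (i : ℕ) :
    WtBound n γt p 1 (alpha1 p n γt tb σ (mono n γt (eps n i))) := by
  intro w
  rw [one_mul]
  exact h.norm_alpha1_mono_le fun k l m h1 h2 => p_mul_wt_le h1 h2

theorem norm_alpha1_mono_le_succ [IsUltrametricDist K] (h : FrobeniusData p n γt tb σ)
    {i G j : ℕ} {w : ℤ × ℤ}
    (hG : G ≤ 2 * n) (hG2 : (eps n G).2 = (eps n i).2)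
    (hGd : (n : ℤ) ∣ p * (eps n G).1 - (eps n i).1) (hG0 : (eps n i).1 = 0 → (eps n G).1 = 0)
    (hj : j ≤ G) (hw : wt n w = j) (hne : w ≠ eps n G) :
    ‖alpha1 p n γt tb σ (mono n γt (eps n i)) w‖ ≤ ‖γt‖ ^ (p * j + 1) := by
  refine h.norm_alpha1_mono_le fun k l m h1 h2 => ?_
  have h3 := p_mul_wt_le h1 h2
  have h4 : p * wt n w ≠ i + n * (k + l + m) := fun heq =>
    hne (eq_eps_of_p_mul_wt_eq h.two_le h.lt h.coprime hG hG2 hGd hG0 h1 h2 heq (by omega))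
  rw [hw] at h3 h4
  omega

/-- The coefficient of `α₁(ε̃_i)` at `ε_{g(i)}`. -/
theorem norm_alpha1_mono_eps_g [IsUltrametricDist K] [CompleteSpace K]
    (h : FrobeniusData p n γt tb σ) {i G : ℕ} (hi : i ≤ 2 * n)
    (hG : G ≤ 2 * n) (hG2 : (eps n G).2 = (eps n i).2)
    (hGd : (n : ℤ) ∣ p * (eps n G).1 - (eps n i).1) (hG0 : (eps n i).1 = 0 → (eps n G).1 = 0)
    (hG1 : 0 < (eps n i).1 → 0 < (eps n G).1) :
    ‖alpha1 p n γt tb σ (mono n γt (eps n i)) (eps n G)‖ = ‖γt‖ ^ (p * G) := by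
  have hn0 : (0 : ℤ) < n := by exact_mod_cast (by have := h.two_le; omega : 0 < n)
  have hpn : (n : ℤ) < p := by exact_mod_cast h.lt
  have e0 := eps_fst_add n i
  have e1 := eps_fst_nonneg n i
  have e1' := eps_fst_le hi
  have e2 := eps_snd_nonneg n i
  have e2' := eps_snd_le_one n i
  have E0 := eps_fst_add n G
  have E1 := eps_fst_le hG
  obtain ⟨c, hc⟩ := hGd
  have hc0 : 0 ≤ c := by
    by_contra hneg
    have h1 : (n : ℤ) * c < 0 := mul_neg_of_pos_of_neg hn0 (by omega)
    rcases e1.eq_or_lt with h0 | h0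
    · rw [← h0, hG0 h0.symm] at hc
      simp at hc
      omega
    · have : (p : ℤ) * 1 ≤ p * (eps n G).1 :=
        mul_le_mul_of_nonneg_left (hG1 h0) (by omega)
      linarith
  have hcp : c < p := by
    refine lt_of_mul_lt_mul_left (a := (n : ℤ)) ?_ hn0.le
    rw [← hc]
    rcases e1.eq_or_lt with h0 | h0
    · rw [← h0, hG0 h0.symm]
      simp only [mul_zero, sub_zero]
      exact mul_pos hn0 (by omega)
    · have : (p : ℤ) * (eps n G).1 ≤ p * n := mul_le_mul_of_nonneg_left E1 (by omega)
      linarith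
  obtain ⟨l, rfl⟩ := Int.eq_ofNat_of_zero_le hc0
  obtain ⟨e, he⟩ := Int.eq_ofNat_of_zero_le e2
  have he1 : e ≤ 1 := by omega
  have hp1 : 1 ≤ p := by omega
  have hm : (((p - 1) * e : ℕ) : ℤ) = p * (eps n i).2 - (eps n i).2 := by
    rw [he]
    push_cast [Nat.cast_sub hp1]
    ring
  -- The dominant term uses no factor 1/(xy): l = (p ε_G − ε_i)₁ / n and m = (p − 1)(ε_i)₂.
  rw [h.norm_alpha1_mono, h.norm_Bcoeff_eq (k := 0) (l := l) (m := (p - 1) * e), ← pow_add]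
  · congr 1
    zify
    push_cast at hm
    rw [Nat.cast_sub hp1] at hm ⊢
    push_cast at hm ⊢
    rw [← E0, hG2, ← e0]
    linear_combination -hc + n * hm
  · simp only [Nat.cast_zero, sub_zero]
    exact hc.symm
  · simp only [Nat.cast_zero, sub_zero, hG2]
    exact hm
  · omega
  · exact_mod_cast hcp
  · calc (p - 1) * e ≤ (p - 1) * 1 := Nat.mul_le_mul_left _ he1
      _ < p := by omega
  · intros
    omega

/-- The coefficient of `α₁(ε̃_i)` at `ε_j`, for `i ≤ n` and `j < n`. -/
theorem norm_alpha1_mono_eps [IsUltrametricDist K] [CompleteSpace K] (h : FrobeniusData p n γt tb σ)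
    {i j α : ℕ}
    (hi : i ≤ n) (hj : j < n) (hij : ¬ (i = n ∧ j = 0)) (hα : (α : ℤ) = (i - p * j : ℤ) % n) :
    ‖alpha1 p n γt tb σ (mono n γt (eps n i)) (eps n j)‖ = ‖γt‖ ^ (p * j + (2 * n + 1) * α) := by
  have hn0 : (0 : ℤ) < n := by exact_mod_cast (by have := h.two_le; omega : 0 < n)
  have hpn : (n : ℤ) < p := by exact_mod_cast h.lt
  have hαn : (α : ℤ) < n := by rw [hα]; exact Int.emod_lt_of_pos _ hn0
  have ei : eps n i = ((i : ℤ), 0) := by rw [eps, if_pos hi]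
  have ej : eps n j = ((j : ℤ), 0) := by rw [eps, if_pos hj.le]
  have hi' : (i : ℤ) ≤ n := by exact_mod_cast hi
  have hd : (n : ℤ) ∣ p * j - i + α := by
    have : (n : ℤ) ∣ (i - p * j : ℤ) - (i - p * j : ℤ) % n := Int.dvd_self_sub_emod
    rw [← hα] at this
    rw [← dvd_neg, show -(p * j - i + α : ℤ) = i - p * j - α by ring]
    exact this
  obtain ⟨c, hc⟩ := hd
  have hc0 : 0 ≤ (n : ℤ) * c := by
    rw [← hc]
    -- For j = 0 and i = n one would have α = 0 and c = −1, which is not a power of x^n; this is the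
    -- excluded pair.
    rcases Nat.eq_zero_or_pos j with rfl | hj0
    · have : (α : ℤ) = i := by
        rw [hα]
        simp only [Nat.cast_zero, mul_zero, sub_zero]
        exact Int.emod_eq_of_lt (by positivity) (by omega)
      simp [this]
    · have : (p : ℤ) * 1 ≤ p * j := mul_le_mul_of_nonneg_left (by omega) (by omega)
      linarith
  have hc0' : 0 ≤ c := nonneg_of_mul_nonneg_right hc0 hn0
  have hcp : c < p := by
    refine lt_of_mul_lt_mul_left (a := (n : ℤ)) ?_ hn0.le
    have : (p : ℤ) * j ≤ p * (n - 1) := mul_le_mul_of_nonneg_left (by omega) (by omega)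
    rw [← hc]
    linarith
  obtain ⟨l, rfl⟩ := Int.eq_ofNat_of_zero_le hc0'
  -- The least number of factors 1/(xy) is α, and each needs a factor y in return. With n l = p j −
  -- i + α the exponent i + n(2α + l) equals p j + (2n+1)α.
  rw [h.norm_alpha1_mono, ei, ej, h.norm_Bcoeff_eq (k := α) (l := l) (m := α), ← pow_add]
  · congr 1
    zify
    linear_combination -hc
  · simp only
    linarith
  · simp
  · omega
  · exact_mod_cast hcp
  · omega
  · intro k' l' m' h1 _
    simp only at h1
    have h2 : (i - p * j : ℤ) % n = k' % n := by
      rw [show (i - p * j : ℤ) = k' + n * (-l') by linarith, Int.add_mul_emod_self_left]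
    have h3 : (k' : ℤ) % n ≤ k' := by
      have := Int.emod_add_mul_ediv k' n
      have h4 : 0 ≤ (n : ℤ) * (k' / n) := mul_nonneg hn0.le (Int.ediv_nonneg (by positivity) hn0.le)
      linarith
    rw [← h2, ← hα] at h3
    exact_mod_cast h3

/-- The Frobenius matrix exists and its entries have the expected absolute values. -/
theorem exists_matrix [IsUltrametricDist K] [CompleteSpace K] (h : FrobeniusData p n γt tb σ) :
    ∃ A : Matrix (Fin (2 * n + 1)) (Fin (2 * n + 1)) K, IsFrobeniusMatrix p n γt tb σ A ∧
      (∀ i j, ‖A j i‖ ≤ ‖γt‖ ^ ((p - 1) * (j : ℕ))) ∧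
      (∀ i j : Fin (2 * n + 1), (j : ℤ) < g p n i → ‖A j i‖ ≤ ‖γt‖ ^ ((p - 1) * (j : ℕ) + 1)) ∧
      (∀ i : Fin (2 * n + 1), ∃ j : Fin (2 * n + 1), (j : ℤ) = g p n i ∧
        ‖A j i‖ = ‖γt‖ ^ ((p - 1) * (j : ℕ))) ∧
      (2 * n ^ 2 - n < (p : ℤ) → ∀ i j : Fin (2 * n + 1), (i : ℕ) ≤ n → (j : ℕ) < n →
        ¬ ((i : ℕ) = n ∧ (j : ℕ) = 0) → ∀ α : ℕ, (α : ℤ) = alphaCoef p n i j →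
          ‖A j i‖ = ‖γt‖ ^ ((p - 1) * (j : ℕ) + (2 * n + 1) * α)) := by
  have h3 := h.three_le
  have hn := h.two_le
  have hπ := h.norm_pos
  have hπ1 := h.norm_lt_one
  have hβ := fun i : Fin (2 * n + 1) => h.wtBound_alpha1_mono i
  have hβ2 : ∀ i : Fin (2 * n + 1),
      WtBound n γt 2 1 (alpha1 p n γt tb σ (mono n γt (eps n i))) := fun i u =>
    (hβ i u).trans (mul_le_mul_of_nonneg_left (pow_le_pow_of_le_one hπ.le hπ1.le
      (Nat.mul_le_mul_right _ (by omega))) zero_le_one)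
  choose v zx zy hv hzx hzy hbound hlead using fun i => h.toOperatorData.exists_reduction (hβ2 i)
  have hvle : ∀ i j, ‖v i j‖ ≤ ‖γt‖ ^ (p * (j : ℕ)) := by
    intro i j
    have := hbound i (p - 1) 1 (by omega) (by rw [Nat.sub_add_cancel (by omega)]; exact hβ i) j
    rwa [Nat.sub_add_cancel (by omega), one_mul] at this
  have hsplit : ∀ j : ℕ, p * j = (p - 1) * j + j := fun j => by
    rw [← Nat.succ_mul, Nat.succ_eq_add_one, Nat.sub_add_cancel (by omega)]
  have hA : ∀ i (j : Fin (2 * n + 1)), ‖v i j / γt ^ (j : ℕ)‖ = ‖v i j‖ / ‖γt‖ ^ (j : ℕ) :=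
    fun i j => by rw [norm_div, norm_pow]
  have hAle : ∀ i (j : Fin (2 * n + 1)) (e : ℕ), ‖v i j‖ ≤ ‖γt‖ ^ (p * (j : ℕ) + e) →
      ‖v i j / γt ^ (j : ℕ)‖ ≤ ‖γt‖ ^ ((p - 1) * (j : ℕ) + e) := by
    intro i j e he
    rw [hA, div_le_iff₀ (by positivity), ← pow_add, add_right_comm, ← hsplit]
    exact he
  have hAeq : ∀ i (j : Fin (2 * n + 1)) (e : ℕ), ‖v i j‖ = ‖γt‖ ^ (p * (j : ℕ) + e) →
      ‖v i j / γt ^ (j : ℕ)‖ = ‖γt‖ ^ ((p - 1) * (j : ℕ) + e) := by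
    intro i j e he
    rw [hA, div_eq_iff (by positivity), ← pow_add, add_right_comm, ← hsplit]
    exact he
  have hAle0 : ∀ i (j : Fin (2 * n + 1)),
      ‖v i j / γt ^ (j : ℕ)‖ ≤ ‖γt‖ ^ ((p - 1) * (j : ℕ)) := fun i j => hAle i j 0 (hvle i j)
  -- Division by γ̃^j passes from ε_j to ε̃_j and lowers the exponent p j to (p − 1) j.
  refine ⟨fun j i => v i j / γt ^ (j : ℕ), ⟨?_, ?_⟩, hAle0, ?_, ?_, ?_⟩
  · exact fun j i => (hAle0 i j).trans (pow_le_one₀ hπ.le hπ1.le)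
  · intro i
    refine ⟨zx i, mem_C0_of_wtBound (by omega) hπ hπ1 (hzx i), zy i,
      mem_C0_of_wtBound (by omega) hπ hπ1 (hzy i), ?_⟩
    rw [sum_smul_mono]
    have hvv : (fun j : Fin (2 * n + 1) => v i j / γt ^ (j : ℕ) * γt ^ (j : ℕ)) = v i := by
      funext j
      exact div_mul_cancel₀ _ (pow_ne_zero _ h.gt_ne_zero)
    rw [hvv]
    nth_rewrite 1 [hv i]
    abel
  · intro i j hj
    obtain ⟨G, hG, hGg, hG2, hGd, hG0, -⟩ :=
      exists_g_eq hn h.coprime (Nat.lt_succ_iff.1 i.2)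
    have hjG : (j : ℕ) < G := by rw [← hGg] at hj; exact_mod_cast hj
    refine hAle i j 1 ?_
    have hne : ∀ w, wt n w = (j : ℕ) → w ≠ eps n G := by
      rintro w hw rfl
      rw [wt_eps] at hw
      omega
    have hle := fun w hw => h.norm_alpha1_mono_le_succ hG hG2 hGd hG0 hjG.le hw (hne w hw)
    have h1 := hlead i 1 (hβ i) j (‖γt‖ ^ (p * (j : ℕ) + 1))
      (by rw [one_mul]; exact pow_le_pow_of_le_one hπ.le hπ1.le (by omega)) fun w hw _ => hle w hw
    have h2 := hle (eps n j) (wt_eps n j)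
    simpa using norm_add_le_of_le h1 h2
  · intro i
    obtain ⟨G, hG, hGg, hG2, hGd, hG0, hG1⟩ :=
      exists_g_eq hn h.coprime (Nat.lt_succ_iff.1 i.2)
    refine ⟨⟨G, by omega⟩, hGg, hAeq i ⟨G, by omega⟩ 0 ?_⟩
    have h1 := hlead i 1 (hβ i) ⟨G, by omega⟩ (‖γt‖ ^ (p * G + 1))
      (by rw [one_mul]; exact pow_le_pow_of_le_one hπ.le hπ1.le (by simp only; omega))
      fun w hw hne => h.norm_alpha1_mono_le_succ hG hG2 hGd hG0 le_rfl hw hne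
    have h2 := h.norm_alpha1_mono_eps_g (Nat.lt_succ_iff.1 i.2) hG hG2 hGd hG0 hG1
    refine (norm_eq_of_norm_sub_lt (h1.trans_lt ?_)).trans h2
    simp only
    rw [h2]
    exact pow_lt_pow_right_of_lt_one₀ hπ hπ1 (Nat.lt_succ_self _)
  · intro hp i j hi hj hij α hα
    rw [alphaCoef_eq] at hα
    refine hAeq i j _ ?_
    have hn0 : (0 : ℤ) < n := by exact_mod_cast (by omega : 0 < n)
    have hαn : (α : ℤ) < n := by rw [hα]; exact Int.emod_lt_of_pos _ hn0
    -- As α ≤ n − 1, the excess is at most 2n² − n − 1, so the leading term beats the reduction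
    -- error exactly in the stated range of p.
    have hlt : (2 * n + 1) * α < p - 1 := by
      have h5 : (2 * (n : ℤ) + 1) * α ≤ (2 * n + 1) * (n - 1) :=
        mul_le_mul_of_nonneg_left (by omega) (by positivity)
      zify [show 1 ≤ p by omega]
      linarith
    have h1 := hlead i 1 (hβ i) j (‖γt‖ ^ (p * (j : ℕ) + (p - 1))) (by rw [one_mul])
      fun w hw hne => absurd (eq_eps_of_wt_lt hw hj) hne
    have h2 := h.norm_alpha1_mono_eps hi hj hij hα
    refine (norm_eq_of_norm_sub_lt (h1.trans_lt ?_)).trans h2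
    rw [h2]
    exact pow_lt_pow_right_of_lt_one₀ hπ hπ1 (by omega)

end FrobeniusData

end

/-! ### The field `ℚ_q(ζ_p, γ̃)` -/

section

variable {K : Type*} [NormedField K]

theorem logb_norm_eq {p n : ℕ} (hp : 1 < p) (hn : 0 < n) {x : K}
    (hx : ‖x‖ ^ (n * (p - 1)) = (p : ℝ)⁻¹) : Real.logb p ‖x‖ = -(1 / (n * ((p : ℝ) - 1))) := by
  have hp' : (1 : ℝ) < p := by exact_mod_cast hp
  have hn' : (0 : ℝ) < n := by exact_mod_cast hn
  have h := congrArg (Real.logb p) hx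
  rw [Real.logb_pow, Real.logb_inv, Real.logb_self_eq_one hp'] at h
  push_cast [Nat.cast_sub hp.le] at h
  have h1 : (p : ℝ) - 1 ≠ 0 := by linarith
  field_simp
  linarith

theorem ordp_of_norm_eq_pow {p n N : ℕ} (hp : 1 < p) (hn : 0 < n) {x y : K}
    (hx : ‖x‖ ^ (n * (p - 1)) = (p : ℝ)⁻¹) (hx0 : 0 < ‖x‖) (hy : ‖y‖ = ‖x‖ ^ N) :
    ordp p y = ((N / (n * ((p : ℝ) - 1)) : ℝ) : EReal) := by
  have hy0 : y ≠ 0 := by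
    rw [← norm_pos_iff, hy]
    positivity
  rw [ordp, if_neg hy0, hy, Real.logb_pow, logb_norm_eq hp hn hx]
  congr 1
  ring

theorem le_ordp_of_norm_le_pow {p n N : ℕ} (hp : 1 < p) (hn : 0 < n) {x y : K}
    (hx : ‖x‖ ^ (n * (p - 1)) = (p : ℝ)⁻¹) (hy : ‖y‖ ≤ ‖x‖ ^ N) :
    ((N / (n * ((p : ℝ) - 1)) : ℝ) : EReal) ≤ ordp p y := by
  rw [ordp]
  split_ifs with hy0
  · exact le_top
  · rw [EReal.coe_le_coe_iff]
    have hp' : (1 : ℝ) < p := by exact_mod_cast hp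
    have h := Real.logb_le_logb_of_le hp' (norm_pos_iff.2 hy0) hy
    rw [Real.logb_pow, logb_norm_eq hp hn hx] at h
    calc (N : ℝ) / (n * ((p : ℝ) - 1)) = -(N * -(1 / (n * ((p : ℝ) - 1)))) := by ring
      _ ≤ _ := neg_le_neg h

/-- Each partial sum of the series `∑ γ^(p^k)/p^k = 0` is as small as the first omitted term. -/
theorem norm_gammaSeq_le [IsUltrametricDist K] {p : ℕ} (hp : 1 < p) {γ : K}
    (hpK : ‖(p : K)‖ = (p : ℝ)⁻¹) (hγ : ‖γ‖ ^ (p - 1) = (p : ℝ)⁻¹) (hγ1 : ‖γ‖ ≤ 1)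
    (hsum : HasSum (fun k : ℕ => γ ^ p ^ k / (p : K) ^ k) 0) (i : ℕ) :
    ‖gammaSeq p γ i * (p : K) ^ i‖ * ‖γ‖ ^ (p - 1) ≤ ‖γ‖ ^ p ^ (i + 1) := by
  have hp0 : (0 : ℝ) < p := by exact_mod_cast (by omega : 0 < p)
  have hterm : ∀ k : ℕ, ‖γ ^ p ^ k / (p : K) ^ k‖ = ‖γ‖ ^ p ^ k * (p : ℝ) ^ k := by
    intro k
    rw [norm_div, norm_pow, norm_pow, hpK, inv_pow, div_inv_eq_mul]
  have hstep : ∀ k : ℕ, ‖γ‖ ^ p ^ (k + 1) * (p : ℝ) ^ (k + 1) ≤ ‖γ‖ ^ p ^ k * (p : ℝ) ^ k := by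
    intro k
    have h1 : p ^ k + (p - 1) ≤ p ^ (k + 1) := by
      have h2 : 1 ≤ p ^ k := Nat.one_le_pow _ _ (by omega)
      have h3 : p ^ (k + 1) = p ^ k + p ^ k * (p - 1) := by
        rw [pow_succ, ← mul_one_add, Nat.add_sub_cancel' hp.le]
      rw [h3]
      exact Nat.add_le_add_left (Nat.le_mul_of_pos_left _ h2) _
    have h2 : ‖γ‖ ^ p ^ (k + 1) ≤ ‖γ‖ ^ p ^ k * (p : ℝ)⁻¹ := by
      rw [← hγ, ← pow_add]
      exact pow_le_pow_of_le_one (norm_nonneg _) hγ1 h1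
    calc ‖γ‖ ^ p ^ (k + 1) * (p : ℝ) ^ (k + 1)
        ≤ ‖γ‖ ^ p ^ k * (p : ℝ)⁻¹ * (p : ℝ) ^ (k + 1) :=
          mul_le_mul_of_nonneg_right h2 (by positivity)
      _ = ‖γ‖ ^ p ^ k * (p : ℝ) ^ k := by
          rw [pow_succ]
          field_simp
  have hanti : Antitone fun k : ℕ => ‖γ‖ ^ p ^ k * (p : ℝ) ^ k := antitone_nat_of_succ_le hstep
  -- The full sum is zero, so the partial sum is minus the tail, which is bounded by its first term
  -- because the norms of the terms do not increase.
  have h1 := ((hasSum_nat_add_iff' (i + 1)).2 hsum).tsum_eq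
  have h2 : gammaSeq p γ i = -∑' k : ℕ, γ ^ p ^ (k + (i + 1)) / (p : K) ^ (k + (i + 1)) := by
    rw [h1, gammaSeq]
    ring
  have h3 : ‖gammaSeq p γ i‖ ≤ ‖γ‖ ^ p ^ (i + 1) * (p : ℝ) ^ (i + 1) := by
    rw [h2, norm_neg]
    refine IsUltrametricDist.norm_tsum_le_of_forall_le_of_nonneg (by positivity) fun k => ?_
    rw [hterm]
    exact hanti (by omega)
  rw [norm_mul, norm_pow, hpK, hγ, mul_assoc, ← pow_succ, inv_pow, ← div_eq_mul_inv,
    div_le_iff₀ (by positivity)]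
  exact h3

end

/-! ### The constants over ℚ_p and the extension generated by them. -/

variable {p : ℕ} [Fact p.Prime]

section

variable {K : Type*} [NormedField K] [NormedAlgebra ℚ_[p] K]

variable (p K) in
theorem norm_ratCast_eq (q : ℚ) : ‖(q : K)‖ = ‖(q : ℚ_[p])‖ := by
  rw [← norm_algebraMap' K (q : ℚ_[p]), map_ratCast]

variable (p K) in
theorem norm_natCast_eq (m : ℕ) : ‖(m : K)‖ = ‖(m : ℚ_[p])‖ := by
  exact_mod_cast norm_ratCast_eq p K m

theorem norm_thetaCoeff_le (γ : K) (k : ℕ) : ‖thetaCoeff p γ k‖ ≤ ‖γ‖ ^ k := by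
  rw [thetaCoeff, norm_mul, norm_pow, norm_ratCast_eq p K]
  exact mul_le_of_le_one_left (by positivity) (norm_coeff_artinHasse_le k)

theorem norm_thetaCoeff_of_lt (γ : K) {k : ℕ} (hk : k < p) : ‖thetaCoeff p γ k‖ = ‖γ‖ ^ k := by
  have hp : p.Prime := Fact.out
  have h1 : ‖((k.factorial : ℕ) : ℚ_[p])‖ = 1 := by
    rw [Padic.norm_natCast_eq_one_iff, hp.coprime_iff_not_dvd, hp.dvd_factorial]
    omega
  rw [thetaCoeff, norm_mul, norm_pow, norm_ratCast_eq p K, coeff_artinHasse_of_lt hk]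
  push_cast
  rw [norm_div, norm_one, h1, div_one, one_mul]

end

theorem norm_pow_of_isDworkRoot {ζ γ : ℂ_[p]} (hγ : IsDworkRoot p ζ γ) :
    ‖γ‖ ^ (p - 1) = (p : ℝ)⁻¹ := by
  have hp : p.Prime := Fact.out
  have hp1 : (1 : ℝ) < p := by exact_mod_cast hp.one_lt
  have h := hγ.2.2
  rw [ordp] at h
  split_ifs at h with h0
  · exact absurd h (EReal.top_ne_coe _)
  rw [EReal.coe_eq_coe_iff] at h
  have h1 : Real.logb p ‖γ‖ = -(1 / ((p : ℝ) - 1)) := by linarith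
  have h2 : Real.logb p (‖γ‖ ^ (p - 1)) = -1 := by
    rw [Real.logb_pow, h1, Nat.cast_sub hp.one_lt.le]
    have : (p : ℝ) - 1 ≠ 0 := by linarith
    field_simp
    push_cast
    ring
  have h3 := Real.rpow_logb (by linarith) hp1.ne' (pow_pos (norm_pos_iff.2 h0) (p - 1))
  rw [← h3, h2, Real.rpow_neg_one]

/-- Finiteness gives completeness of the field and the isometry of its automorphisms. The generators
are roots of unity or zero, and γ̃, whose n-th power γ lies in ℚ_p(ζ). -/
theorem finiteDimensional_Omega {n a : ℕ} (hn : 0 < n) (ha : 1 ≤ a) {ζ γ γt : ℂ_[p]}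
    (hζ : IsPrimitiveRoot ζ p) (hγ : IsDworkRoot p ζ γ) (hγt : γt ^ n = γ) :
    FiniteDimensional ℚ_[p] (Omega p a ζ γt) := by
  have hp : p.Prime := Fact.out
  have hq : 1 < p ^ a := Nat.one_lt_pow (by omega) hp.one_lt
  have hfin : ({z : ℂ_[p] | z ^ p ^ a = z} ∪ {ζ, γt}).Finite := by
    refine Set.Finite.union ?_ (Set.toFinite _)
    have hne : (Polynomial.X ^ p ^ a - Polynomial.X : Polynomial ℂ_[p]) ≠ 0 :=
      FiniteField.X_pow_card_sub_X_ne_zero ℂ_[p] hq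
    refine (Polynomial.rootSet_finite (Polynomial.X ^ p ^ a - Polynomial.X : Polynomial ℂ_[p])
      ℂ_[p]).subset fun z hz => ?_
    rw [Polynomial.mem_rootSet]
    refine ⟨hne, ?_⟩
    simpa [sub_eq_zero] using hz
  have : Finite ({z : ℂ_[p] | z ^ p ^ a = z} ∪ {ζ, γt} : Set ℂ_[p]) := hfin
  have hζi : IsIntegral ℚ_[p] ζ := by
    refine IsIntegral.of_pow hp.pos ?_
    rw [hζ.pow_eq_one]
    exact isIntegral_one
  have hγi : IsIntegral ℚ_[p] γ := by
    have := IntermediateField.isAlgebraic_adjoin_simple hζi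
    have h1 := (Algebra.IsAlgebraic.isAlgebraic (R := ℚ_[p])
      (⟨γ, hγ.1⟩ : IntermediateField.adjoin ℚ_[p] {ζ})).isIntegral
    exact h1.map (IntermediateField.adjoin ℚ_[p] {ζ}).val
  refine IntermediateField.finiteDimensional_adjoin fun z hz => ?_
  rcases hz with hz | rfl | rfl
  · rw [Set.mem_ofPred_eq] at hz
    rcases eq_or_ne z 0 with rfl | h0
    · exact isIntegral_zero
    · refine IsIntegral.of_pow (n := p ^ a - 1) (by omega) ?_
      have : z ^ (p ^ a - 1) = 1 := by
        refine mul_right_cancel₀ h0 ?_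
        rw [← pow_succ, Nat.sub_add_cancel hq.le, hz, one_mul]
      rw [this]
      exact isIntegral_one
  · exact hζi
  · refine IsIntegral.of_pow hn ?_
    rw [hγt]
    exact hγi

/-- The norm is the spectral norm, which is determined by minimal polynomials. -/
theorem norm_algEquiv {K : Type*} [NormedField K] [NormedAlgebra ℚ_[p] K]
    [FiniteDimensional ℚ_[p] K] (σ : K ≃ₐ[ℚ_[p]] K) (x : K) : ‖σ x‖ = ‖x‖ := by
  rw [NormedAlgebra.norm_eq_spectralNorm ℚ_[p], NormedAlgebra.norm_eq_spectralNorm ℚ_[p],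
    ← spectralNorm_eq_of_equiv]

theorem norm_gammaIn_pow {n a : ℕ} {ζ γ γt : ℂ_[p]} (hγ : IsDworkRoot p ζ γ) (hγt : γt ^ n = γ) :
    ‖gammaIn p a ζ γt‖ ^ (n * (p - 1)) = (p : ℝ)⁻¹ := by
  rw [← norm_pow_of_isDworkRoot hγ, ← hγt, norm_pow, ← pow_mul]
  rfl

theorem coe_gammaSeq (E : IntermediateField ℚ_[p] ℂ_[p]) (γ : E) (i : ℕ) :
    ((gammaSeq p γ i : E) : ℂ_[p]) = gammaSeq p (γ : ℂ_[p]) i := by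
  simp [gammaSeq]

theorem frobeniusData_Omega {n a : ℕ} (hn : 2 ≤ n) (ha : 1 ≤ a) (hpn : n < p)
    {ζ γ γt : ℂ_[p]} (hζ : IsPrimitiveRoot ζ p) (hγ : IsDworkRoot p ζ γ) (hγt : γt ^ n = γ)
    (σ : Omega p a ζ γt ≃ₐ[ℚ_[p]] Omega p a ζ γt) {tb : Omega p a ζ γt}
    (htb : tb ^ (p ^ a - 1) = 1) :
    FrobeniusData p n (gammaIn p a ζ γt) tb σ.toRingEquiv := by
  have hp : p.Prime := Fact.out
  have hq : 1 < p ^ a := Nat.one_lt_pow (by omega) hp.one_lt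
  have hcop : Nat.Coprime p n :=
    (hp.coprime_iff_not_dvd).2 fun hd => absurd (Nat.le_of_dvd (by omega) hd) (by omega)
  have hfd := finiteDimensional_Omega (by omega : 0 < n) ha hζ hγ hγt
  have hpow := norm_pow_of_isDworkRoot hγ
  have hnorm : ‖gammaIn p a ζ γt‖ ^ n = ‖γ‖ := by rw [← hγt, norm_pow]; rfl
  have hp1 : (1 : ℝ) < p := by exact_mod_cast hp.one_lt
  have hγ0 : 0 < ‖γ‖ := by
    refine lt_of_le_of_ne (norm_nonneg _) fun h0 => ?_
    rw [← h0, zero_pow (by have := hp.two_le; omega)] at hpow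
    have : (0 : ℝ) < (p : ℝ)⁻¹ := by positivity
    linarith
  have hγ1 : ‖γ‖ < 1 := by
    by_contra hc
    have h1 := one_le_pow₀ (n := p - 1) (not_lt.1 hc)
    rw [hpow] at h1
    exact absurd (inv_lt_one_of_one_lt₀ hp1) (not_lt.2 h1)
  have htn : ‖tb‖ = 1 := by
    have h1 := congrArg norm htb
    rw [norm_pow, norm_one] at h1
    exact (pow_eq_one_iff_of_nonneg (norm_nonneg _) (by omega)).1 h1
  refine
    { two_le := hn
      norm_pos := ?_
      norm_lt_one := ?_
      norm_natCast := ?_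
      norm_t := htn
      lt := hpn
      norm_iterate := ?_
      norm_gammaSeq := ?_
      coprime := hcop
      norm_theta := ?_
      norm_theta_eq := ?_
      norm_symm := fun x => norm_algEquiv σ.symm x }
  · refine lt_of_le_of_ne (norm_nonneg _) fun h0 => ?_
    rw [← h0, zero_pow (by omega)] at hnorm
    exact hγ0.ne hnorm
  · by_contra hc
    have h1 := one_le_pow₀ (n := n) (not_lt.1 hc)
    rw [hnorm] at h1
    exact absurd hγ1 (not_lt.2 h1)
  · rw [norm_natCast_eq p, Padic.norm_natCast_eq_one_iff]
    exact hcop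
  · intro i
    induction i with
    | zero => exact htn
    | succ i ih =>
      rw [Function.iterate_succ_apply']
      exact (norm_algEquiv σ _).trans ih
  · intro i
    have h1 := norm_gammaSeq_le hp.one_lt
      (by rw [norm_natCast_eq p, Padic.norm_p]) hpow hγ1.le hγ.2.1 i
    rw [pow_mul, hnorm, pow_mul, hnorm]
    refine le_trans (le_of_eq ?_) h1
    congr 1
    have h2 : ((gammaSeq p (gammaIn p a ζ γt ^ n) i : Omega p a ζ γt) : ℂ_[p])
        = gammaSeq p γ i := by
      rw [coe_gammaSeq, ← hγt]
      rfl
    rw [← h2, norm_mul, norm_mul, norm_pow, norm_pow,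
      norm_natCast_eq p (Omega p a ζ γt), norm_natCast_eq p ℂ_[p]]
    rfl
  · intro k
    rw [pow_mul, ← norm_pow]
    exact norm_thetaCoeff_le _ k
  · intro k hk
    rw [pow_mul, ← norm_pow]
    exact norm_thetaCoeff_of_lt _ hk

end Dwork

end

/-! ### From norms to valuations. -/

theorem theorem2p15 (p n a : ℕ) [Fact p.Prime] (hn : 2 ≤ n) (ha : 1 ≤ a) (hpn : n < p)
    (ζ γ γt : ℂ_[p]) (hζ : IsPrimitiveRoot ζ p) (hγ : Dwork.IsDworkRoot p ζ γ)
    (hγt : γt ^ n = γ)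
    (σ : Dwork.Omega p a ζ γt ≃ₐ[ℚ_[p]] Dwork.Omega p a ζ γt) (hσ : Dwork.IsFrobenius σ)
    (tb : Dwork.Omega p a ζ γt) (htb : tb ^ (p ^ a - 1) = 1) :
    ∃ A : Matrix (Fin (2 * n + 1)) (Fin (2 * n + 1)) (Dwork.Omega p a ζ γt),
      -- `A` is the matrix of the coefficients `Ã(ε̃_j, ε̃_i)`, which are well defined
      Dwork.IsFrobeniusMatrix p n (Dwork.gammaIn p a ζ γt) tb σ.toRingEquiv A ∧
      (∀ A', Dwork.IsFrobeniusMatrix p n (Dwork.gammaIn p a ζ γt) tb σ.toRingEquiv A' → A' = A) ∧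
      -- (a)
      (∀ i j : Fin (2 * n + 1), (((j : ℝ) / n : ℝ) : EReal) ≤ Dwork.ordp p (A j i)) ∧
      -- (b)
      (∀ i j : Fin (2 * n + 1), (j : ℤ) < Dwork.g p n i →
        (((j : ℝ) / n : ℝ) : EReal) < Dwork.ordp p (A j i)) ∧
      (∀ i : Fin (2 * n + 1), ∃ j : Fin (2 * n + 1), (j : ℤ) = Dwork.g p n i ∧
        Dwork.ordp p (A j i) = (((Dwork.g p n i : ℝ) / n : ℝ) : EReal)) ∧
      -- (c)
      (2 * n ^ 2 - n < (p : ℤ) → ∀ i j : Fin (2 * n + 1), (i : ℕ) ≤ n → (j : ℕ) ≤ n - 1 →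
        ¬ ((i : ℕ) = n ∧ (j : ℕ) = 0) →
        Dwork.ordp p (A j i) =
          (((j : ℝ) / n + (2 * n + 1) * (Dwork.alphaCoef p n i j : ℝ) / (n * ((p : ℝ) - 1)) : ℝ)
            : EReal)) := by
  have hp : p.Prime := Fact.out
  have hp1 : (0 : ℝ) < (p : ℝ) - 1 := by
    have : (1 : ℝ) < p := by exact_mod_cast hp.one_lt
    linarith
  have hn0 : 0 < n := by omega
  have hn0' : (0 : ℝ) < n := by exact_mod_cast hn0
  have hfd := Dwork.finiteDimensional_Omega hn0 ha hζ hγ hγt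
  have hcomplete : CompleteSpace (Dwork.Omega p a ζ γt) := FiniteDimensional.complete ℚ_[p] _
  have hF := Dwork.frobeniusData_Omega hn ha hpn hζ hγ hγt σ htb
  have hπ := Dwork.norm_gammaIn_pow (a := a) hγ hγt
  -- Since ord_p γ̃ = 1/(n(p − 1)), the exponent (p − 1) j of |γ̃| has order j/n.
  have hdiv : ∀ j : ℕ, (((p - 1) * j : ℕ) : ℝ) / (n * ((p : ℝ) - 1)) = (j : ℝ) / n := by
    intro j
    rw [Nat.cast_mul, Nat.cast_sub hp.one_lt.le, Nat.cast_one]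
    field_simp
  obtain ⟨A, hA, hle, hlt, heq, hc⟩ := hF.exists_matrix
  refine ⟨A, hA, fun A' hA' => hF.toOperatorData.isFrobeniusMatrix_unique hA hA', ?_, ?_, ?_, ?_⟩
  · intro i j
    rw [← hdiv]
    exact Dwork.le_ordp_of_norm_le_pow hp.one_lt hn0 hπ (hle i j)
  · intro i j hj
    refine lt_of_lt_of_le ?_ (Dwork.le_ordp_of_norm_le_pow hp.one_lt hn0 hπ (hlt i j hj))
    rw [EReal.coe_lt_coe_iff, ← hdiv]
    refine div_lt_div_of_pos_right ?_ (mul_pos hn0' hp1)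
    exact_mod_cast Nat.lt_succ_self _
  · intro i
    obtain ⟨j, hj, hAj⟩ := heq i
    refine ⟨j, hj, ?_⟩
    rw [Dwork.ordp_of_norm_eq_pow hp.one_lt hn0 hπ hF.norm_pos hAj, hdiv, ← hj, Int.cast_natCast]
  · intro hp2 i j hi hj hij
    have h0 : 0 ≤ Dwork.alphaCoef p n i j := by
      rw [Dwork.alphaCoef_eq]
      exact Int.emod_nonneg _ (by omega)
    obtain ⟨α, hα⟩ := Int.eq_ofNat_of_zero_le h0
    have hAj := hc hp2 i j hi (by omega) hij α hα.symm
    rw [Dwork.ordp_of_norm_eq_pow hp.one_lt hn0 hπ hF.norm_pos hAj, hα, Int.cast_natCast,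
      Nat.cast_add, add_div, hdiv]
    push_cast
    rfl
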